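/- All digraphs are finite, parallel arcs are allowed, and paths are simple directed paths, identified with their arc sets. For a node set $U$, $\delta^+(U)$ and $\delta^-(U)$ denote the sets of arcs leaving and entering $U$. **MRF-R$^\star$.** An instance consists of a directed acyclic graph $D=(V,A)$ with unit arc capacities, nodes $s\neq t$, an interdiction budget $k\in\mathbb N$ with $1\le k\le |A|$, a compatibility graph $H=(A,E_H)$ and a demand $\theta\in\mathbb Q_{+}$. Let $\mathcal P$ be the set of $s$-$t$-paths in $D$. Decide whether there is $x\in\mathbb Q_+^{\mathcal P}$ with $\sum_{P\ni a}x_P\le 1$ for all $a\in A$, $\sum_{P\in\mathcal P}x_P=\theta$, and $\sum_{P\in\mathcal P:P\cap S\ne\emptyset}x_P\le k-1$ for every clique $S\subseteq A$ of $H$ with $|S|\le k$. **MRF-M$^\star$.** An instance consists of a digraph $D=(V,A)$ with capacities $u\in\mathbb Q_+^A$, a budget $k\in\mathbb N$ with $1\le k\le|A|$, and a finite set $K$ of commodities $i$ with sources $s_i$, sinks $t_i\ne s_i$ and demands $d_i\in\mathbb Q_+$, where the pairs $(s_i,t_i)$ are pairwise distinct. Let $\mathcal P_i$ be the set of $s_i$-$t_i$-paths,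 $\mathcal P=\bigcup_{i\in K}\mathcal P_i$, $M:=\max_{a\in A}u_a$, and let $X_K$ be the set of all $x\in\mathbb Q_+^{\mathcal P}$ with $\sum_{P\in\mathcal P:a\in P}x_P\le u_a$ for all $a\in A$ and $\sum_{P\in\mathcal P_i}x_P=d_i$ for all $i\in K$. Decide whether there is $x\in X_K$ with $\sum_{P\in\mathcal P:P\cap S\neq\emptyset}x_P\le kM-1$ for every $S\subseteq A$ with $|S|=k$. In the integral version of either problem, $x$ is required in addition to be integral. **Theorem.** There is a polynomial-time computable map that sends every instance $I$ of MRF-R$^\star$ to an instance $J$ of MRF-M$^\star$ with the same budget $k$, such that $I$ is a YES instance of MRF-R$^\star$ if and only if $J$ is a YES instance of MRF-M$^\star$, and $I$ is a YES instance of the integral version of MRF-R$^\star$ if and only if $J$ is a YES instance of the integral version of MRF-M$^\star$. Moreover, every resulting instance $J$, with digraph $D=(V,A)$, capacities $u$, commodities $K$ and $M$ as above, has the following properties: 1. All capacities are integral, and $M\le p(|A|)$ for a fixed polynomial $p$ that does not depend on $I$. 2. Every $i\in K$ satisfies $\sum_{a\in\delta^+(s_i)}u_a=\sum_{a\in\delta^-(t_i)}u_a=d_i$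 and $\delta^-(s_i)=\delta^+(t_i)=\emptyset$. 3. There is a commodity $i_0\in K$ with $\sum_{i\in K\setminus\{i_0\}}d_i\le M-3$. 4. With this same $i_0$, for every $x\in X_K$: $\sum_{P\in\mathcal P_i:a\in P}x_P\ge 2$ for all $i\in K\setminus\{i_0\}$ and all $a\in A$ with $u_a\ge M-2$. 5. There is $U\subseteq V$ with $\{s_i:i\in K\}\subseteq U$, $\{t_i:i\in K\}\subseteq V\setminus U$, $\sum_{a\in\delta^+(U)}u_a=\sum_{i\in K}d_i$, and $|\{a\in\delta^+(U):u_a=M\}|=k-1$. -/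

import Mathlib

namespace RobustFlow

/-! ### Directed multigraphs, paths and cuts -/

/-- A finite directed graph, parallel arcs allowed, with node set `Fin numV` and arc set
`Fin numA`. -/
structure FinDigraph where
  numV : ℕ
  numA : ℕ
  tail : Fin numA → Fin numV
  head : Fin numA → Fin numV

namespace FinDigraph

variable (D : FinDigraph)

/-- `D.IsWalk v l w`: the list of arcs `l` is a directed walk from `v` to `w`. -/
def IsWalk : Fin D.numV → List (Fin D.numA) → Fin D.numV → Prop
  | v, [], w => v = w
  | v, a :: l, w => D.tail a = v ∧ IsWalk (D.head a) l w

/-- `P` is the arc set of a (simple) directed path from `v` to `w`: a walk that visits pairwise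
distinct nodes. -/
def IsPath (v w : Fin D.numV) (P : Finset (Fin D.numA)) : Prop :=
  ∃ l : List (Fin D.numA), D.IsWalk v l w ∧ (v :: l.map D.head).Nodup ∧ l.toFinset = P

open Classical in
/-- The set of all `v`-`w`-paths; a path is identified with its set of arcs. -/
noncomputable def paths (v w : Fin D.numV) : Finset (Finset (Fin D.numA)) :=
  Finset.univ.filter fun P => D.IsPath v w P

/-- There is no directed cycle (in particular no loop). -/
def Acyclic : Prop :=
  ∀ v, ¬ Relation.TransGen (fun v w => ∃ a, D.tail a = v ∧ D.head a = w) v v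

/-- The arcs `δ⁺(U)` leaving the node set `U`. -/
def outArcs (U : Finset (Fin D.numV)) : Finset (Fin D.numA) :=
  Finset.univ.filter fun a => D.tail a ∈ U ∧ D.head a ∉ U

/-- The arcs `δ⁻(U)` entering the node set `U`. -/
def inArcs (U : Finset (Fin D.numV)) : Finset (Fin D.numA) :=
  Finset.univ.filter fun a => D.tail a ∉ U ∧ D.head a ∈ U

end FinDigraph

/-! ### Path flows

Flows assign a nonnegative rational number to each path of a finite family `Ps` of paths (values of
`x` outside `Ps` play no role). -/

section Flows

variable {α : Type*} [DecidableEq α]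

/-- The amount of flow on the paths of `Ps` containing the arc `a`. -/
def arcFlow (Ps : Finset (Finset α)) (x : Finset α → ℚ≥0) (a : α) : ℚ≥0 :=
  ∑ P ∈ Ps with a ∈ P, x P

/-- The amount of flow lost at failure of the arcs in `S`: the flow on all paths meeting `S`. -/
def lostFlow (Ps : Finset (Finset α)) (x : Finset α → ℚ≥0) (S : Finset α) : ℚ≥0 :=
  ∑ P ∈ Ps with (P ∩ S).Nonempty, x P

/-- The flow value on every path is an integer. -/
def IsIntegralFlow (Ps : Finset (Finset α)) (x : Finset α → ℚ≥0) : Prop :=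
  ∀ P ∈ Ps, ∃ z : ℕ, x P = z

end Flows

/-! ### Maximum robust flow with restricted interdiction -/

/-- An instance of the decision problem MRF-R*: a directed acyclic graph with unit capacities,
source and sink, an interdiction budget `k` (such that there is a set of exactly `k` arcs), a
compatibility graph on the arcs, and a demand. -/
structure MRFR extends FinDigraph where
  s : Fin numV
  t : Fin numV
  k : ℕ
  compat : SimpleGraph (Fin numA)
  demand : ℚ≥0
  acyclic : toFinDigraph.Acyclic
  s_ne_t : s ≠ t
  one_le_k : 1 ≤ k
  k_le : k ≤ numA

namespace MRFR

variable (I : MRFR)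

/-- The `s`-`t`-paths of the instance. -/
noncomputable def stPaths : Finset (Finset (Fin I.numA)) := I.toFinDigraph.paths I.s I.t

/-- `x` is an `s`-`t`-flow respecting the unit capacities whose value is the demand, and at most
`k - 1` units are lost at failure of any clique of at most `k` arcs of the compatibility graph. -/
def IsSolution (x : Finset (Fin I.numA) → ℚ≥0) : Prop :=
  (∀ a, arcFlow I.stPaths x a ≤ 1) ∧
  ∑ P ∈ I.stPaths, x P = I.demand ∧
  ∀ S : Finset (Fin I.numA), S.card ≤ I.k → I.compat.IsClique (S : Set (Fin I.numA)) →
    (lostFlow I.stPaths x S : ℚ) ≤ (I.k : ℚ) - 1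

/-- The instance is a YES instance of MRF-R*. -/
def IsYes : Prop := ∃ x, I.IsSolution x

/-- The instance is a YES instance of the integral version of MRF-R*. -/
def IsIntegralYes : Prop := ∃ x, I.IsSolution x ∧ IsIntegralFlow I.stPaths x

end MRFR

/-! ### Maximum robust flow with multiple commodities -/

/-- An instance of the decision problem MRF-M*: a directed graph with capacities, an interdiction
budget `k` (such that there is a set of exactly `k` arcs), and commodities indexed by `Fin numK`,
each with a source, a sink and a demand. Different commodities have different source-sink pairs, so
that a path belongs to at most one commodity. -/
structure MRFM extends FinDigraph where
  cap : Fin numA → ℚ≥0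
  k : ℕ
  numK : ℕ
  src : Fin numK → Fin numV
  snk : Fin numK → Fin numV
  dem : Fin numK → ℚ≥0
  one_le_k : 1 ≤ k
  k_le : k ≤ numA
  src_ne_snk : ∀ i, src i ≠ snk i
  pairs_injective : Function.Injective fun i => (src i, snk i)

namespace MRFM

variable (J : MRFM)

/-- The paths `Pᵢ` of commodity `i`. -/
noncomputable def commodityPaths (i : Fin J.numK) : Finset (Finset (Fin J.numA)) :=
  J.toFinDigraph.paths (J.src i) (J.snk i)

/-- The set `⋃ᵢ Pᵢ` of all paths. -/
noncomputable def allPaths : Finset (Finset (Fin J.numA)) :=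
  Finset.univ.biUnion J.commodityPaths

/-- The maximum capacity `M` (there is an arc, since `1 ≤ k ≤ numA`). -/
def maxCap : ℚ≥0 := Finset.univ.sup J.cap

/-- `x` is a multicommodity flow: it respects the capacities and fulfils all demands. -/
def IsFlow (x : Finset (Fin J.numA) → ℚ≥0) : Prop :=
  (∀ a, arcFlow J.allPaths x a ≤ J.cap a) ∧ ∀ i, ∑ P ∈ J.commodityPaths i, x P = J.dem i

/-- `x` is a multicommodity flow that loses at most `k M - 1` units at failure of any `k` arcs. -/
def IsSolution (x : Finset (Fin J.numA) → ℚ≥0) : Prop :=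
  J.IsFlow x ∧ ∀ S : Finset (Fin J.numA), S.card = J.k →
    (lostFlow J.allPaths x S : ℚ) ≤ (J.k : ℚ) * (J.maxCap : ℚ) - 1

/-- The instance is a YES instance of MRF-M*. -/
def IsYes : Prop := ∃ x, J.IsSolution x

/-- The instance is a YES instance of the integral version of MRF-M*. -/
def IsIntegralYes : Prop := ∃ x, J.IsSolution x ∧ IsIntegralFlow J.allPaths x

end MRFM

/-! ### Polynomial-time computation

The machine model is a structured programming language over binary trees (the WHILE language with a
single variable, pairing, projections, branching and while-loops). A program is a finite object, and
every executed instruction costs the size of the tree it is applied to. Consequently the size of the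
output never exceeds the cost, a Turing machine simulates a run within time polynomial in its
cost, and conversely, so the functions computed with polynomial cost are the polynomial-time
computable ones. -/

/-- The data of the machine: binary trees. -/
inductive Data where
  | nil : Data
  | node : Data → Data → Data

namespace Data

/-- The number of nodes and leaves. -/
def size : Data → ℕ
  | nil => 1
  | node a b => a.size + b.size + 1

def fst : Data → Data
  | nil => nil
  | node a _ => a

def snd : Data → Data
  | nil => nil
  | node _ b => b

def ofList : List Data → Data
  | [] => nil
  | a :: l => node a (ofList l)

def ofBool : Bool → Data
  | false => nil
  | true => node nil nil

/-- Binary representation of a natural number, least significant bit first. -/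
def ofNat (n : ℕ) : Data := ofList (n.bits.map ofBool)

/-- Unary representation of a natural number. -/
def ofNatUnary (n : ℕ) : Data := ofList (List.replicate n nil)

/-- A nonnegative rational number: numerator and denominator in binary. -/
def ofRat (q : ℚ≥0) : Data := node (ofNat q.num) (ofNat q.den)

end Data

/-- Programs transforming a tree into a tree. -/
inductive Prog where
  | id : Prog
  | nil : Prog
  | fst : Prog
  | snd : Prog
  | pair : Prog → Prog → Prog
  | seq : Prog → Prog → Prog
  | ite : Prog → Prog → Prog → Prog
  | while : Prog → Prog → Prog

/-- `Runs p v w c`: the program `p`, started on `v`, halts with output `w` at total cost `c`.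
The tests of `ite` and `while` fail exactly on the tree `nil`. -/
inductive Runs : Prog → Data → Data → ℕ → Prop
  | id (v : Data) : Runs .id v v v.size
  | nil (v : Data) : Runs .nil v .nil v.size
  | fst (v : Data) : Runs .fst v v.fst v.size
  | snd (v : Data) : Runs .snd v v.snd v.size
  | pair {p q : Prog} {v a b : Data} {c d : ℕ} :
      Runs p v a c → Runs q v b d → Runs (.pair p q) v (.node a b) (v.size + c + d)
  | seq {p q : Prog} {v a b : Data} {c d : ℕ} :
      Runs p v a c → Runs q a b d → Runs (.seq p q) v b (v.size + c + d)
  | ite_true {r p q : Prog} {v a b w : Data} {c d : ℕ} :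
      Runs r v (.node a b) c → Runs p v w d → Runs (.ite r p q) v w (v.size + c + d)
  | ite_false {r p q : Prog} {v w : Data} {c d : ℕ} :
      Runs r v .nil c → Runs q v w d → Runs (.ite r p q) v w (v.size + c + d)
  | while_true {r p : Prog} {v a b v' w : Data} {c d e : ℕ} :
      Runs r v (.node a b) c → Runs p v v' d → Runs (.while r p) v' w e →
      Runs (.while r p) v w (v.size + c + d + e)
  | while_false {r p : Prog} {v : Data} {c : ℕ} :
      Runs r v .nil c → Runs (.while r p) v v (v.size + c)

/-- The function `T` is computable in polynomial time with respect to the given encodings of its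
arguments and values. -/
def ComputableInPolyTime {α β : Type*} (encα : α → Data) (encβ : β → Data) (T : α → β) : Prop :=
  ∃ (prog : Prog) (p : Polynomial ℕ), ∀ I : α,
    ∃ c : ℕ, Runs prog (encα I) (encβ (T I)) c ∧ c ≤ p.eval (encα I).size

open Classical in
/-- Encoding of an instance: the nodes in unary, the list of arcs (tail and head), source, sink,
budget, the adjacency matrix of the compatibility graph, and the demand; numbers are binary. -/
noncomputable def MRFR.encode (I : MRFR) : Data :=
  Data.ofList
    [Data.ofNatUnary I.numV,
     Data.ofList (List.ofFn fun a => Data.node (Data.ofNat (I.tail a)) (Data.ofNat (I.head a))),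
     Data.ofNat I.s,
     Data.ofNat I.t,
     Data.ofNat I.k,
     Data.ofList (List.ofFn fun a =>
       Data.ofList (List.ofFn fun b => Data.ofBool (decide (I.compat.Adj a b)))),
     Data.ofRat I.demand]

/-- Encoding of an instance: the nodes in unary, the list of arcs (tail, head and capacity), the
budget, and the list of commodities (source, sink and demand); numbers are binary. -/
def MRFM.encode (J : MRFM) : Data :=
  Data.ofList
    [Data.ofNatUnary J.numV,
     Data.ofList (List.ofFn fun a =>
       Data.ofList [Data.ofNat (J.tail a), Data.ofNat (J.head a), Data.ofRat (J.cap a)]),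
     Data.ofNat J.k,
     Data.ofList (List.ofFn fun i =>
       Data.ofList [Data.ofNat (J.src i), Data.ofNat (J.snk i), Data.ofRat (J.dem i)])]

end RobustFlow

open RobustFlow

set_option linter.unusedSectionVars false

/-! Call the arcs of capacity `M` main arcs. Only they matter to the interdictor: capacities are
integral, so `k` arcs of which one has capacity below `M` have total capacity at most `k M - 1`. The
network has one main arc for each arc of the given digraph and `k - 1` extra ones. Every commodity
sends flow directly from its source over each main arc to its sink, and the special commodity `com0`
has enough of it to make the accounting below exact.

Two main arcs are linked by a path that carries one unit and traverses both. If `S` contains a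
linked pair, this unit is counted twice in the capacity of `S`, so again at most `k M - 1` is lost.
Incompatible arcs are linked, and each extra arc is linked to every original one. Since there are
only `k - 1` extra arcs, a set of `k` main arcs without a link consists of `k` original arcs forming
a clique. The direct and link flow through such a set is exactly `k (M - 1)`. This leaves `k - 1`
for the `s`-`t` flow, which runs through copies of the given nodes and the main arcs of the given
arcs: the constraint of MRF-R*. Cliques with fewer than `k` arcs add nothing to the unit capacities.

A solution of the network need not use the direct and link paths as intended. Uncrossing repairs
this: two deviating paths through the same main arcs are recombined into an intended path and a
second path. The intended path meets main arcs only where both old paths do, so no loss grows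
(`Sol.swap`, `Sol.shift`), while the flow on intended paths grows. After finitely many exchanges all
intended paths are full (`exists_uncrossed`). Then every remaining path that enters the given
digraph traces an `s`-`t`-path, and the losses transfer (`origFlow_loss_le`).

The demand `num / den` is given in binary while `M` has to be polynomial in the number of arcs, so
it is enforced by gadgets. A column splits `W = |A|` units between two chains; let `V j` be the
amount on the first. A row commodity needs the residual capacity of one arc on selected chains, so
it can be routed exactly if a linear inequality in the `V j` with coefficients 0 and ±1 holds. The
rows express `V j = ∑ i < j, V i` for `j ≥ 1`, whence `V (i+1) = 2^i V 0`, and `den * V 0 = 1`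
through the bits of `den`. Row 0, which alone may also use the `s`-`t` flow, says that this flow is
at least `num * V 0`. An excess of flow is removed afterwards.

All flows are handled as natural numbers over a common denominator `N`; `N = 1` is the integral
version. There `den * V 0 = 1` forces `den = 1`, and conversely an integral flow has integral value.

For computability, a calculus of closure properties of polynomial-time functions on lists and unary
numbers is set up. The network is numbered explicitly and its encoding is written as an expression
in this calculus. -/

namespace RobustFlow

/-! ### Walks and simple paths over arbitrary node and arc types -/

section Walks

variable {V A : Type*} (tl hd : A → V)

/-- The list of arcs `l` is a directed walk from `v` to `w`. -/
def Walk : V → List A → V → Prop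
  | v, [], w => v = w
  | v, a :: l, w => tl a = v ∧ Walk (hd a) l w

variable {tl hd}

theorem Walk.append {u v w : V} {l₁ l₂ : List A} (h₁ : Walk tl hd u l₁ v)
    (h₂ : Walk tl hd v l₂ w) : Walk tl hd u (l₁ ++ l₂) w := by
  induction l₁ generalizing u with
  | nil => cases h₁; exact h₂
  | cons a l ih => exact ⟨h₁.1, ih h₁.2⟩

theorem Walk.of_append {u w : V} {l₁ l₂ : List A} (h : Walk tl hd u (l₁ ++ l₂) w) :
    ∃ v, Walk tl hd u l₁ v ∧ Walk tl hd v l₂ w := by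
  induction l₁ generalizing u with
  | nil => exact ⟨u, rfl, h⟩
  | cons a l ih =>
    obtain ⟨v, h₁, h₂⟩ := ih h.2
    exact ⟨v, ⟨h.1, h₁⟩, h₂⟩

theorem Walk.split {u w : V} {l₁ l₂ : List A} {a : A} (h : Walk tl hd u (l₁ ++ a :: l₂) w) :
    Walk tl hd u l₁ (tl a) ∧ Walk tl hd (hd a) l₂ w := by
  obtain ⟨v, h₁, h₂, h₃⟩ := h.of_append
  subst h₂
  exact ⟨h₁, h₃⟩

theorem Walk.nodes_eq {v w : V} {l : List A} (h : Walk tl hd v l w) :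
    v :: l.map hd = l.map tl ++ [w] := by
  induction l generalizing v with
  | nil => cases h; rfl
  | cons a l ih =>
    have := ih h.2
    simp only [List.map_cons, List.cons_append, this, h.1]

variable [DecidableEq A]

variable (tl hd) in
/-- `P` is the arc set of a simple directed path from `v` to `w`. -/
def SimplePath (v w : V) (P : Finset A) : Prop :=
  ∃ l : List A, Walk tl hd v l w ∧ (v :: l.map hd).Nodup ∧ l.toFinset = P

/-- Cutting out cycles. Recombined walks become simple paths without using new arcs, and only this
containment matters for capacities and losses. -/
theorem Walk.exists_simplePath {v w : V} {l : List A} (h : Walk tl hd v l w) :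
    ∃ P, SimplePath tl hd v w P ∧ P ⊆ l.toFinset := by
  suffices ∃ l', Walk tl hd v l' w ∧ (v :: l'.map hd).Nodup ∧ l' ⊆ l by
    obtain ⟨l', h₁, h₂, h₃⟩ := this
    exact ⟨_, ⟨l', h₁, h₂, rfl⟩, fun a ha => by simp at ha ⊢; exact h₃ ha⟩
  induction l generalizing v with
  | nil => exact ⟨[], h, by simp, by simp⟩
  | cons a l ih =>
    obtain ⟨l', h₁, h₂, h₃⟩ := ih h.2
    by_cases hv : v ∈ hd a :: l'.map hd
    · rcases List.mem_cons.1 hv with hv | hv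
      · subst hv
        exact ⟨l', h₁, h₂, fun x hx => List.mem_cons_of_mem _ (h₃ hx)⟩
      · obtain ⟨b, hb, rfl⟩ := List.mem_map.1 hv
        obtain ⟨l₁, l₂, rfl⟩ := List.append_of_mem hb
        refine ⟨l₂, h₁.split.2, ?_, fun x hx => List.mem_cons_of_mem _ (h₃ (by simp [hx]))⟩
        simp only [List.map_append, List.map_cons] at h₂
        exact (List.nodup_append.1 (List.nodup_cons.1 h₂).2).2.1
    · refine ⟨a :: l', ⟨h.1, h₁⟩, ?_, ?_⟩
      · simpa using List.nodup_cons.2 ⟨hv, h₂⟩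
      · exact List.cons_subset_cons _ h₃

namespace SimplePath

variable {v w : V} {P Q : Finset A}

theorem tl_ne (h : SimplePath tl hd v w P) {a : A} (ha : a ∈ P) : tl a ≠ w := by
  obtain ⟨l, h₁, h₂, rfl⟩ := h
  rw [h₁.nodes_eq] at h₂
  rintro rfl
  exact (List.disjoint_of_nodup_append h₂) (List.mem_map_of_mem (by simpa using ha)) (by simp)

theorem hd_inj (h : SimplePath tl hd v w P) {a b : A} (ha : a ∈ P) (hb : b ∈ P)
    (hab : hd a = hd b) : a = b := by
  obtain ⟨l, _, h₂, rfl⟩ := h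
  exact List.inj_on_of_nodup_map (List.nodup_cons.1 h₂).2 (by simpa using ha) (by simpa using hb)
    hab

theorem tl_inj (h : SimplePath tl hd v w P) {a b : A} (ha : a ∈ P) (hb : b ∈ P)
    (hab : tl a = tl b) : a = b := by
  obtain ⟨l, h₁, h₂, rfl⟩ := h
  rw [h₁.nodes_eq] at h₂
  exact List.inj_on_of_nodup_map (List.nodup_append.1 h₂).1 (by simpa using ha) (by simpa using hb)
    hab

theorem exists_prev (h : SimplePath tl hd v w P) {a : A} (ha : a ∈ P) (hv : tl a ≠ v) :
    ∃ b ∈ P, hd b = tl a := by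
  obtain ⟨l, h₁, h₂, rfl⟩ := h
  have : tl a ∈ v :: l.map hd := by
    rw [h₁.nodes_eq]
    exact List.mem_append_left _ (List.mem_map_of_mem (by simpa using ha))
  rcases List.mem_cons.1 this with h | h
  · exact absurd h hv
  · obtain ⟨b, hb, e⟩ := List.mem_map.1 h
    exact ⟨b, by simpa using hb, e⟩

theorem exists_next (h : SimplePath tl hd v w P) {a : A} (ha : a ∈ P) (hw : hd a ≠ w) :
    ∃ b ∈ P, tl b = hd a := by
  obtain ⟨l, h₁, h₂, rfl⟩ := h
  have : hd a ∈ l.map tl ++ [w] := by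
    rw [← h₁.nodes_eq]
    exact List.mem_cons_of_mem _ (List.mem_map_of_mem (by simpa using ha))
  rcases List.mem_append.1 this with h | h
  · obtain ⟨b, hb, e⟩ := List.mem_map.1 h
    exact ⟨b, by simpa using hb, e⟩
  · exact absurd (by simpa using h) hw

theorem exists_first (h : SimplePath tl hd v w P) (hvw : v ≠ w) : ∃ b ∈ P, tl b = v := by
  obtain ⟨l, h₁, h₂, rfl⟩ := h
  cases l with
  | nil => exact absurd h₁ hvw
  | cons a l => exact ⟨a, by simp, h₁.1⟩

theorem exists_last (h : SimplePath tl hd v w P) (hvw : v ≠ w) : ∃ b ∈ P, hd b = w := by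
  obtain ⟨l, h₁, h₂, rfl⟩ := h
  have : w ∈ v :: l.map hd := by rw [h₁.nodes_eq]; simp
  rcases List.mem_cons.1 this with h | h
  · exact absurd h.symm hvw
  · obtain ⟨b, hb, e⟩ := List.mem_map.1 h
    exact ⟨b, by simpa using hb, e⟩

theorem start_eq (h : SimplePath tl hd v w P) {a : A} (ha : a ∈ P)
    (hs : ∀ b, hd b ≠ tl a) : tl a = v := by
  by_contra hv
  obtain ⟨b, _, hb⟩ := h.exists_prev ha hv
  exact hs b hb

theorem end_eq (h : SimplePath tl hd v w P) {a : A} (ha : a ∈ P)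
    (hs : ∀ b, tl b ≠ hd a) : hd a = w := by
  by_contra hv
  obtain ⟨b, _, hb⟩ := h.exists_next ha hv
  exact hs b hb

/-- The arcs of a simple path have distinct tails, so at each node the smaller path has no choice
but to follow the larger one. This identifies a path from a few arcs known to lie on it. -/
theorem eq_of_subset (h : SimplePath tl hd v w P) (h' : SimplePath tl hd v w Q) (hQ : Q ⊆ P) :
    Q = P := by
  obtain ⟨l, h₁, h₂, rfl⟩ := h
  obtain ⟨l', h₁', h₂', rfl⟩ := h'
  suffices l' = l by rw [this]
  have hs : ∀ a ∈ l', a ∈ l := fun a ha => by simpa using hQ (by simpa using ha)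
  clear hQ
  induction l generalizing v l' with
  | nil => exact List.eq_nil_iff_forall_not_mem.2 fun a ha => by simpa using hs a ha
  | cons a l ih =>
    cases l' with
    | nil =>
      exfalso
      cases h₁'
      have := SimplePath.tl_ne (tl := tl) (hd := hd) ⟨a :: l, h₁, h₂, rfl⟩ (a := a) (by simp)
      exact this h₁.1
    | cons b l' =>
      have hb : b = a := SimplePath.tl_inj (tl := tl) (hd := hd) ⟨a :: l, h₁, h₂, rfl⟩
        (by simpa using hs b (by simp)) (by simp) (h₁'.1.trans h₁.1.symm)
      subst hb
      have n₁ : (b :: l').Nodup := List.Nodup.of_map _ (List.nodup_cons.1 h₂').2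
      rw [ih h₁.2 (by simpa using (List.nodup_cons.1 h₂).2) l' h₁'.2
        (by simpa using (List.nodup_cons.1 h₂').2) fun c hc => ?_]
      rcases List.mem_cons.1 (hs c (by simp [hc])) with rfl | h
      · exact absurd hc (List.nodup_cons.1 n₁).1
      · exact h

end SimplePath

end Walks

section Walks
variable {V A : Type*} {tl hd : A → V}

theorem Walk.tl_mem {v w : V} {l : List A} (h : Walk tl hd v l w) {a : A} (ha : a ∈ l) :
    tl a = v ∨ ∃ b, hd b = tl a := by
  have : tl a ∈ v :: l.map hd := by
    rw [h.nodes_eq]; exact List.mem_append_left _ (List.mem_map_of_mem ha)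
  rcases List.mem_cons.1 this with h | h
  · exact Or.inl h
  · obtain ⟨b, _, e⟩ := List.mem_map.1 h
    exact Or.inr ⟨b, e⟩

theorem Walk.hd_mem {v w : V} {l : List A} (h : Walk tl hd v l w) {a : A} (ha : a ∈ l) :
    hd a = w ∨ ∃ b, tl b = hd a := by
  have : hd a ∈ l.map tl ++ [w] := by
    rw [← h.nodes_eq]; exact List.mem_cons_of_mem _ (List.mem_map_of_mem ha)
  rcases List.mem_append.1 this with h | h
  · obtain ⟨b, _, e⟩ := List.mem_map.1 h
    exact Or.inr ⟨b, e⟩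
  · exact Or.inl (by simpa using h)

theorem SimplePath.split [DecidableEq A] {v w : V} {P : Finset A} (h : SimplePath tl hd v w P)
    {a : A} (ha : a ∈ P) : ∃ l₁ l₂, Walk tl hd v l₁ (tl a) ∧ Walk tl hd (hd a) l₂ w ∧
      (l₁ ++ a :: l₂).Nodup ∧ (l₁ ++ a :: l₂).toFinset = P := by
  obtain ⟨l, h₁, h₂, rfl⟩ := h
  obtain ⟨l₁, l₂, rfl⟩ := List.append_of_mem (List.mem_toFinset.1 ha)
  exact ⟨l₁, l₂, h₁.split.1, h₁.split.2, List.Nodup.of_map _ (List.nodup_cons.1 h₂).2, rfl⟩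

end Walks

/-! ### Multicommodity path flows with integral data -/

/-- A multicommodity flow instance with integral capacities and demands, over arbitrary node, arc
and commodity types. The number `M` is meant to be the largest capacity. -/
structure Inst (V A K : Type*) where
  tl : A → V
  hd : A → V
  src : K → V
  snk : K → V
  cap : A → ℕ
  dem : K → ℕ
  k : ℕ
  M : ℕ

namespace Inst

variable {V A K : Type*} [Fintype A] [DecidableEq A] [Fintype K] (G : Inst V A K)

open Classical in
/-- The paths of commodity `i`. -/
noncomputable def paths (i : K) : Finset (Finset A) :=
  Finset.univ.filter (SimplePath G.tl G.hd (G.src i) (G.snk i))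

/-- The paths of all commodities. -/
noncomputable def all : Finset (Finset A) := Finset.univ.biUnion G.paths

variable {G}

theorem mem_paths {i : K} {P : Finset A} :
    P ∈ G.paths i ↔ SimplePath G.tl G.hd (G.src i) (G.snk i) P := by simp [paths]

theorem mem_all {P : Finset A} : P ∈ G.all ↔ ∃ i, P ∈ G.paths i := by simp [all]

variable (G) in
/-- `z / N` is a multicommodity flow. -/
structure IsFlow (N : ℕ) (z : Finset A → ℕ) : Prop where
  cap_le : ∀ a, ∑ P ∈ G.all with a ∈ P, z P ≤ N * G.cap a
  dem_eq : ∀ i, ∑ P ∈ G.paths i, z P = N * G.dem i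

variable (G) in
/-- `z / N` is a multicommodity flow that loses at most `k M - 1` units at failure of any `k`
arcs. -/
structure Sol (N : ℕ) (z : Finset A → ℕ) : Prop extends G.IsFlow N z where
  loss_le : ∀ S : Finset A, S.card = G.k →
    ∑ P ∈ G.all with (P ∩ S).Nonempty, z P + N ≤ N * (G.k * G.M)

theorem loss_le_sum (F : Finset (Finset A)) (z : Finset A → ℕ) (S : Finset A) :
    ∑ P ∈ F with (P ∩ S).Nonempty, z P ≤ ∑ a ∈ S, ∑ P ∈ F with a ∈ P, z P := by
  simp_rw [Finset.sum_filter]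
  rw [Finset.sum_comm]
  refine Finset.sum_le_sum fun P _ => ?_
  split_ifs with h
  · obtain ⟨a, ha⟩ := h
    rw [Finset.mem_inter] at ha
    refine le_trans ?_ (Finset.single_le_sum (f := fun a => if a ∈ P then z P else 0)
      (fun _ _ => Nat.zero_le _) ha.2)
    simp [ha.1]
  · exact Nat.zero_le _

/-- By integrality one arc of smaller capacity already saves a whole unit. Hence only sets of arcs
of maximum capacity have to be examined. -/
theorem IsFlow.loss_le_of_cap_lt {N : ℕ} {z : Finset A → ℕ} (h : G.IsFlow N z)
    (hM : ∀ a, G.cap a ≤ G.M) {S : Finset A} (hS : S.card = G.k) {a : A} (ha : a ∈ S)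
    (haM : G.cap a ≠ G.M) :
    ∑ P ∈ G.all with (P ∩ S).Nonempty, z P + N ≤ N * (G.k * G.M) := by
  have h₁ : ∑ a ∈ S, G.cap a + 1 ≤ G.k * G.M := by
    have : ∑ a ∈ S, G.cap a < ∑ a ∈ S, G.M :=
      Finset.sum_lt_sum (fun a _ => hM a) ⟨a, ha, lt_of_le_of_ne (hM a) haM⟩
    simpa [hS] using this
  calc _ ≤ ∑ a ∈ S, N * G.cap a + N :=
        Nat.add_le_add_right ((loss_le_sum _ z S).trans (Finset.sum_le_sum fun a _ => h.cap_le a)) N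
    _ = N * (∑ a ∈ S, G.cap a + 1) := by rw [← Finset.mul_sum]; ring
    _ ≤ _ := Nat.mul_le_mul_left _ h₁

/-- One unit on the path `P`. -/
def unit (P : Finset A) (X : Finset A) : ℕ := if X = P then 1 else 0

theorem sum_unit (F : Finset (Finset A)) (P : Finset A) :
    ∑ X ∈ F, unit P X = if P ∈ F then 1 else 0 := by
  simp [unit]

theorem exists_eq_add_unit {z : Finset A → ℕ} {P : Finset A} (hP : 0 < z P) :
    ∃ r : Finset A → ℕ, z = fun X => r X + unit P X := by
  refine ⟨fun X => z X - unit P X, funext fun X => ?_⟩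
  simp only [unit]
  split_ifs with h
  · subst h; omega
  · simp

theorem exists_eq_add_unit_add_unit {z : Finset A → ℕ} {P Q : Finset A} (hP : 0 < z P)
    (hQ : 0 < z Q) (hPQ : P ≠ Q) :
    ∃ r : Finset A → ℕ, z = fun X => r X + unit P X + unit Q X := by
  refine ⟨fun X => z X - unit P X - unit Q X, funext fun X => ?_⟩
  simp only [unit]
  split_ifs with h h' h'
  · exact absurd (h.symm.trans h') hPQ
  · subst h; omega
  · subst h'; omega
  · simp

/-- The counting behind an exchange of paths: if being hit by one new path implies being hit by some
old path, and by both new paths implies by both old ones, then the count does not grow. -/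
theorem ite_add_ite_le {p q p' q' : Prop} [Decidable p] [Decidable q] [Decidable p']
    [Decidable q'] (h₁ : p' ∨ q' → p ∨ q) (h₂ : p' → q' → p ∧ q) :
    (if p' then 1 else 0) + (if q' then 1 else 0) ≤ (if p then 1 else 0) + if q then 1 else 0 := by
  split_ifs <;> first | omega | (exfalso; tauto)

/-- Exchanging one unit on each of two paths for one unit on each of two other paths, one of which
meets the arcs of maximum capacity only where both old paths do. -/
theorem Sol.swap {N : ℕ} (hM : ∀ a, G.cap a ≤ G.M) {r : Finset A → ℕ} {P Q P' Q' : Finset A}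
    {i j : K} (hz : G.Sol N fun X => r X + unit P X + unit Q X)
    (hP : ∀ l, P ∈ G.paths l ↔ l = i) (hQ : ∀ l, Q ∈ G.paths l ↔ l = j)
    (hP' : ∀ l, P' ∈ G.paths l ↔ l = i) (hQ' : ∀ l, Q' ∈ G.paths l ↔ l = j)
    (hU : P' ∪ Q' ⊆ P ∪ Q) (hI : P' ∩ Q' ⊆ P ∩ Q)
    (htr : ∀ a ∈ P', G.cap a = G.M → a ∈ P ∧ a ∈ Q) :
    G.Sol N fun X => r X + unit P' X + unit Q' X := by
  have aP : P ∈ G.all := mem_all.2 ⟨i, (hP i).2 rfl⟩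
  have aQ : Q ∈ G.all := mem_all.2 ⟨j, (hQ j).2 rfl⟩
  have aP' : P' ∈ G.all := mem_all.2 ⟨i, (hP' i).2 rfl⟩
  have aQ' : Q' ∈ G.all := mem_all.2 ⟨j, (hQ' j).2 rfl⟩
  have hU' : ∀ a, a ∈ P' ∨ a ∈ Q' → a ∈ P ∨ a ∈ Q := fun a ha => by
    simpa using hU (by simpa using ha)
  have hI' : ∀ a, a ∈ P' → a ∈ Q' → a ∈ P ∧ a ∈ Q := fun a h₁ h₂ => by
    simpa using hI (by simp [h₁, h₂])
  have hf : G.IsFlow N fun X => r X + unit P' X + unit Q' X := by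
    refine ⟨fun a => le_trans ?_ (hz.cap_le a), fun l => Eq.trans ?_ (hz.dem_eq l)⟩
    · simp only [Finset.sum_add_distrib, sum_unit, Finset.mem_filter, aP, aQ, aP', aQ', true_and]
      have := ite_add_ite_le (hU' a) (hI' a)
      omega
    · simp only [Finset.sum_add_distrib, sum_unit]
      rw [if_congr ((hP' l).trans (hP l).symm) rfl rfl, if_congr ((hQ' l).trans (hQ l).symm) rfl rfl]
  refine ⟨hf, fun S hS => ?_⟩
  by_cases hSM : ∀ a ∈ S, G.cap a = G.M
  · refine le_trans (Nat.add_le_add_right ?_ N) (hz.loss_le S hS)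
    simp only [Finset.sum_add_distrib, sum_unit, Finset.mem_filter, aP, aQ, aP', aQ', true_and]
    have e : ∀ X : Finset A, (X ∩ S).Nonempty ↔ ∃ a ∈ S, a ∈ X := fun X => by
      simp [Finset.Nonempty, and_comm]
    simp only [e]
    -- The crucial asymmetry: destroying `P'` destroys both old paths, so the new loss is bounded by
    -- the old one even though `Q'` may meet `S` anywhere on `P ∪ Q`.
    have h₁ : (∃ a ∈ S, a ∈ P') → (∃ a ∈ S, a ∈ P) ∧ (∃ a ∈ S, a ∈ Q) := fun ⟨a, ha, h⟩ =>
      ⟨⟨a, ha, (htr a h (hSM a ha)).1⟩, ⟨a, ha, (htr a h (hSM a ha)).2⟩⟩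
    have h₂ : (∃ a ∈ S, a ∈ Q') → (∃ a ∈ S, a ∈ P) ∨ (∃ a ∈ S, a ∈ Q) := fun ⟨a, ha, h⟩ =>
      (hU' a (Or.inr h)).imp (fun h => ⟨a, ha, h⟩) fun h => ⟨a, ha, h⟩
    have := ite_add_ite_le (fun h => h.elim (fun h => Or.inl (h₁ h).1) h₂) fun h _ => h₁ h
    omega
  · push Not at hSM
    obtain ⟨a, ha, hc⟩ := hSM
    exact hf.loss_le_of_cap_lt hM hS ha hc

/-- Moving one unit to a path that meets the arcs of maximum capacity only where the old path does;
on the arcs not in the old path there has to be room for it. -/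
theorem Sol.shift {N : ℕ} (hM : ∀ a, G.cap a ≤ G.M) {r : Finset A → ℕ} {P P' : Finset A}
    {i : K} (hz : G.Sol N fun X => r X + unit P X)
    (hP : ∀ l, P ∈ G.paths l ↔ l = i) (hP' : ∀ l, P' ∈ G.paths l ↔ l = i)
    (hroom : ∀ a ∈ P', a ∉ P → ∑ X ∈ G.all with a ∈ X, (r X + unit P X) < N * G.cap a)
    (htr : ∀ a ∈ P', G.cap a = G.M → a ∈ P) :
    G.Sol N fun X => r X + unit P' X := by
  have aP : P ∈ G.all := mem_all.2 ⟨i, (hP i).2 rfl⟩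
  have aP' : P' ∈ G.all := mem_all.2 ⟨i, (hP' i).2 rfl⟩
  have hf : G.IsFlow N fun X => r X + unit P' X := by
    refine ⟨fun a => ?_, fun l => Eq.trans ?_ (hz.dem_eq l)⟩
    · have h₁ := hz.cap_le a
      have h₂ := hroom a
      simp only [Finset.sum_add_distrib, sum_unit, Finset.mem_filter, aP, aP', true_and] at h₁ h₂ ⊢
      by_cases ha : a ∈ P <;> by_cases ha' : a ∈ P' <;> simp_all <;> omega
    · simp only [Finset.sum_add_distrib, sum_unit]
      rw [if_congr ((hP' l).trans (hP l).symm) rfl rfl]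
  refine ⟨hf, fun S hS => ?_⟩
  by_cases hSM : ∀ a ∈ S, G.cap a = G.M
  · refine le_trans (Nat.add_le_add_right ?_ N) (hz.loss_le S hS)
    simp only [Finset.sum_add_distrib, sum_unit, Finset.mem_filter, aP, aP', true_and]
    have e : ∀ X : Finset A, (X ∩ S).Nonempty ↔ ∃ a ∈ S, a ∈ X := fun X => by
      simp [Finset.Nonempty, and_comm]
    simp only [e]
    have h₁ : (∃ a ∈ S, a ∈ P') → (∃ a ∈ S, a ∈ P) := fun ⟨a, ha, h⟩ =>
      ⟨a, ha, htr a h (hSM a ha)⟩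
    by_cases h : ∃ a ∈ S, a ∈ P'
    · rw [if_pos h, if_pos (h₁ h)]
    · rw [if_neg h]; omega
  · push Not at hSM
    obtain ⟨a, ha, hc⟩ := hSM
    exact hf.loss_le_of_cap_lt hM hS ha hc

/-- The total amount of flow leaving a saturated source. -/
theorem IsFlow.saturated_src {N : ℕ} {z : Finset A → ℕ} (h : G.IsFlow N z) (i : K)
    (hne : G.src i ≠ G.snk i) [DecidableEq V]
    (hd : ∑ a with G.tl a = G.src i, G.cap a = G.dem i) {a : A} (ha : G.tl a = G.src i) :
    ∑ P ∈ G.paths i with a ∈ P, z P = N * G.cap a := by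
  have hle : ∀ b, ∑ P ∈ G.paths i with b ∈ P, z P ≤ N * G.cap b := fun b =>
    (Finset.sum_le_sum_of_subset (Finset.filter_subset_filter _
      (Finset.subset_biUnion_of_mem G.paths (Finset.mem_univ i)))).trans (h.cap_le b)
  -- Each path uses exactly one arc at its source, so the flows on these arcs add up to the demand,
  -- that is, to their total capacity. With the termwise bound, every arc is saturated.
  have hsum : ∑ b with G.tl b = G.src i, ∑ P ∈ G.paths i with b ∈ P, z P
      = ∑ b with G.tl b = G.src i, N * G.cap b := by
    rw [← Finset.mul_sum, hd, ← h.dem_eq i]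
    simp_rw [Finset.sum_filter (s := G.paths i)]
    rw [Finset.sum_comm]
    refine Finset.sum_congr rfl fun P hP => ?_
    rw [mem_paths] at hP
    obtain ⟨b, hb, hb'⟩ := hP.exists_first hne
    rw [Finset.sum_eq_single b]
    · simp [hb]
    · intro c hc hcb
      rw [if_neg]
      exact fun hcP => hcb (hP.tl_inj hcP hb (by simpa [hb'] using hc))
    · simp [hb']
  exact (Finset.sum_eq_sum_iff_of_le fun b _ => hle b).1 hsum a (by simpa using ha)

/-- The total amount of flow entering a saturated sink. -/
theorem IsFlow.saturated_snk {N : ℕ} {z : Finset A → ℕ} (h : G.IsFlow N z) (i : K)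
    (hne : G.src i ≠ G.snk i) [DecidableEq V]
    (hd : ∑ a with G.hd a = G.snk i, G.cap a = G.dem i) {a : A} (ha : G.hd a = G.snk i) :
    ∑ P ∈ G.paths i with a ∈ P, z P = N * G.cap a := by
  have hle : ∀ b, ∑ P ∈ G.paths i with b ∈ P, z P ≤ N * G.cap b := fun b =>
    (Finset.sum_le_sum_of_subset (Finset.filter_subset_filter _
      (Finset.subset_biUnion_of_mem G.paths (Finset.mem_univ i)))).trans (h.cap_le b)
  have hsum : ∑ b with G.hd b = G.snk i, ∑ P ∈ G.paths i with b ∈ P, z P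
      = ∑ b with G.hd b = G.snk i, N * G.cap b := by
    rw [← Finset.mul_sum, hd, ← h.dem_eq i]
    simp_rw [Finset.sum_filter (s := G.paths i)]
    rw [Finset.sum_comm]
    refine Finset.sum_congr rfl fun P hP => ?_
    rw [mem_paths] at hP
    obtain ⟨b, hb, hb'⟩ := hP.exists_last hne
    rw [Finset.sum_eq_single b]
    · simp [hb]
    · intro c hc hcb
      rw [if_neg]
      exact fun hcP => hcb (hP.hd_inj hcP hb (by simpa [hb'] using hc))
    · simp [hb']
  exact (Finset.sum_eq_sum_iff_of_le fun b _ => hle b).1 hsum a (by simpa using ha)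

end Inst

/-! ### The network of the reduction -/

/-- The parameters of the network: the digraph of the given instance with source `s` and sink `t`,
`ext` additional arcs of maximum capacity, the number of columns (binary splittings of a quantity
`W`), the number of rows besides row `0`, the links, which make pairs of arcs of maximum capacity
share flow, and the coefficients and right-hand sides of the rows. -/
structure Layout where
  numV : ℕ
  numA : ℕ
  tl : Fin numA → Fin numV
  hd : Fin numA → Fin numV
  s : Fin numV
  t : Fin numV
  ext : ℕ
  cols : ℕ
  rows : ℕ
  W : ℕ
  lk : Fin numA ⊕ Fin ext → Fin numA ⊕ Fin ext → ℕ
  coef : Fin (rows + 1) → Fin cols → Bool → ℕ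
  rhs : Fin (rows + 1) → ℕ

namespace Layout

/-- The arcs of maximum capacity. -/
abbrev Main (D : Layout) : Type := Fin D.numA ⊕ Fin D.ext

/-- The commodities: one for each row, column and arc of maximum capacity. -/
abbrev Com (D : Layout) : Type := Fin (D.rows + 1) ⊕ Fin D.cols ⊕ D.Main

/-- The nodes of the network. -/
inductive Node (D : Layout) : Type
  | orig (v : Fin D.numV)
  | src (i : D.Com)
  | snk (i : D.Com)
  | entry (i : D.Com)
  | exit (i : D.Com)
  | inn (c : D.Main)
  | out (c : D.Main)
  | chain (j : Fin D.cols) (h : Bool) (l : Fin (D.rows + 2))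

/-- The arcs of the network. -/
inductive Arc (D : Layout) : Type
  | directIn (i : D.Com) (c : D.Main)
  | directOut (i : D.Com) (c : D.Main)
  | feed (i : D.Com)
  | drain (i : D.Com)
  | main (c : D.Main)
  | origIn (a : Fin D.numA)
  | origOut (a : Fin D.numA)
  | toOrig
  | fromOrig
  | link (p q : D.Main)
  | linkIn (p : D.Main)
  | linkOut (p q : D.Main)
  | chainArc (j : Fin D.cols) (h : Bool) (l : Fin (D.rows + 1))
  | colIn (j : Fin D.cols) (h : Bool)
  | colOut (j : Fin D.cols) (h : Bool)
  | rowIn (l : Fin (D.rows + 1)) (j : Fin D.cols) (h : Bool)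
  | rowOut (l : Fin (D.rows + 1)) (j : Fin D.cols) (h : Bool)

variable {D : Layout}

noncomputable instance : DecidableEq D.Node := Classical.decEq _
noncomputable instance : DecidableEq D.Arc := Classical.decEq _

/-- The commodity of row `0`. -/
abbrev com0 : D.Com := Sum.inl 0
/-- The commodity of a row. -/
abbrev row (l : Fin (D.rows + 1)) : D.Com := Sum.inl l
/-- The commodity of a column. -/
abbrev col (j : Fin D.cols) : D.Com := Sum.inr (Sum.inl j)
/-- The commodity of an arc of maximum capacity. -/
abbrev lnk (p : D.Main) : D.Com := Sum.inr (Sum.inr p)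

/-- The nodes as a sum type. -/
abbrev NodeSum (D : Layout) : Type :=
  Fin D.numV ⊕ D.Com ⊕ D.Com ⊕ D.Com ⊕ D.Com ⊕ D.Main ⊕ D.Main ⊕
    (Fin D.cols × Bool × Fin (D.rows + 2))

/-- The arcs as a sum type. -/
abbrev ArcSum (D : Layout) : Type :=
  (D.Com × D.Main) ⊕ (D.Com × D.Main) ⊕ D.Com ⊕ D.Com ⊕ D.Main ⊕ Fin D.numA ⊕ Fin D.numA ⊕
    Unit ⊕ Unit ⊕ (D.Main × D.Main) ⊕ D.Main ⊕ (D.Main × D.Main) ⊕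
    (Fin D.cols × Bool × Fin (D.rows + 1)) ⊕ (Fin D.cols × Bool) ⊕ (Fin D.cols × Bool) ⊕
    (Fin (D.rows + 1) × Fin D.cols × Bool) ⊕ (Fin (D.rows + 1) × Fin D.cols × Bool)

/-- Nodes correspond to the elements of the sum type. -/
def nodeEquiv (D : Layout) : D.Node ≃ D.NodeSum where
  toFun
    | .orig v => .inl v
    | .src i => .inr (.inl i)
    | .snk i => .inr (.inr (.inl i))
    | .entry i => .inr (.inr (.inr (.inl i)))
    | .exit i => .inr (.inr (.inr (.inr (.inl i))))
    | .inn c => .inr (.inr (.inr (.inr (.inr (.inl c)))))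
    | .out c => .inr (.inr (.inr (.inr (.inr (.inr (.inl c))))))
    | .chain j h l => .inr (.inr (.inr (.inr (.inr (.inr (.inr (j, h, l)))))))
  invFun
    | .inl v => .orig v
    | .inr (.inl i) => .src i
    | .inr (.inr (.inl i)) => .snk i
    | .inr (.inr (.inr (.inl i))) => .entry i
    | .inr (.inr (.inr (.inr (.inl i)))) => .exit i
    | .inr (.inr (.inr (.inr (.inr (.inl c))))) => .inn c
    | .inr (.inr (.inr (.inr (.inr (.inr (.inl c)))))) => .out c
    | .inr (.inr (.inr (.inr (.inr (.inr (.inr (j, h, l))))))) => .chain j h l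
  left_inv x := by cases x <;> rfl
  right_inv x := by rcases x with _ | _ | _ | _ | _ | _ | _ | ⟨_, _, _⟩ <;> rfl

/-- Arcs correspond to the elements of the sum type. -/
def arcEquiv (D : Layout) : D.Arc ≃ D.ArcSum where
  toFun
    | .directIn i c => .inl (i, c)
    | .directOut i c => .inr (.inl (i, c))
    | .feed i => .inr (.inr (.inl i))
    | .drain i => .inr (.inr (.inr (.inl i)))
    | .main c => .inr (.inr (.inr (.inr (.inl c))))
    | .origIn a => .inr (.inr (.inr (.inr (.inr (.inl a)))))
    | .origOut a => .inr (.inr (.inr (.inr (.inr (.inr (.inl a))))))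
    | .toOrig => .inr (.inr (.inr (.inr (.inr (.inr (.inr (.inl ())))))))
    | .fromOrig => .inr (.inr (.inr (.inr (.inr (.inr (.inr (.inr (.inl ()))))))))
    | .link p q => .inr (.inr (.inr (.inr (.inr (.inr (.inr (.inr (.inr (.inl (p, q))))))))))
    | .linkIn p => .inr (.inr (.inr (.inr (.inr (.inr (.inr (.inr (.inr (.inr (.inl p))))))))))
    | .linkOut p q => .inr (.inr (.inr (.inr (.inr (.inr (.inr (.inr (.inr (.inr (.inr
        (.inl (p, q))))))))))))
    | .chainArc j h l => .inr (.inr (.inr (.inr (.inr (.inr (.inr (.inr (.inr (.inr (.inr (.inr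
        (.inl (j, h, l)))))))))))))
    | .colIn j h => .inr (.inr (.inr (.inr (.inr (.inr (.inr (.inr (.inr (.inr (.inr (.inr (.inr
        (.inl (j, h))))))))))))))
    | .colOut j h => .inr (.inr (.inr (.inr (.inr (.inr (.inr (.inr (.inr (.inr (.inr (.inr (.inr
        (.inr (.inl (j, h)))))))))))))))
    | .rowIn l j h => .inr (.inr (.inr (.inr (.inr (.inr (.inr (.inr (.inr (.inr (.inr (.inr (.inr
        (.inr (.inr (.inl (l, j, h))))))))))))))))
    | .rowOut l j h => .inr (.inr (.inr (.inr (.inr (.inr (.inr (.inr (.inr (.inr (.inr (.inr (.inr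
        (.inr (.inr (.inr (l, j, h))))))))))))))))
  invFun
    | .inl (i, c) => .directIn i c
    | .inr (.inl (i, c)) => .directOut i c
    | .inr (.inr (.inl i)) => .feed i
    | .inr (.inr (.inr (.inl i))) => .drain i
    | .inr (.inr (.inr (.inr (.inl c)))) => .main c
    | .inr (.inr (.inr (.inr (.inr (.inl a))))) => .origIn a
    | .inr (.inr (.inr (.inr (.inr (.inr (.inl a)))))) => .origOut a
    | .inr (.inr (.inr (.inr (.inr (.inr (.inr (.inl ()))))))) => .toOrig
    | .inr (.inr (.inr (.inr (.inr (.inr (.inr (.inr (.inl ())))))))) => .fromOrig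
    | .inr (.inr (.inr (.inr (.inr (.inr (.inr (.inr (.inr (.inl (p, q)))))))))) => .link p q
    | .inr (.inr (.inr (.inr (.inr (.inr (.inr (.inr (.inr (.inr (.inl p)))))))))) => .linkIn p
    | .inr (.inr (.inr (.inr (.inr (.inr (.inr (.inr (.inr (.inr (.inr
        (.inl (p, q)))))))))))) => .linkOut p q
    | .inr (.inr (.inr (.inr (.inr (.inr (.inr (.inr (.inr (.inr (.inr (.inr
        (.inl (j, h, l))))))))))))) => .chainArc j h l
    | .inr (.inr (.inr (.inr (.inr (.inr (.inr (.inr (.inr (.inr (.inr (.inr (.inr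
        (.inl (j, h)))))))))))))) => .colIn j h
    | .inr (.inr (.inr (.inr (.inr (.inr (.inr (.inr (.inr (.inr (.inr (.inr (.inr
        (.inr (.inl (j, h))))))))))))))) => .colOut j h
    | .inr (.inr (.inr (.inr (.inr (.inr (.inr (.inr (.inr (.inr (.inr (.inr (.inr
        (.inr (.inr (.inl (l, j, h)))))))))))))))) => .rowIn l j h
    | .inr (.inr (.inr (.inr (.inr (.inr (.inr (.inr (.inr (.inr (.inr (.inr (.inr
        (.inr (.inr (.inr (l, j, h)))))))))))))))) => .rowOut l j h
  left_inv x := by cases x <;> rfl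
  right_inv x := by
    rcases x with ⟨_, _⟩ | ⟨_, _⟩ | _ | _ | _ | _ | _ | _ | _ | ⟨_, _⟩ | _ | ⟨_, _⟩ | ⟨_, _, _⟩ |
      ⟨_, _⟩ | ⟨_, _⟩ | ⟨_, _, _⟩ | ⟨_, _, _⟩ <;> rfl

instance : Fintype D.Arc := Fintype.ofEquiv _ (arcEquiv D).symm

/-- The tail of an arc. -/
def tail : D.Arc → D.Node
  | .directIn i _ => .src i
  | .directOut _ c => .out c
  | .feed i => .src i
  | .drain i => .exit i
  | .main c => .inn c
  | .origIn a => .orig (D.tl a)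
  | .origOut a => .out (.inl a)
  | .toOrig => .entry com0
  | .fromOrig => .orig D.t
  | .link p _ => .out p
  | .linkIn p => .entry (lnk p)
  | .linkOut _ q => .out q
  | .chainArc j h l => .chain j h l.castSucc
  | .colIn j _ => .entry (col j)
  | .colOut j h => .chain j h (Fin.last _)
  | .rowIn l _ _ => .entry (row l)
  | .rowOut l j h => .chain j h l.succ

/-- The head of an arc. -/
def head : D.Arc → D.Node
  | .directIn _ c => .inn c
  | .directOut i _ => .snk i
  | .feed i => .entry i
  | .drain i => .snk i
  | .main c => .out c
  | .origIn a => .inn (.inl a)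
  | .origOut a => .orig (D.hd a)
  | .toOrig => .orig D.s
  | .fromOrig => .exit com0
  | .link _ q => .inn q
  | .linkIn p => .inn p
  | .linkOut p _ => .exit (lnk p)
  | .chainArc j h l => .chain j h l.succ
  | .colIn j h => .chain j h 0
  | .colOut j _ => .exit (col j)
  | .rowIn l j h => .chain j h l.castSucc
  | .rowOut l _ _ => .exit (row l)

variable (D)

/-- The number of links leaving an arc of maximum capacity. -/
def outdeg (p : D.Main) : ℕ := ∑ q, D.lk p q

/-- The number of links entering an arc of maximum capacity. -/
def indeg (q : D.Main) : ℕ := ∑ p, D.lk p q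

/-- The number of commodities. -/
def numK : ℕ := D.rows + 1 + (D.cols + (D.numA + D.ext))

/-- The amount of flow of a commodity that does not go directly along one arc of maximum
capacity. -/
def core : D.Com → ℕ
  | .inl l => D.rhs l
  | .inr (.inl _) => D.W
  | .inr (.inr p) => D.outdeg p

/-- The maximum capacity. -/
def maxc : ℕ :=
  10 + 2 * D.numK + 2 * (D.numA + D.ext) + 2 * (D.numA + D.ext) * D.numK + D.W + ∑ i, D.core i

/-- The flow on an arc of maximum capacity that is not direct. -/
def used (c : D.Main) : ℕ := D.outdeg c + D.indeg c + if c.isLeft then 1 else 0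

/-- The amount of flow of a commodity going directly along an arc of maximum capacity. -/
def direct (i : D.Com) (c : D.Main) : ℕ :=
  if i = com0 then D.maxc - 2 * (D.numK - 1) - D.used c else 2

/-- The capacities. -/
def capacity : D.Arc → ℕ
  | .directIn i c => D.direct i c
  | .directOut i c => D.direct i c
  | .feed i => D.core i
  | .drain i => D.core i
  | .main _ => D.maxc
  | .origIn _ => 1
  | .origOut _ => 1
  | .toOrig => D.rhs 0
  | .fromOrig => D.rhs 0
  | .link p q => D.lk p q
  | .linkIn p => D.outdeg p
  | .linkOut p q => D.lk p q
  | .chainArc _ _ _ => D.W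
  | .colIn _ _ => D.W
  | .colOut _ _ => D.W
  | .rowIn l j h => D.W * D.coef l j h
  | .rowOut l j h => D.W * D.coef l j h

/-- The demands. -/
def demand (i : D.Com) : ℕ := ∑ c, D.direct i c + D.core i

/-- The multicommodity flow instance of the reduction. -/
@[simps]
def inst : Inst D.Node D.Arc D.Com where
  tl := tail
  hd := head
  src := .src
  snk := .snk
  cap := D.capacity
  dem := D.demand
  k := D.ext + 1
  M := D.maxc

/-- The conditions on the parameters that make the reduction work. -/
structure Valid : Prop where
  ext_lt : D.ext < D.numA
  cols_pos : 0 < D.cols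
  lk_le : ∀ p q, D.lk p q ≤ 1
  lk_self : ∀ p, D.lk p p = 0
  lk_inr : ∀ p e, D.lk p (.inr e) = 0
  lk_inr_inl : ∀ e a, D.lk (.inr e) (.inl a) = 1
  coef_le : ∀ l j h, D.coef l j h ≤ 1

variable {D}

theorem outdeg_le (h : D.Valid) (p : D.Main) : D.outdeg p ≤ D.numA + D.ext := by
  simpa [outdeg] using Finset.sum_le_sum (s := Finset.univ) fun q _ => h.lk_le p q

theorem indeg_le (h : D.Valid) (q : D.Main) : D.indeg q ≤ D.numA + D.ext := by
  simpa [indeg] using Finset.sum_le_sum (s := Finset.univ) fun p _ => h.lk_le p q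

theorem core_le (i : D.Com) : D.core i + 10 + D.W ≤ D.maxc := by
  have := Finset.single_le_sum (f := D.core) (fun _ _ => Nat.zero_le _) (Finset.mem_univ i)
  simp only [maxc]; omega

/-- `maxc` is large enough that the subtractions in the direct flow of `com0` are not truncated. -/
theorem used_le (h : D.Valid) (c : D.Main) : 2 * (D.numK - 1) + D.used c ≤ D.maxc := by
  have h₁ := outdeg_le h c
  have h₂ := indeg_le h c
  have h₃ : (if c.isLeft then 1 else 0) ≤ 1 := by split_ifs <;> omega
  simp only [maxc, used]
  generalize 2 * (D.numA + D.ext) * D.numK = x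
  omega

theorem numK_gt (h : D.Valid) : 2 < D.numK := by
  have := h.cols_pos
  have := h.ext_lt
  simp only [numK]; omega

theorem direct_of_ne {i : D.Com} (hi : i ≠ com0) (c : D.Main) : D.direct i c = 2 := by
  simp [direct, hi]

theorem card_com : Fintype.card D.Com = D.numK := by simp [numK]

/-- The direct flow of `com0` is defined as the amount that fills the arc up to its capacity. This
exact balance turns a bound on the total loss into a bound on the `s`-`t` flow lost. -/
theorem sum_direct_add (h : D.Valid) (c : D.Main) : ∑ i, D.direct i c + D.used c = D.maxc := by
  have h₁ : ∑ i ∈ Finset.univ.erase com0, D.direct i c = 2 * (D.numK - 1) := by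
    rw [Finset.sum_congr rfl fun i hi => direct_of_ne (Finset.ne_of_mem_erase hi) c]
    simp [Finset.card_erase_of_mem, card_com, -Fintype.card_sum, mul_comm]
  have h₂ := used_le h c
  rw [← Finset.add_sum_erase _ _ (Finset.mem_univ com0), h₁]
  simp only [direct, if_true]
  omega

/-- The gap of 3 ensures that even an arc of capacity at least `M - 2` is a main arc. For the direct
arcs of `com0` it comes from the two units reserved for each of at least two other commodities. -/
theorem capacity_lt (h : D.Valid) (a : D.Arc) (ha : ∀ c, a ≠ .main c) :
    D.capacity a + 3 ≤ D.maxc := by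
  have hd : ∀ i c, D.direct i c + 3 ≤ D.maxc := fun i c => by
    have := used_le h c
    have := numK_gt h
    have := core_le (D := D) com0
    unfold direct
    split_ifs <;> omega
  have hc := fun i => core_le (D := D) i
  have hc0 := hc com0
  have hlk := fun p q => h.lk_le p q
  have hco : ∀ l j b, D.W * D.coef l j b ≤ D.W := fun l j b => by
    simpa using Nat.mul_le_mul_left D.W (h.coef_le l j b)
  cases a with
  | directIn i c => exact hd i c
  | directOut i c => exact hd i c
  | feed i => have := hc i; simp only [capacity]; omega
  | drain i => have := hc i; simp only [capacity]; omega
  | main c => exact absurd rfl (ha c)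
  | origIn a => simp only [capacity]; omega
  | origOut a => simp only [capacity]; omega
  | toOrig => have := hc (row 0); simp only [capacity]; simp only [core] at this; omega
  | fromOrig => have := hc (row 0); simp only [capacity]; simp only [core] at this; omega
  | link p q => have := hlk p q; simp only [capacity]; omega
  | linkIn p => have := hc (lnk p); simp only [capacity]; simp only [core] at this; omega
  | linkOut p q => have := hlk p q; simp only [capacity]; omega
  | chainArc => simp only [capacity]; omega
  | colIn => simp only [capacity]; omega
  | colOut => simp only [capacity]; omega
  | rowIn l j b => have := hco l j b; simp only [capacity]; omega
  | rowOut l j b => have := hco l j b; simp only [capacity]; omega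

theorem capacity_le (h : D.Valid) (a : D.Arc) : D.capacity a ≤ D.maxc := by
  by_cases ha : ∃ c, a = .main c
  · obtain ⟨c, rfl⟩ := ha; exact le_rfl
  · push Not at ha
    have := capacity_lt h a ha
    omega

theorem capacity_eq_iff (h : D.Valid) (a : D.Arc) : D.capacity a = D.maxc ↔ ∃ c, a = .main c := by
  constructor
  · intro ha
    by_contra hc
    push Not at hc
    have := capacity_lt h a hc
    omega
  · rintro ⟨c, rfl⟩; rfl

theorem sum_arc {β : Type*} [AddCommMonoid β] (f : D.Arc → β) :
    ∑ a, f a = ∑ x : D.ArcSum, f ((arcEquiv D).symm x) := ((arcEquiv D).symm.sum_comp f).symm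

end Layout

namespace Layout

variable {D : Layout}

/-! ### Saturated sources and sinks -/

theorem head_ne_src (a : D.Arc) (i : D.Com) : head a ≠ .src i := by cases a <;> simp [head]

theorem tail_ne_snk (a : D.Arc) (i : D.Com) : tail a ≠ .snk i := by cases a <;> simp [tail]

theorem filter_tail_src (i : D.Com) : (Finset.univ.filter fun a : D.Arc => tail a = .src i) =
    insert (.feed i) (Finset.univ.image (Arc.directIn i)) := by
  ext a; cases a <;> simp [tail, eq_comm]

theorem filter_head_snk (i : D.Com) : (Finset.univ.filter fun a : D.Arc => head a = .snk i) =
    insert (.drain i) (Finset.univ.image (Arc.directOut i)) := by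
  ext a; cases a <;> simp [head, eq_comm]

theorem sum_src (i : D.Com) : ∑ a with tail a = .src i, D.capacity a = D.demand i := by
  rw [filter_tail_src, Finset.sum_insert (by simp), Finset.sum_image (fun _ _ _ _ h => by simpa using h), add_comm]
  rfl

theorem sum_snk (i : D.Com) : ∑ a with head a = .snk i, D.capacity a = D.demand i := by
  rw [filter_head_snk, Finset.sum_insert (by simp), Finset.sum_image (fun _ _ _ _ h => by simpa using h), add_comm]
  rfl

theorem mem_paths {i : D.Com} {P : Finset D.Arc} :
    P ∈ D.inst.paths i ↔ SimplePath tail head (Node.src i) (.snk i) P := Inst.mem_paths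

/-- No arc enters a source, so an arc leaving a source can only be the first arc of a path and
reveals its commodity. -/
theorem com_unique {i j : D.Com} {P : Finset D.Arc} (h : P ∈ D.inst.paths i)
    (h' : P ∈ D.inst.paths j) : j = i := by
  rw [mem_paths] at h h'
  obtain ⟨a, ha, e⟩ := h.exists_first (by simp)
  have := h'.start_eq ha fun b => e ▸ head_ne_src b i
  simpa using (e.symm.trans this).symm

theorem mem_paths_iff {i : D.Com} {P : Finset D.Arc} (h : P ∈ D.inst.paths i) (j : D.Com) :
    P ∈ D.inst.paths j ↔ j = i := ⟨com_unique h, fun e => e ▸ h⟩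

section Structure

variable {N : ℕ} {z : Finset D.Arc → ℕ}

theorem flow_src (h : D.inst.IsFlow N z) {i : D.Com} {a : D.Arc} (ha : tail a = .src i) :
    ∑ P ∈ D.inst.paths i with a ∈ P, z P = N * D.capacity a :=
  h.saturated_src i (by simp) (sum_src i) ha

theorem flow_snk (h : D.inst.IsFlow N z) {i : D.Com} {a : D.Arc} (ha : head a = .snk i) :
    ∑ P ∈ D.inst.paths i with a ∈ P, z P = N * D.capacity a :=
  h.saturated_snk i (by simp) (sum_snk i) ha

theorem com_of_src {i j : D.Com} {P : Finset D.Arc} (h : P ∈ D.inst.paths i) {a : D.Arc}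
    (ha : a ∈ P) (e : tail a = .src j) : j = i := by
  rw [mem_paths] at h
  simpa using (e.symm.trans (h.start_eq ha fun b => e ▸ head_ne_src b j))

theorem com_of_snk {i j : D.Com} {P : Finset D.Arc} (h : P ∈ D.inst.paths i) {a : D.Arc}
    (ha : a ∈ P) (e : head a = .snk j) : j = i := by
  rw [mem_paths] at h
  simpa using (e.symm.trans (h.end_eq ha fun b => e ▸ tail_ne_snk b j))

theorem main_of_inn {i : D.Com} {P : Finset D.Arc} (h : P ∈ D.inst.paths i) {a : D.Arc}
    (ha : a ∈ P) {c : D.Main} (e : head a = .inn c) : Arc.main c ∈ P := by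
  rw [mem_paths] at h
  obtain ⟨b, hb, e'⟩ := h.exists_next ha (by simp [e])
  rw [e] at e'
  cases b <;> simp [tail] at e'
  subst e'; exact hb

theorem main_of_out {i : D.Com} {P : Finset D.Arc} (h : P ∈ D.inst.paths i) {a : D.Arc}
    (ha : a ∈ P) {c : D.Main} (e : tail a = .out c) : Arc.main c ∈ P := by
  rw [mem_paths] at h
  obtain ⟨b, hb, e'⟩ := h.exists_prev ha (by simp [e])
  rw [e] at e'
  cases b <;> simp [head] at e'
  subst e'; exact hb

/-- The core entry of a commodity is only used by the commodity. -/
theorem feed_of_entry {i j : D.Com} {P : Finset D.Arc} (h : P ∈ D.inst.paths i) {a : D.Arc}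
    (ha : a ∈ P) (e : tail a = .entry j) : j = i ∧ Arc.feed j ∈ P := by
  have h' := mem_paths.1 h
  obtain ⟨b, hb, e'⟩ := h'.exists_prev ha (by simp [e])
  rw [e] at e'
  cases b <;> simp [head] at e'
  subst e'
  exact ⟨com_of_src h hb rfl, hb⟩

/-- The core exit of a commodity is only used by the commodity. -/
theorem drain_of_exit {i j : D.Com} {P : Finset D.Arc} (h : P ∈ D.inst.paths i) {a : D.Arc}
    (ha : a ∈ P) (e : head a = .exit j) : j = i ∧ Arc.drain j ∈ P := by
  have h' := mem_paths.1 h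
  obtain ⟨b, hb, e'⟩ := h'.exists_next ha (by simp [e])
  rw [e] at e'
  cases b <;> simp [tail] at e'
  subst e'
  exact ⟨com_of_snk h hb rfl, hb⟩

/-- A path starts directly or with its core entry. -/
theorem first_arc {i : D.Com} {P : Finset D.Arc} (h : P ∈ D.inst.paths i) :
    (∃ c, Arc.directIn i c ∈ P) ∨ Arc.feed i ∈ P := by
  rw [mem_paths] at h
  obtain ⟨b, hb, e⟩ := h.exists_first (by simp)
  cases b <;> simp [tail] at e
  · subst e; exact Or.inl ⟨_, hb⟩
  · subst e; exact Or.inr hb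

end Structure

/-! ### Intended paths -/

/-- The direct path along an arc of maximum capacity. -/
noncomputable def dpath (i : D.Com) (c : D.Main) : Finset D.Arc := {.directIn i c, .main c, .directOut i c}

/-- The path of commodity `lnk p` along the link from `p` to `q`. -/
noncomputable def lpath (p q : D.Main) : Finset D.Arc :=
  {.feed (lnk p), .linkIn p, .main p, .link p q, .main q, .linkOut p q, .drain (lnk p)}

theorem dpath_mem (i : D.Com) (c : D.Main) : dpath i c ∈ D.inst.paths i :=
  mem_paths.2 ⟨[.directIn i c, .main c, .directOut i c], by simp [Walk, tail, head],
    by simp [head], by simp [dpath]⟩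

theorem lpath_mem {p q : D.Main} (hpq : p ≠ q) : lpath p q ∈ D.inst.paths (lnk p) :=
  mem_paths.2 ⟨[.feed (lnk p), .linkIn p, .main p, .link p q, .main q, .linkOut p q,
    .drain (lnk p)], by simp [Walk, tail, head], by simp [head, hpq], by simp [lpath]⟩

/-- The arc of maximum capacity in between is forced, so `P` contains the whole direct path and
`eq_of_subset` applies. -/
theorem eq_dpath {i : D.Com} {c : D.Main} {P : Finset D.Arc} (h : P ∈ D.inst.paths i)
    (h₁ : Arc.directIn i c ∈ P) (h₂ : Arc.directOut i c ∈ P) : P = dpath i c := by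
  refine (SimplePath.eq_of_subset (mem_paths.1 h) (mem_paths.1 (dpath_mem i c)) ?_).symm
  have := main_of_inn h h₁ rfl
  simp [dpath, Finset.insert_subset_iff, *]

theorem eq_lpath {p q : D.Main} (hpq : p ≠ q) {P : Finset D.Arc}
    (h : P ∈ D.inst.paths (lnk p))
    (h₁ : Arc.feed (lnk p) ∈ P) (h₂ : Arc.link p q ∈ P) (h₃ : Arc.linkOut p q ∈ P) :
    P = lpath p q := by
  refine (SimplePath.eq_of_subset (mem_paths.1 h) (mem_paths.1 (lpath_mem hpq)) ?_).symm
  have h₄ : Arc.linkIn p ∈ P := by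
    obtain ⟨b, hb, e⟩ := (mem_paths.1 h).exists_next h₁ (by simp [head])
    cases b <;> simp [tail, head] at e
    subst e; exact hb
  have h₅ := main_of_inn h h₄ rfl
  have h₆ := main_of_inn h h₂ rfl
  have h₇ := (drain_of_exit h h₃ rfl).2
  simp [lpath, Finset.insert_subset_iff, *]

theorem next_feed_lnk {p : D.Main} {P : Finset D.Arc} (h : P ∈ D.inst.paths (lnk p))
    (h₁ : Arc.feed (lnk p) ∈ P) : Arc.linkIn p ∈ P := by
  obtain ⟨b, hb, e⟩ := (mem_paths.1 h).exists_next h₁ (by simp [head])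
  cases b <;> simp [tail, head] at e
  subst e; exact hb

variable (D) in
/-- The intended paths. -/
noncomputable def intended : Finset (Finset D.Arc) :=
  Finset.univ.image (fun x : D.Com × D.Main => dpath x.1 x.2) ∪
    (Finset.univ.filter fun x : D.Main × D.Main => D.lk x.1 x.2 = 1).image
      fun x => lpath x.1 x.2

theorem dpath_mem_intended (i : D.Com) (c : D.Main) : dpath i c ∈ D.intended :=
  Finset.mem_union_left _ (Finset.mem_image.2 ⟨(i, c), Finset.mem_univ _, rfl⟩)

theorem lpath_mem_intended {p q : D.Main} (h : D.lk p q = 1) : lpath p q ∈ D.intended :=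
  Finset.mem_union_right _ (Finset.mem_image.2 ⟨(p, q), by simpa using h, rfl⟩)

theorem mem_intended {P : Finset D.Arc} (h : P ∈ D.intended) :
    (∃ i c, P = dpath i c) ∨ ∃ p q, D.lk p q = 1 ∧ P = lpath p q := by
  rcases Finset.mem_union.1 h with h | h
  · obtain ⟨x, _, rfl⟩ := Finset.mem_image.1 h
    exact Or.inl ⟨_, _, rfl⟩
  · obtain ⟨x, hx, rfl⟩ := Finset.mem_image.1 h
    exact Or.inr ⟨_, _, by simpa using hx, rfl⟩

theorem lk_ne (hV : D.Valid) {p q : D.Main} (h : D.lk p q = 1) : p ≠ q := by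
  rintro rfl
  rw [hV.lk_self] at h; omega

theorem intended_subset (hV : D.Valid) : D.intended ⊆ D.inst.all := by
  intro P hP
  rcases mem_intended hP with ⟨i, c, rfl⟩ | ⟨p, q, h, rfl⟩
  · exact Inst.mem_all.2 ⟨_, dpath_mem i c⟩
  · exact Inst.mem_all.2 ⟨_, lpath_mem (lk_ne hV h)⟩

theorem not_intended_of_directIn {P : Finset D.Arc} {i : D.Com} {c : D.Main}
    (h : Arc.directIn i c ∈ P) (hne : P ≠ dpath i c) : P ∉ D.intended := by
  intro hP
  rcases mem_intended hP with ⟨i', c', rfl⟩ | ⟨p, q, _, rfl⟩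
  · simp [dpath] at h
    obtain ⟨rfl, rfl⟩ := h
    exact hne rfl
  · simp [lpath] at h

theorem not_intended_of_directOut {P : Finset D.Arc} {i : D.Com} {c : D.Main}
    (h : Arc.directOut i c ∈ P) (hne : P ≠ dpath i c) : P ∉ D.intended := by
  intro hP
  rcases mem_intended hP with ⟨i', c', rfl⟩ | ⟨p, q, _, rfl⟩
  · simp [dpath] at h
    obtain ⟨rfl, rfl⟩ := h
    exact hne rfl
  · simp [lpath] at h

theorem not_intended_of_link {P : Finset D.Arc} {p q : D.Main}
    (h : Arc.link p q ∈ P) (hne : P ≠ lpath p q) : P ∉ D.intended := by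
  intro hP
  rcases mem_intended hP with ⟨i', c', rfl⟩ | ⟨p, q, _, rfl⟩
  · simp [dpath] at h
  · simp [lpath] at h
    obtain ⟨rfl, rfl⟩ := h
    exact hne rfl

theorem not_intended_of_linkOut {P : Finset D.Arc} {p q : D.Main}
    (h : Arc.linkOut p q ∈ P) (hne : P ≠ lpath p q) : P ∉ D.intended := by
  intro hP
  rcases mem_intended hP with ⟨i', c', rfl⟩ | ⟨p, q, _, rfl⟩
  · simp [dpath] at h
  · simp [lpath] at h
    obtain ⟨rfl, rfl⟩ := h
    exact hne rfl

/-- The amount of flow on the last arc of a link path is forced. -/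
theorem flow_linkOut {N : ℕ} {z : Finset D.Arc → ℕ} (h : D.inst.IsFlow N z) (p q : D.Main) :
    ∑ P ∈ D.inst.paths (lnk p) with Arc.linkOut p q ∈ P, z P = N * D.lk p q := by
  have hle : ∀ q, ∑ P ∈ D.inst.paths (lnk p) with Arc.linkOut p q ∈ P, z P ≤ N * D.lk p q :=
    fun q => (Finset.sum_le_sum_of_subset (Finset.filter_subset_filter _
      (Finset.subset_biUnion_of_mem D.inst.paths (Finset.mem_univ _)))).trans
      (h.cap_le (.linkOut p q))
  -- The saturated drain of `lnk p` has the total capacity of the arcs `linkOut p q`, and a path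
  -- using the drain arrives by exactly one of them.
  have hsum : ∑ q, ∑ P ∈ D.inst.paths (lnk p) with Arc.linkOut p q ∈ P, z P
      = ∑ q, N * D.lk p q := by
    rw [← Finset.mul_sum]
    refine Eq.trans ?_ (flow_snk (i := lnk p) h (a := .drain (lnk p)) rfl)
    simp_rw [Finset.sum_filter]
    rw [Finset.sum_comm]
    refine Finset.sum_congr rfl fun P hP => ?_
    have hP' := mem_paths.1 hP
    by_cases hd : Arc.drain (lnk p) ∈ P
    · obtain ⟨b, hb, e⟩ := hP'.exists_prev hd (by simp [tail])
      cases b <;> simp [tail, head] at e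
      rename_i p' q'
      subst e
      rw [Finset.sum_eq_single q', if_pos hb, if_pos hd]
      · intro c _ hc
        rw [if_neg fun hcP => hc ?_]
        simpa using hP'.hd_inj hcP hb rfl
      · simp
    · rw [if_neg hd]
      refine Finset.sum_eq_zero fun q _ => if_neg fun hq => hd (drain_of_exit hP hq rfl).2
  exact (Finset.sum_eq_sum_iff_of_le fun q _ => hle q).1 hsum q (Finset.mem_univ q)

end Layout

theorem exists_pos_ne {β : Type*} {F : Finset β} {z : β → ℕ} {b : β} (hb : b ∈ F)
    (h : ∑ x ∈ F, z x ≠ z b) : ∃ x ∈ F, x ≠ b ∧ 0 < z x := by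
  by_contra hc
  push Not at hc
  exact h (Finset.sum_eq_single b (fun x hx hne => by have := hc x hx hne; omega)
    fun h => absurd hb h)

namespace Layout

variable {D : Layout} {N : ℕ} {z : Finset D.Arc → ℕ}

/-! ### Uncrossing -/

/-- The flow on intended paths is the potential that makes uncrossing terminate. -/
theorem sum_intended_swap {r : Finset D.Arc → ℕ} {P Q P' Q' : Finset D.Arc}
    (hP : P ∉ D.intended) (hQ : Q ∉ D.intended) (hP' : P' ∈ D.intended) :
    ∑ X ∈ D.intended, (r X + Inst.unit P X + Inst.unit Q X) <
      ∑ X ∈ D.intended, (r X + Inst.unit P' X + Inst.unit Q' X) := by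
  simp only [Finset.sum_add_distrib, Inst.sum_unit, hP, hQ, hP', if_true, if_false]
  omega

theorem sum_intended_shift {r : Finset D.Arc → ℕ} {P P' : Finset D.Arc}
    (hP : P ∉ D.intended) (hP' : P' ∈ D.intended) :
    ∑ X ∈ D.intended, (r X + Inst.unit P X) < ∑ X ∈ D.intended, (r X + Inst.unit P' X) := by
  simp only [Finset.sum_add_distrib, Inst.sum_unit, hP, hP', if_true, if_false]
  omega

/-- The first and the last arc of the direct path are saturated by commodity `i`. If the direct path
does not carry all of this flow, some path `X` starts like it and another path `Y` ends like it.
Both pass `main c`, and exchanging their parts after this arc creates one more unit on the direct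
path. -/
theorem exists_better_of_direct (hV : D.Valid) (hz : D.inst.Sol N z) {i : D.Com} {c : D.Main}
    (hne : z (dpath i c) ≠ N * D.direct i c) :
    ∃ z', D.inst.Sol N z' ∧ ∑ X ∈ D.intended, z X < ∑ X ∈ D.intended, z' X := by
  obtain ⟨X, hX, hXne, hXpos⟩ := exists_pos_ne (z := z) (b := dpath i c)
    (F := (D.inst.paths i).filter (Arc.directIn i c ∈ ·))
    (Finset.mem_filter.2 ⟨dpath_mem i c, by simp [dpath]⟩)
    (by rw [flow_src hz.toIsFlow rfl]; exact hne.symm)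
  obtain ⟨Y, hY, hYne, hYpos⟩ := exists_pos_ne (z := z) (b := dpath i c)
    (F := (D.inst.paths i).filter (Arc.directOut i c ∈ ·))
    (Finset.mem_filter.2 ⟨dpath_mem i c, by simp [dpath]⟩)
    (by rw [flow_snk hz.toIsFlow rfl]; exact hne.symm)
  rw [Finset.mem_filter] at hX hY
  obtain ⟨hX, hXin⟩ := hX
  obtain ⟨hY, hYout⟩ := hY
  have hXY : X ≠ Y := by
    rintro rfl
    exact hXne (eq_dpath hX hXin hYout)
  have hXm : Arc.main c ∈ X := main_of_inn hX hXin rfl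
  have hYm : Arc.main c ∈ Y := main_of_out hY hYout rfl
  obtain ⟨l₁, l₂, -, w₂, -, rfl⟩ := (mem_paths.1 hX).split hXm
  obtain ⟨l₃, l₄, w₃, -, -, rfl⟩ := (mem_paths.1 hY).split hYm
  obtain ⟨Q', hQ', hsub⟩ := Walk.exists_simplePath (l := l₃ ++ .main c :: l₂) (v := Node.src i)
    (w := .snk i) (tl := tail) (hd := head) (w₃.append ⟨rfl, w₂⟩)
  obtain ⟨r, rfl⟩ := Inst.exists_eq_add_unit_add_unit hXpos hYpos hXY
  refine ⟨_, hz.swap (P' := dpath i c) (Q' := Q') (i := i) (j := i) (capacity_le hV)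
    (mem_paths_iff hX) (mem_paths_iff hY) (mem_paths_iff (dpath_mem i c))
    (mem_paths_iff (mem_paths.2 hQ')) ?_ ?_ ?_,
    sum_intended_swap (not_intended_of_directIn hXin hXne) (not_intended_of_directOut hYout hYne)
      (dpath_mem_intended i c)⟩
  · refine Finset.union_subset ?_ (hsub.trans ?_)
    · intro a ha
      simp only [dpath, Finset.mem_insert, Finset.mem_singleton] at ha
      rcases ha with rfl | rfl | rfl
      · exact Finset.mem_union_left _ hXin
      · exact Finset.mem_union_left _ hXm
      · exact Finset.mem_union_right _ hYout
    · intro a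
      simp only [List.mem_toFinset, List.mem_append, List.mem_cons, Finset.mem_union]
      rintro (h | h | h)
      · exact Or.inr (Or.inl h)
      · exact Or.inl (Or.inr (Or.inl h))
      · exact Or.inl (Or.inr (Or.inr h))
  -- An arc common to both new paths must lie on both old ones. In the second new path `directIn`
  -- can only come from the initial part of `Y`, since no arc enters a source, and `directOut` only
  -- from the final part of `X`, since no arc leaves a sink.
  · intro a ha
    rw [Finset.mem_inter] at ha
    obtain ⟨ha, haQ⟩ := ha
    have haQ := hsub haQ
    simp only [dpath, Finset.mem_insert, Finset.mem_singleton] at ha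
    rcases ha with rfl | rfl | rfl
    · refine Finset.mem_inter.2 ⟨hXin, ?_⟩
      simp only [List.mem_toFinset, List.mem_append, List.mem_cons] at haQ ⊢
      rcases haQ with h | h | h
      · exact Or.inl h
      · cases h
      · rcases w₂.tl_mem h with e | ⟨b, e⟩
        · simp [tail, head] at e
        · exact absurd e (head_ne_src _ _)
    · exact Finset.mem_inter.2 ⟨hXm, hYm⟩
    · refine Finset.mem_inter.2 ⟨?_, hYout⟩
      simp only [List.mem_toFinset, List.mem_append, List.mem_cons] at haQ ⊢
      rcases haQ with h | h | h
      · rcases w₃.hd_mem h with e | ⟨b, e⟩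
        · simp [tail, head] at e
        · exact absurd e (tail_ne_snk _ _)
      · cases h
      · exact Or.inr (Or.inr h)
  · intro a ha hM
    obtain ⟨c', rfl⟩ := (capacity_eq_iff hV a).1 hM
    simp only [dpath, Finset.mem_insert, Finset.mem_singleton] at ha
    rcases ha with h | h | h
    · cases h
    · cases h; exact ⟨hXm, hYm⟩
    · cases h

/-- The flow on `linkOut p q` is forced. If the link path does not carry it, some path `Q` gets from
`main p` to `main q` by a detour. Either another path occupies the link, and the two exchange detour
and link, or the link has room and `Q` moves onto it. -/
theorem exists_better_of_link (hV : D.Valid) (hz : D.inst.Sol N z)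
    (hdir : ∀ i c, z (dpath i c) = N * D.direct i c) {p q : D.Main} (hlk : D.lk p q = 1)
    (hne : z (lpath p q) ≠ N) :
    ∃ z', D.inst.Sol N z' ∧ ∑ X ∈ D.intended, z X < ∑ X ∈ D.intended, z' X := by
  have hpq := lk_ne hV hlk
  have hLm := lpath_mem hpq
  obtain ⟨Q, hQ, hQne, hQpos⟩ := exists_pos_ne (z := z) (b := lpath p q)
    (F := (D.inst.paths (lnk p)).filter (Arc.linkOut p q ∈ ·))
    (Finset.mem_filter.2 ⟨hLm, by simp [lpath]⟩)
    (by rw [flow_linkOut hz.toIsFlow, hlk]; simpa using hne.symm)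
  rw [Finset.mem_filter] at hQ
  obtain ⟨hQ, hQout⟩ := hQ
  have hQint := not_intended_of_linkOut hQout hQne
  -- By `hdir` the direct paths exhaust the arcs `directIn`, so `Q`, which is not intended, cannot
  -- start with one of them.
  have hQfeed : Arc.feed (lnk p) ∈ Q := by
    rcases first_arc hQ with ⟨c, hc⟩ | h
    · exfalso
      have h₁ := flow_src hz.toIsFlow (i := lnk p) (a := .directIn (lnk p) c) rfl
      have hd : dpath (lnk p) c ∈ (D.inst.paths (lnk p)).filter (Arc.directIn (lnk p) c ∈ ·) :=
        Finset.mem_filter.2 ⟨dpath_mem _ _, by simp [dpath]⟩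
      rw [← Finset.add_sum_erase _ _ hd, hdir] at h₁
      have h₂ := Finset.single_le_sum (f := z) (fun _ _ => Nat.zero_le _)
        (s := ((D.inst.paths (lnk p)).filter (Arc.directIn (lnk p) c ∈ ·)).erase
          (dpath (lnk p) c)) (a := Q) (Finset.mem_erase.2 ⟨fun e : Q = dpath (lnk p) c =>
          hQint (e.symm ▸ dpath_mem_intended (lnk p) c), Finset.mem_filter.2 ⟨hQ, hc⟩⟩)
      simp only [capacity] at h₁
      omega
    · exact h
  have hQlink : Arc.link p q ∉ Q := fun h => hQne (eq_lpath hpq hQ hQfeed h hQout)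
  have hQin := next_feed_lnk hQ hQfeed
  have hQmp := main_of_inn hQ hQin rfl
  have hQmq := main_of_out hQ hQout rfl
  have hQdr := (drain_of_exit hQ hQout rfl).2
  by_cases hP : ∃ P ∈ D.inst.all, P ≠ lpath p q ∧ Arc.link p q ∈ P ∧ 0 < z P
  · obtain ⟨P, hP, hPne, hPl, hPpos⟩ := hP
    obtain ⟨i, hP⟩ := Inst.mem_all.1 hP
    have hPint := not_intended_of_link hPl hPne
    have hPQ : P ≠ Q := by rintro rfl; exact hQlink hPl
    have hPmp := main_of_out hP hPl rfl
    have hPmq := main_of_inn hP hPl rfl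
    obtain ⟨m₁, m₂, w₁, w₂, nP, eP⟩ := (mem_paths.1 hP).split hPl
    obtain ⟨l₁, l₂, w₃, w₄, nQ, eQ⟩ := (mem_paths.1 hQ).split hQmp
    -- Tails on a path are distinct, so its first arcs are determined one after another. In
    -- particular `main q` comes after `main p`.
    have hl₁ : l₁ = [.feed (lnk p), .linkIn p] := by
      have hmem : ∀ b ∈ l₁, b ∈ Q := fun b hb => by rw [← eQ]; simp [hb]
      cases l₁ with
      | nil => simp [Walk, tail] at w₃
      | cons b l₁ =>
      obtain ⟨e₁, w₃⟩ := w₃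
      obtain rfl : b = .feed (lnk p) :=
        (mem_paths.1 hQ).tl_inj (hmem b (by simp)) hQfeed (e₁.trans rfl)
      cases l₁ with
      | nil => simp [Walk, tail, head] at w₃
      | cons b l₁ =>
      obtain ⟨e₁, w₃⟩ := w₃
      obtain rfl : b = .linkIn p :=
        (mem_paths.1 hQ).tl_inj (hmem b (by simp)) hQin (e₁.trans rfl)
      cases l₁ with
      | nil => rfl
      | cons b l₁ =>
      obtain ⟨e₁, w₃⟩ := w₃
      obtain rfl : b = .main p :=
        (mem_paths.1 hQ).tl_inj (hmem b (by simp)) hQmp (e₁.trans rfl)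
      simp at nQ
    subst hl₁
    have hl₂ : Arc.main q ∈ l₂ := by
      rw [← eQ] at hQmq
      simp only [List.mem_toFinset, List.mem_append, List.mem_cons] at hQmq
      rcases hQmq with (h | h | h) | h | h
      · cases h
      · cases h
      · cases h
      · exact absurd (by simpa using h.symm) hpq
      · exact h
    obtain ⟨l₃, l₄, rfl⟩ := List.append_of_mem hl₂
    obtain ⟨w₅, w₆⟩ := w₄.split
    -- `P` with the link replaced by the detour `l₃` of `Q` between `main p` and `main q`.
    obtain ⟨Q', hQ', hsub⟩ := Walk.exists_simplePath (l := m₁ ++ (l₃ ++ m₂)) (v := Node.src i)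
      (w := .snk i) (tl := tail) (hd := head) (w₁.append (w₅.append w₂))
    obtain ⟨r, rfl⟩ := Inst.exists_eq_add_unit_add_unit hQpos hPpos hPQ.symm
    have hm : ∀ a, a ∈ m₁ ∨ a ∈ m₂ → a ∈ P ∧ a ≠ .link p q := fun a ha => by
      refine ⟨by rw [← eP]; rcases ha with h | h <;> simp [h], ?_⟩
      rintro rfl
      have := (List.nodup_middle.1 nP)
      rw [List.nodup_cons, List.mem_append] at this
      exact this.1 ha
    have hl₃Q : ∀ a ∈ l₃, a ∈ Q := fun a ha => by rw [← eQ]; simp [ha]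
    -- Hence an arc shared by the two new paths comes from `P`; being different from the link, it
    -- also lies on `Q`.
    have hl₃ : ∀ a ∈ l₃, a ∉ lpath p q := by
      intro a ha hL
      simp only [lpath, Finset.mem_insert, Finset.mem_singleton] at hL
      rcases hL with rfl | rfl | rfl | rfl | rfl | rfl | rfl
      · simp [ha] at nQ
      · simp [ha] at nQ
      · simp [ha] at nQ
      · exact hQlink (hl₃Q _ ha)
      · simp only [List.cons_append, List.nil_append, List.nodup_cons, List.nodup_append] at nQ
        exact nQ.2.2.2.2.2 _ ha _ (by simp) rfl
      · cases l₄ with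
        | nil => simp [Walk, head] at w₆
        | cons b l₄ =>
          obtain rfl : b = .linkOut p q := (mem_paths.1 hQ).tl_inj (by rw [← eQ]; simp) hQout
            (w₆.1.trans rfl)
          simp only [List.cons_append, List.nil_append, List.nodup_cons, List.nodup_append] at nQ
          exact nQ.2.2.2.2.2 _ ha _ (by simp) rfl
      · rcases w₅.hd_mem ha with e | ⟨b, e⟩
        · simp [tail, head] at e
        · exact absurd e (tail_ne_snk _ _)
    refine ⟨_, hz.swap (P' := lpath p q) (Q' := Q') (i := lnk p) (j := i) (capacity_le hV)
      (mem_paths_iff hQ) (mem_paths_iff hP) (mem_paths_iff hLm)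
      (mem_paths_iff (mem_paths.2 hQ')) ?_ ?_ ?_,
      sum_intended_swap hQint hPint (lpath_mem_intended hlk)⟩
    · refine Finset.union_subset ?_ (hsub.trans ?_)
      · intro a ha
        rw [Finset.mem_union]
        simp only [lpath, Finset.mem_insert, Finset.mem_singleton] at ha
        rcases ha with rfl | rfl | rfl | rfl | rfl | rfl | rfl
        all_goals first | exact Or.inl ‹_› | exact Or.inr ‹_›
      · intro a ha
        simp only [List.mem_toFinset, List.mem_append] at ha
        rw [Finset.mem_union]
        rcases ha with h | h | h
        · exact Or.inr (hm a (Or.inl h)).1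
        · exact Or.inl (hl₃Q a h)
        · exact Or.inr (hm a (Or.inr h)).1
    · intro a ha
      rw [Finset.mem_inter] at ha
      obtain ⟨ha, haQ⟩ := ha
      have haQ := hsub haQ
      simp only [List.mem_toFinset, List.mem_append] at haQ
      have h₁ : a ∈ P ∧ a ≠ .link p q := by
        rcases haQ with h | h | h
        · exact hm a (Or.inl h)
        · exact absurd ha (hl₃ a h)
        · exact hm a (Or.inr h)
      refine Finset.mem_inter.2 ⟨?_, h₁.1⟩
      simp only [lpath, Finset.mem_insert, Finset.mem_singleton] at ha
      rcases ha with rfl | rfl | rfl | rfl | rfl | rfl | rfl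
      all_goals first | assumption | exact absurd rfl h₁.2
    · intro a ha hM
      obtain ⟨c', rfl⟩ := (capacity_eq_iff hV a).1 hM
      simp only [lpath, Finset.mem_insert, Finset.mem_singleton, reduceCtorEq, Arc.main.injEq,
        false_or, or_false] at ha
      rcases ha with rfl | rfl
      · exact ⟨hQmp, hPmp⟩
      · exact ⟨hQmq, hPmq⟩
  -- Now only the link path itself uses the link, with less than `N`, so a unit of `Q` fits.
  · push Not at hP
    have hsum : ∑ X ∈ D.inst.all with Arc.link p q ∈ X, z X = z (lpath p q) := by
      refine Finset.sum_eq_single _ (fun X hX hne => ?_) (fun h => absurd ?_ h)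
      · rw [Finset.mem_filter] at hX
        have := hP X hX.1 hne hX.2
        omega
      · exact Finset.mem_filter.2 ⟨Inst.mem_all.2 ⟨_, hLm⟩, by simp [lpath]⟩
    have hcap := hz.cap_le (.link p q)
    rw [hsum] at hcap
    obtain ⟨r, rfl⟩ := Inst.exists_eq_add_unit hQpos
    refine ⟨_, hz.shift (P' := lpath p q) (capacity_le hV) (mem_paths_iff hQ)
      (mem_paths_iff hLm) ?_ ?_, sum_intended_shift hQint (lpath_mem_intended hlk)⟩
    · intro a ha haQ
      simp only [lpath, Finset.mem_insert, Finset.mem_singleton] at ha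
      rcases ha with rfl | rfl | rfl | rfl | rfl | rfl | rfl
      all_goals first | exact absurd ‹_› haQ | skip
      rw [hsum]
      simp only [inst_cap, capacity, hlk, mul_one] at hcap ⊢
      exact lt_of_le_of_ne hcap hne
    · intro a ha hM
      obtain ⟨c', rfl⟩ := (capacity_eq_iff hV a).1 hM
      simp only [lpath, Finset.mem_insert, Finset.mem_singleton, reduceCtorEq, Arc.main.injEq,
        false_or, or_false] at ha
      rcases ha with rfl | rfl
      · exact hQmp
      · exact hQmq

theorem sum_all_le {f : Finset D.Arc → ℕ} :
    ∑ P ∈ D.inst.all, f P ≤ ∑ i, ∑ P ∈ D.inst.paths i, f P := by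
  rw [Inst.all, Finset.sum_biUnion]
  intro i _ j _ hij
  rw [Function.onFun, Finset.disjoint_left]
  exact fun P hP hP' => hij (com_unique hP' hP)

/-- Every deviation from the intended amounts allows an exchange that increases the flow on intended
paths, a natural number bounded by the scaled total demand. -/
theorem exists_uncrossed (hV : D.Valid) (hz : D.inst.Sol N z) :
    ∃ z', D.inst.Sol N z' ∧ (∀ i c, z' (dpath i c) = N * D.direct i c) ∧
      ∀ p q, D.lk p q = 1 → z' (lpath p q) = N := by
  have hB : ∀ z, D.inst.Sol N z → ∑ X ∈ D.intended, z X ≤ ∑ i, N * D.demand i := fun z hz => by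
    refine (Finset.sum_le_sum_of_subset (intended_subset hV)).trans ?_
    exact sum_all_le.trans (Finset.sum_le_sum fun i _ => (hz.dem_eq i).le)
  generalize hB' : ∑ i, N * D.demand i = B at hB
  induction hn : B - ∑ X ∈ D.intended, z X using Nat.strong_induction_on generalizing z with
  | _ n ih =>
  have step : (∃ z', D.inst.Sol N z' ∧ ∑ X ∈ D.intended, z X < ∑ X ∈ D.intended, z' X) →
      ∃ z', D.inst.Sol N z' ∧ (∀ i c, z' (dpath i c) = N * D.direct i c) ∧
        ∀ p q, D.lk p q = 1 → z' (lpath p q) = N := by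
    rintro ⟨z', hz', hlt⟩
    have := hB z' hz'
    exact ih _ (by omega) hz' rfl
  by_cases h₁ : ∀ i c, z (dpath i c) = N * D.direct i c
  · by_cases h₂ : ∀ p q, D.lk p q = 1 → z (lpath p q) = N
    · exact ⟨z, hz, h₁, h₂⟩
    · push Not at h₂
      obtain ⟨p, q, hlk, hne⟩ := h₂
      exact step (exists_better_of_link hV hz h₁ hlk hne)
  · push Not at h₁
    obtain ⟨i, c, hne⟩ := h₁
    exact step (exists_better_of_direct hV hz hne)

end Layout

namespace Layout

variable {D : Layout} {N : ℕ} {z : Finset D.Arc → ℕ}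

/-! ### From robust flows of the network to robust flows of the given instance -/

/-- Applied to the paths through a direct arc or link: the intended path takes all the capacity and
leaves none to others. -/
theorem eq_of_sum_le {β : Type*} {F : Finset β} {z : β → ℕ} {b x : β} (hb : b ∈ F)
    (h : ∑ x ∈ F, z x ≤ z b) (hx : x ∈ F) (hpos : 0 < z x) : x = b := by
  classical
  by_contra hne
  have := Finset.sum_le_sum_of_subset (f := z)
    (Finset.insert_subset hx (Finset.singleton_subset_iff.2 hb))
  rw [Finset.sum_pair hne] at this
  omega

variable (D) in
open Classical in
/-- The paths from `s` to `t` in the given digraph. -/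
noncomputable def stPaths : Finset (Finset (Fin D.numA)) :=
  Finset.univ.filter (SimplePath D.tl D.hd D.s D.t)

theorem mem_stPaths {Q : Finset (Fin D.numA)} :
    Q ∈ D.stPaths ↔ SimplePath D.tl D.hd D.s D.t Q := by simp [stPaths]

/-- The arcs of the given digraph used by a path of the network. -/
noncomputable def trace (P : Finset D.Arc) : Finset (Fin D.numA) :=
  Finset.univ.filter fun a => Arc.main (.inl a) ∈ P

theorem mem_trace {P : Finset D.Arc} {a : Fin D.numA} :
    a ∈ trace P ↔ Arc.main (.inl a) ∈ P := by simp [trace]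

variable (D N z) in
/-- Uncrossed solutions use the intended paths as much as possible. -/
structure Uncrossed : Prop extends D.inst.Sol N z where
  direct_eq : ∀ i c, z (dpath i c) = N * D.direct i c
  link_eq : ∀ p q, D.lk p q = 1 → z (lpath p q) = N

namespace Uncrossed

theorem eq_dpath_of_directIn (h : D.Uncrossed N z) {i j : D.Com} {c : D.Main} {P : Finset D.Arc}
    (hP : P ∈ D.inst.paths i) (hz : 0 < z P) (hc : Arc.directIn j c ∈ P) : P = dpath i c := by
  obtain rfl := com_of_src hP hc rfl
  refine eq_of_sum_le (F := (D.inst.paths j).filter (Arc.directIn j c ∈ ·))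
    (Finset.mem_filter.2 ⟨dpath_mem j c, by simp [dpath]⟩) ?_ (Finset.mem_filter.2 ⟨hP, hc⟩) hz
  rw [flow_src h.toIsFlow rfl, h.direct_eq]
  rfl

theorem eq_dpath_of_directOut (h : D.Uncrossed N z) {i j : D.Com} {c : D.Main}
    {P : Finset D.Arc} (hP : P ∈ D.inst.paths i) (hz : 0 < z P) (hc : Arc.directOut j c ∈ P) :
    P = dpath i c := by
  obtain rfl := com_of_snk hP hc rfl
  refine eq_of_sum_le (F := (D.inst.paths j).filter (Arc.directOut j c ∈ ·))
    (Finset.mem_filter.2 ⟨dpath_mem j c, by simp [dpath]⟩) ?_ (Finset.mem_filter.2 ⟨hP, hc⟩) hz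
  rw [flow_snk h.toIsFlow rfl, h.direct_eq]
  rfl

theorem eq_lpath_of_link (h : D.Uncrossed N z) (hV : D.Valid) {i : D.Com} {p q : D.Main}
    {P : Finset D.Arc} (hP : P ∈ D.inst.paths i) (hz : 0 < z P) (hl : Arc.link p q ∈ P) :
    P = lpath p q := by
  have hcap := h.cap_le (.link p q)
  have hPa : P ∈ D.inst.all.filter (Arc.link p q ∈ ·) :=
    Finset.mem_filter.2 ⟨Inst.mem_all.2 ⟨i, hP⟩, hl⟩
  have hlk : D.lk p q = 1 := by
    have := hV.lk_le p q
    have h₂ := Finset.single_le_sum (f := z) (fun _ _ => Nat.zero_le _) hPa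
    by_contra hne
    have h0 : D.lk p q = 0 := by omega
    simp only [inst_cap, capacity, h0] at hcap
    omega
  refine eq_of_sum_le (Finset.mem_filter.2 ⟨Inst.mem_all.2 ⟨_, lpath_mem (lk_ne hV hlk)⟩,
    by simp [lpath]⟩) ?_ hPa hz
  rw [h.link_eq p q hlk]
  simpa [capacity, hlk] using hcap

end Uncrossed

theorem not_walk_of_snk {i j : D.Com} (hij : i ≠ j) (l : List D.Arc) :
    ¬ Walk tail head (Node.snk i) l (Node.snk j) := by
  cases l with
  | nil => simpa [Walk] using hij
  | cons a l => exact fun h => tail_ne_snk _ _ h.1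

theorem not_walk_of_exit {i j : D.Com} (hij : i ≠ j) (l : List D.Arc) :
    ¬ Walk tail head (Node.exit i) l (Node.snk j) := by
  cases l with
  | nil => simp [Walk]
  | cons a l =>
    rintro ⟨e, h⟩
    cases a <;> simp [tail] at e
    subst e
    exact not_walk_of_snk hij l h

/-- From a copy of a given node the walk can only take blocks `origIn a`, `main a`, `origOut a`
until it leaves by `fromOrig`: direct exits and links are excluded by hypothesis, and `linkOut`
leads to the exit of another commodity, from which `com0` cannot reach its sink. The sublist of
heads is what transfers simplicity to the traced walk. -/
theorem exists_trace_walk (n : ℕ) (l : List D.Arc) (hl : l.length ≤ n) (v : Fin D.numV)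
    (hw : Walk tail head (Node.orig v) l (.snk com0))
    (h₁ : ∀ i c, Arc.directOut i c ∉ l) (h₂ : ∀ p q, Arc.link p q ∉ l) :
    ∃ l', Walk D.tl D.hd v l' D.t ∧
      (l'.map fun a => Node.orig (D.hd a)).Sublist (l.map head) ∧
      ∀ a, Arc.main (.inl a) ∈ l ↔ a ∈ l' := by
  induction n generalizing l v with
  | zero =>
    obtain rfl : l = [] := by simpa using hl
    simp [Walk] at hw
  | succ n ih =>
    cases l with
    | nil => simp [Walk] at hw
    | cons b l =>
    obtain ⟨e, hw⟩ := hw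
    cases b <;> simp [tail] at e
    · rename_i a
      subst e
      cases l with
      | nil => simp [Walk, head] at hw
      | cons b l =>
      obtain ⟨e, hw⟩ := hw
      cases b <;> simp [tail, head] at e
      subst e
      cases l with
      | nil => simp [Walk, head] at hw
      | cons b l =>
      obtain ⟨e, hw⟩ := hw
      cases b <;> simp [tail, head] at e <;> subst e
      · exact (h₁ _ _ (by right; right; left)).elim
      · rename_i a
        obtain ⟨l', k₁, k₂, k₃⟩ := ih l (by simp at hl; omega) _ hw
          (fun i c hi => h₁ i c (by simp [hi])) (fun p q hi => h₂ p q (by simp [hi]))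
        refine ⟨a :: l', ⟨rfl, k₁⟩, ?_, fun x => ?_⟩
        · simp only [List.map_cons, head]
          exact ((k₂.cons_cons _).cons _).cons _
        · simp [k₃]
      · exact (h₂ _ _ (by right; right; left)).elim
      · exact absurd hw (not_walk_of_exit (by simp) l)
    · subst e
      cases l with
      | nil => simp [Walk, head] at hw
      | cons b l =>
      obtain ⟨e, hw⟩ := hw
      cases b <;> simp [tail, head] at e
      subst e
      cases l with
      | nil => exact ⟨[], rfl, by simp, by simp⟩
      | cons b l => exact absurd hw.1 (tail_ne_snk _ _)

namespace Uncrossed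

theorem trace_mem (h : D.Uncrossed N z) (hV : D.Valid) {P : Finset D.Arc}
    (hP : P ∈ D.inst.paths com0) (hz : 0 < z P) (hO : Arc.toOrig ∈ P) :
    trace P ∈ D.stPaths := by
  have hfeed := (feed_of_entry hP hO rfl).2
  have hP' := mem_paths.1 hP
  have hP'' := hP'
  obtain ⟨l, w, nd, rfl⟩ := hP'
  obtain ⟨l₁, l₂, rfl⟩ := List.append_of_mem (List.mem_toFinset.1 hO)
  obtain ⟨w₁, w₂⟩ := w.split
  have nA := List.Nodup.of_map _ (List.nodup_cons.1 nd).2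
  -- Before `toOrig` there is nothing but the feed of `com0`.
  have hl₁ : ∀ a, Arc.main (.inl a) ∉ l₁ := by
    cases l₁ with
    | nil => simp
    | cons b l₁ =>
    obtain ⟨e, w₁⟩ := w₁
    obtain rfl : b = .feed com0 := hP''.tl_inj (by simp) hfeed (e.trans rfl)
    cases l₁ with
    | nil => simp
    | cons b l₁ =>
    obtain ⟨e, w₁⟩ := w₁
    obtain rfl : b = .toOrig := hP''.tl_inj (by simp) hO (e.trans rfl)
    simp at nA
  obtain ⟨l', k₁, k₂, k₃⟩ := exists_trace_walk l₂.length l₂ le_rfl D.s w₂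
    (fun i c hi => by
      have := h.eq_dpath_of_directOut hP hz (j := i) (c := c) (by simp [hi])
      rw [this] at hO
      simp [dpath] at hO)
    (fun p q hi => by
      have := h.eq_lpath_of_link hV hP hz (p := p) (q := q) (by simp [hi])
      rw [this] at hO
      simp [lpath] at hO)
  refine mem_stPaths.2 ⟨l', k₁, ?_, ?_⟩
  · have : (Node.orig D.s :: l₂.map head).Nodup := by
      simp only [List.map_append, List.map_cons] at nd
      exact (List.nodup_append.1 (List.nodup_cons.1 nd).2).2.1
    have := this.sublist (k₂.cons_cons _)
    refine List.Nodup.of_map (Node.orig (D := D)) ?_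
    simpa [Function.comp_def] using this
  · ext a
    simp [mem_trace, hl₁, k₃]

/-- All other ways into the main arc belong to direct paths, link paths or other commodities.
Therefore the unit capacity of `origIn a` bounds the induced flow on `a`. -/
theorem origIn_mem (h : D.Uncrossed N z) (hV : D.Valid) {P : Finset D.Arc}
    (hP : P ∈ D.inst.paths com0) (hz : 0 < z P) (hO : Arc.toOrig ∈ P) {a : Fin D.numA}
    (ha : a ∈ trace P) : Arc.origIn a ∈ P := by
  rw [mem_trace] at ha
  obtain ⟨b, hb, e⟩ := (mem_paths.1 hP).exists_prev ha (by simp [tail])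
  cases b <;> simp [tail, head] at e <;> subst e
  · have := h.eq_dpath_of_directIn hP hz hb
    rw [this] at hO
    simp [dpath] at hO
  · exact hb
  · have := h.eq_lpath_of_link hV hP hz hb
    rw [this] at hO
    simp [lpath] at hO
  · have := (feed_of_entry hP hb rfl).1
    simp at this

end Uncrossed

/-! ### Columns, rows and the linear inequalities they impose -/

theorem chain_next {i : D.Com} {P : Finset D.Arc} (hP : P ∈ D.inst.paths i) {a : D.Arc}
    (ha : a ∈ P) {j : Fin D.cols} {b : Bool} {l : Fin (D.rows + 1)}
    (e : head a = .chain j b l.castSucc) :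
    Arc.chainArc j b l ∈ P ∨ ∃ l', row l' = i ∧ l'.succ = l.castSucc := by
  obtain ⟨c, hc, e'⟩ := (mem_paths.1 hP).exists_next ha (by simp [e])
  rw [e] at e'
  cases c <;> simp [tail] at e'
  · obtain ⟨rfl, rfl, rfl⟩ := e'
    exact Or.inl hc
  · exact absurd e'.2.2.symm (Fin.castSucc_lt_last l).ne
  · exact Or.inr ⟨_, (drain_of_exit hP hc rfl).1, e'.2.2⟩

/-- The side exits of a chain lead to exits of row commodities, so a column commodity has to stay on
the chain to its end. -/
theorem chainArc_of_colIn {j j' : Fin D.cols} {P : Finset D.Arc} (hP : P ∈ D.inst.paths (col j))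
    {b : Bool} (h : Arc.colIn j' b ∈ P) (l : Fin (D.rows + 1)) : Arc.chainArc j' b l ∈ P := by
  have key : ∀ {a : D.Arc}, a ∈ P → ∀ {l : Fin (D.rows + 1)},
      head a = .chain j' b l.castSucc → Arc.chainArc j' b l ∈ P := fun ha l e => by
    rcases chain_next hP ha e with h | ⟨l', h, _⟩
    · exact h
    · simp at h
  induction l using Fin.induction with
  | zero => exact key h rfl
  | succ l ih => exact key ih rfl

/-- The exit of row `l` lies one node after its entrance, so the commodity cannot leave before using
the arc in between. -/
theorem chainArc_of_rowIn {l : Fin (D.rows + 1)} {P : Finset D.Arc}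
    (hP : P ∈ D.inst.paths (row l)) {j : Fin D.cols} {b : Bool} (h : Arc.rowIn l j b ∈ P) :
    Arc.chainArc j b l ∈ P := by
  rcases chain_next hP h rfl with h | ⟨l', e, h⟩
  · exact h
  · simp at e
    subst e
    exact absurd h (Fin.castSucc_lt_succ).ne'

theorem next_feed_row {l : Fin (D.rows + 1)} {P : Finset D.Arc}
    (hP : P ∈ D.inst.paths (row l)) (h : Arc.feed (row l) ∈ P) :
    (∃ j b, Arc.rowIn l j b ∈ P) ∨ l = 0 ∧ Arc.toOrig ∈ P := by
  obtain ⟨c, hc, e⟩ := (mem_paths.1 hP).exists_next h (by simp [head])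
  cases c <;> simp [tail, head] at e
  · exact Or.inr ⟨e.symm, hc⟩
  · subst e
    exact Or.inl ⟨_, _, hc⟩

/-- The flow of a column commodity on one of the two chains of the column. -/
noncomputable def colFlow (z : Finset D.Arc → ℕ) (j : Fin D.cols) (b : Bool) : ℕ :=
  ∑ P ∈ D.inst.paths (col j) with Arc.colIn j b ∈ P, z P

/-- The feed of the column is saturated with `W`, and each path using it continues into exactly one
of the two chains. -/
theorem colFlow_add (h : D.inst.IsFlow N z) (j : Fin D.cols) :
    colFlow z j true + colFlow z j false = N * D.W := by
  rw [show N * D.W = N * D.capacity (.feed (col j)) from rfl, ← flow_src h (i := col j) rfl]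
  simp only [colFlow, Finset.sum_filter, ← Finset.sum_add_distrib]
  refine Finset.sum_congr rfl fun P hP => ?_
  have hP' := mem_paths.1 hP
  by_cases hf : Arc.feed (col j) ∈ P
  · obtain ⟨c, hc, e⟩ := hP'.exists_next hf (by simp [head])
    cases c <;> simp [tail, head] at e
    rename_i j' b
    subst e
    have : Arc.colIn j' (!b) ∉ P := fun hb => by
      have := hP'.tl_inj hc hb rfl
      cases b <;> simp at this
    cases b <;> simp_all
  · have : ∀ b, Arc.colIn j b ∉ P := fun b hb => hf (feed_of_entry hP hb rfl).2
    simp [this, hf]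

theorem colFlow_add_not (h : D.inst.IsFlow N z) (j : Fin D.cols) (b : Bool) :
    colFlow z j b + colFlow z j (!b) = N * D.W := by
  have := colFlow_add h j
  cases b <;> simp only [Bool.not_true, Bool.not_false] <;> omega

/-- Row and column flow share a chain arc of capacity `W`. What the column leaves free on one chain
is what it sends along the other. -/
theorem rowFlow_le (h : D.inst.IsFlow N z) (hV : D.Valid) (l : Fin (D.rows + 1))
    (j : Fin D.cols) (b : Bool) :
    ∑ P ∈ D.inst.paths (row l) with Arc.rowIn l j b ∈ P, z P
      ≤ D.coef l j b * colFlow z j (!b) := by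
  have h₁ : ∑ P ∈ D.inst.paths (row l) with Arc.rowIn l j b ∈ P, z P
      ≤ N * (D.W * D.coef l j b) :=
    (Finset.sum_le_sum_of_subset (Finset.filter_subset_filter _
      (Finset.subset_biUnion_of_mem D.inst.paths (Finset.mem_univ _)))).trans
      (h.cap_le (.rowIn l j b))
  rcases Nat.le_one_iff_eq_zero_or_eq_one.1 (hV.coef_le l j b) with hc | hc
  · simpa [hc] using h₁
  · rw [hc, one_mul]
    have h₂ := h.cap_le (.chainArc j b l)
    have h₃ := colFlow_add_not h j b
    have hdis : Disjoint ((D.inst.paths (row l)).filter (Arc.rowIn l j b ∈ ·))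
        ((D.inst.paths (col j)).filter (Arc.colIn j b ∈ ·)) := by
      rw [Finset.disjoint_left]
      intro P hP hP'
      have := com_unique (Finset.mem_filter.1 hP).1 (Finset.mem_filter.1 hP').1
      simp at this
    have h₄ := Finset.sum_le_sum_of_subset (f := z) (s := ((D.inst.paths (row l)).filter
      (Arc.rowIn l j b ∈ ·)).disjUnion _ hdis) (t := D.inst.all.filter (Arc.chainArc j b l ∈ ·)) <| by
      intro P hP
      rw [Finset.mem_disjUnion] at hP
      rcases hP with hP | hP <;> rw [Finset.mem_filter] at hP <;>
        refine Finset.mem_filter.2 ⟨Inst.mem_all.2 ⟨_, hP.1⟩, ?_⟩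
      · exact chainArc_of_rowIn hP.1 hP.2
      · exact chainArc_of_colIn hP.1 hP.2 l
    rw [Finset.sum_disjUnion] at h₄
    simp only [inst_cap, capacity] at h₂
    change _ + colFlow z j b ≤ _ at h₄
    omega

/-- The saturated feed of the row has to continue into the chains or, for row 0 only, into the given
digraph. -/
theorem row_le (h : D.inst.IsFlow N z) (hV : D.Valid) (l : Fin (D.rows + 1)) :
    N * D.rhs l ≤ ∑ j, ∑ b, D.coef l j b * colFlow z j (!b) +
      if l = 0 then ∑ P ∈ D.inst.paths com0 with Arc.toOrig ∈ P, z P else 0 := by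
  calc N * D.rhs l = N * D.capacity (.feed (row l)) := rfl
    _ = ∑ P ∈ D.inst.paths (row l) with Arc.feed (row l) ∈ P, z P := (flow_src h rfl).symm
    _ ≤ ∑ j, ∑ b, ∑ P ∈ D.inst.paths (row l) with Arc.rowIn l j b ∈ P, z P +
      if l = 0 then ∑ P ∈ D.inst.paths (row l) with Arc.toOrig ∈ P, z P else 0 := ?_
    _ ≤ _ := by
      refine Nat.add_le_add (Finset.sum_le_sum fun j _ => Finset.sum_le_sum fun b _ =>
        rowFlow_le h hV l j b) ?_
      split_ifs with h0
      · subst h0; rfl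
      · rfl
  have e : (if l = 0 then ∑ P ∈ D.inst.paths (row l) with Arc.toOrig ∈ P, z P else 0) =
      ∑ P ∈ D.inst.paths (row l), if l = 0 ∧ Arc.toOrig ∈ P then z P else 0 := by
    split_ifs with h0
    · simp [h0, Finset.sum_filter]
    · simp [h0]
  rw [e]
  simp_rw [Finset.sum_filter]
  have e₂ : ∑ j, ∑ b, ∑ P ∈ D.inst.paths (row l), (if Arc.rowIn l j b ∈ P then z P else 0) =
      ∑ P ∈ D.inst.paths (row l), ∑ j, ∑ b, (if Arc.rowIn l j b ∈ P then z P else 0) := by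
    rw [Finset.sum_comm]
    simp_rw [Finset.sum_comm (s := Finset.univ (α := Bool))]
    rw [Finset.sum_comm]
  rw [e₂, ← Finset.sum_add_distrib]
  refine Finset.sum_le_sum fun P hP => ?_
  split_ifs with hf h0
  · exact Nat.le_add_left _ _
  · rcases next_feed_row hP hf with ⟨j, b, hjb⟩ | h'
    · refine le_trans ?_ (Nat.le_add_right _ _)
      calc z P = if Arc.rowIn l j b ∈ P then z P else 0 := by rw [if_pos hjb]
        _ ≤ ∑ b, if Arc.rowIn l j b ∈ P then z P else 0 :=
          Finset.single_le_sum (f := fun b => if Arc.rowIn l j b ∈ P then z P else 0)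
            (fun _ _ => Nat.zero_le _) (Finset.mem_univ b)
        _ ≤ _ := Finset.single_le_sum
            (f := fun j => ∑ b, if Arc.rowIn l j b ∈ P then z P else 0)
            (fun _ _ => Nat.zero_le _) (Finset.mem_univ j)
    · exact absurd h' h0
  · exact Nat.zero_le _
  · exact Nat.zero_le _

end Layout

/-! ### The flow induced by an uncrossed solution on the given digraph -/

namespace Layout

variable {D : Layout} {N : ℕ} {z : Finset D.Arc → ℕ}

/-- The flow induced on the given digraph. -/
noncomputable def origFlow (z : Finset D.Arc → ℕ) (Q : Finset (Fin D.numA)) : ℕ :=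
  ∑ P ∈ (D.inst.paths com0).filter (fun P => Arc.toOrig ∈ P ∧ 0 < z P) with trace P = Q, z P

namespace Uncrossed

theorem sum_origFlow (h : D.Uncrossed N z) (hV : D.Valid) (p : Finset (Fin D.numA) → Prop)
    [DecidablePred p] : ∑ Q ∈ D.stPaths with p Q, origFlow z Q =
      ∑ P ∈ D.inst.paths com0 with (Arc.toOrig ∈ P ∧ 0 < z P) ∧ p (trace P), z P := by
  rw [← Finset.filter_filter, ← Finset.sum_fiberwise_of_maps_to (t := D.stPaths.filter p)
    (g := trace)]
  · refine Finset.sum_congr rfl fun Q hQ => ?_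
    rw [Finset.mem_filter] at hQ
    rw [origFlow]
    refine Finset.sum_congr ?_ fun _ _ => rfl
    ext P
    simp only [Finset.mem_filter]
    constructor
    · rintro ⟨h₁, rfl⟩; exact ⟨⟨h₁, hQ.2⟩, rfl⟩
    · rintro ⟨⟨h₁, _⟩, h₂⟩; exact ⟨h₁, h₂⟩
  · intro P hP
    simp only [Finset.mem_filter] at hP
    exact Finset.mem_filter.2 ⟨h.trace_mem hV hP.1.1 hP.1.2.2 hP.1.2.1, hP.2⟩

theorem origFlow_le (h : D.Uncrossed N z) (hV : D.Valid) (a : Fin D.numA) :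
    ∑ Q ∈ D.stPaths with a ∈ Q, origFlow z Q ≤ N := by
  rw [h.sum_origFlow hV (a ∈ ·)]
  have := h.cap_le (.origIn a)
  simp only [inst_cap, capacity, mul_one] at this
  refine le_trans (Finset.sum_le_sum_of_subset fun P hP => ?_) this
  simp only [Finset.mem_filter] at hP ⊢
  exact ⟨Inst.mem_all.2 ⟨_, hP.1⟩, h.origIn_mem hV hP.1 hP.2.1.2 hP.2.1.1 hP.2.2⟩

theorem total_origFlow (h : D.Uncrossed N z) (hV : D.Valid) :
    ∑ Q ∈ D.stPaths, origFlow z Q = ∑ P ∈ D.inst.paths com0 with Arc.toOrig ∈ P, z P := by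
  have := h.sum_origFlow hV (fun _ => True)
  simp only [Finset.filter_true, and_true] at this
  rw [this, ← Finset.filter_filter, Finset.sum_filter_of_ne]
  intro P _ h
  omega

/-- No link has both ends in `S`, so adding the degrees over `S` counts each link that meets `S`
once. -/
theorem pair_sum (S : Finset (Fin D.numA))
    (hV : D.Valid) (hS : ∀ a ∈ S, ∀ b ∈ S, a ≠ b → D.lk (.inl a) (.inl b) = 0) :
    ((Finset.univ.filter fun x : D.Main × D.Main => D.lk x.1 x.2 = 1 ∧
      ((∃ a ∈ S, x.1 = .inl a) ∨ ∃ a ∈ S, x.2 = .inl a)).card) =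
    ∑ a ∈ S, (D.outdeg (.inl a) + D.indeg (.inl a)) := by
  classical
  have e : ∀ f : D.Main → ℕ, ∑ a ∈ S, f (.inl a) = ∑ c, if ∃ a ∈ S, c = .inl a then f c else 0 := by
    intro f
    rw [← Finset.sum_filter]
    refine Finset.sum_bij (fun a _ => .inl a) (fun a ha => by simpa using ha)
      (fun a _ b _ h => by simpa using h) (fun c hc => ?_) (fun _ _ => rfl)
    obtain ⟨a, ha, rfl⟩ := (Finset.mem_filter.1 hc).2
    exact ⟨a, ha, rfl⟩
  rw [Finset.sum_add_distrib, e D.outdeg, e D.indeg]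
  have h₂ : ∑ c, (if ∃ a ∈ S, c = .inl a then D.indeg c else 0) =
      ∑ p, ∑ q, if ∃ a ∈ S, q = .inl a then D.lk p q else 0 := by
    rw [Finset.sum_comm]
    refine Finset.sum_congr rfl fun q _ => ?_
    split_ifs <;> simp [indeg]
  have h₁ : ∑ c, (if ∃ a ∈ S, c = .inl a then D.outdeg c else 0) =
      ∑ p, ∑ q, if ∃ a ∈ S, p = .inl a then D.lk p q else 0 := by
    refine Finset.sum_congr rfl fun q _ => ?_
    split_ifs <;> simp [outdeg]
  rw [h₁, h₂, ← Finset.sum_add_distrib, Finset.card_filter, Fintype.sum_prod_type]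
  refine Finset.sum_congr rfl fun p _ => ?_
  rw [← Finset.sum_add_distrib]
  refine Finset.sum_congr rfl fun q _ => ?_
  have hle := hV.lk_le p q
  have hlk : (∃ a ∈ S, p = .inl a) → (∃ a ∈ S, q = .inl a) → D.lk p q = 0 := by
    rintro ⟨a, ha, rfl⟩ ⟨b, hb, rfl⟩
    by_cases hab : a = b
    · subst hab; exact hV.lk_self _
    · exact hS a ha b hb hab
  by_cases hp : ∃ a ∈ S, p = .inl a <;> by_cases hq : ∃ a ∈ S, q = .inl a
  · simp [hlk hp hq]
  · rw [if_pos hp, if_neg hq]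
    simp only [hp, true_or, and_true, add_zero]
    split_ifs <;> omega
  · rw [if_pos hq, if_neg hp]
    simp only [hq, or_true, and_true, zero_add]
    split_ifs <;> omega
  · simp [hp, hq]

theorem dpath_inj {i i' : D.Com} {c c' : D.Main} (h : dpath i c = dpath i' c') :
    i = i' ∧ c = c' := by
  have : Arc.directIn i c ∈ dpath i' c' := by rw [← h]; simp [dpath]
  simpa [dpath] using this

theorem lpath_inj {p p' q q' : D.Main} (h : lpath p q = lpath p' q') : p = p' ∧ q = q' := by
  have : Arc.link p q ∈ lpath p' q' := by rw [← h]; simp [lpath]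
  simpa [lpath] using this

/-- Direct paths, link paths and paths through `toOrig` are disjoint families. Those of the first
two that meet the main arcs of `S` carry exactly `k (M - 1)` units, so of the admissible loss `k M -
1` only `k - 1` remain for the third. -/
theorem origFlow_loss_le (h : D.Uncrossed N z) (hV : D.Valid) (S : Finset (Fin D.numA))
    (hcard : S.card = D.ext + 1)
    (hS : ∀ a ∈ S, ∀ b ∈ S, a ≠ b → D.lk (.inl a) (.inl b) = 0) :
    ∑ Q ∈ D.stPaths with (Q ∩ S).Nonempty, origFlow z Q + N ≤ N * (D.ext + 1) := by
  classical
  rw [h.sum_origFlow hV fun Q => (Q ∩ S).Nonempty]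
  set S' : Finset D.Arc := S.image fun a => .main (.inl a) with hS'
  have hcard' : S'.card = D.ext + 1 := by
    rw [hS', Finset.card_image_of_injective _ (fun a b h => by simpa using h), hcard]
  have hloss := h.loss_le S' hcard'
  have hmem : ∀ P : Finset D.Arc, (P ∩ S').Nonempty ↔ ∃ a ∈ S, Arc.main (.inl a) ∈ P := by
    intro P
    simp [hS', Finset.Nonempty, and_comm]
  set T₁ : Finset (Finset D.Arc) := (Finset.univ ×ˢ S).image
    fun x : D.Com × Fin D.numA => dpath x.1 (.inl x.2) with hT₁
  set X := Finset.univ.filter fun x : D.Main × D.Main => D.lk x.1 x.2 = 1 ∧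
      ((∃ a ∈ S, x.1 = .inl a) ∨ ∃ a ∈ S, x.2 = .inl a) with hX
  set T₂ : Finset (Finset D.Arc) := X.image fun x => lpath x.1 x.2 with hT₂
  set T₃ := (D.inst.paths com0).filter
    fun P => (Arc.toOrig ∈ P ∧ 0 < z P) ∧ (trace P ∩ S).Nonempty with hT₃
  have d₁₂ : Disjoint T₁ T₂ := by
    rw [Finset.disjoint_left]
    rintro P h₁ h₂
    obtain ⟨x, _, rfl⟩ := Finset.mem_image.1 h₁
    obtain ⟨y, _, e⟩ := Finset.mem_image.1 h₂
    have : Arc.directIn x.1 (.inl x.2) ∈ lpath y.1 y.2 := by rw [e]; simp [dpath]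
    simp [lpath] at this
  have d₃ : Disjoint (T₁ ∪ T₂) T₃ := by
    rw [Finset.disjoint_left]
    rintro P h₁ h₃
    have := (Finset.mem_filter.1 h₃).2.1.1
    rcases Finset.mem_union.1 h₁ with h₁ | h₁ <;> obtain ⟨x, _, rfl⟩ := Finset.mem_image.1 h₁
    · simp [dpath] at this
    · simp [lpath] at this
  have hsub : T₁ ∪ T₂ ∪ T₃ ⊆ D.inst.all.filter fun P => (P ∩ S').Nonempty := by
    intro P hP
    rw [Finset.mem_filter, hmem]
    rcases Finset.mem_union.1 hP with hP | hP
    · rcases Finset.mem_union.1 hP with hP | hP <;> obtain ⟨x, hx, rfl⟩ := Finset.mem_image.1 hP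
      · exact ⟨Inst.mem_all.2 ⟨_, dpath_mem _ _⟩, x.2, (Finset.mem_product.1 hx).2,
          by simp [dpath]⟩
      · obtain ⟨-, hlk, hx⟩ := Finset.mem_filter.1 hx
        refine ⟨Inst.mem_all.2 ⟨_, lpath_mem (lk_ne hV hlk)⟩, ?_⟩
        rcases hx with ⟨a, ha, e⟩ | ⟨a, ha, e⟩
        · exact ⟨a, ha, by simp [lpath, e]⟩
        · exact ⟨a, ha, by simp [lpath, e]⟩
    · obtain ⟨hP, -, a, ha⟩ := Finset.mem_filter.1 hP
      rw [Finset.mem_inter, mem_trace] at ha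
      exact ⟨Inst.mem_all.2 ⟨_, hP⟩, a, ha.2, ha.1⟩
  have hsum := Finset.sum_le_sum_of_subset (f := z) hsub
  rw [Finset.sum_union d₃, Finset.sum_union d₁₂] at hsum
  have s₁ : ∑ P ∈ T₁, z P = N * ∑ a ∈ S, ∑ i, D.direct i (.inl a) := by
    rw [hT₁, Finset.sum_image (fun x _ y _ h => by
      obtain ⟨e₁, e₂⟩ := dpath_inj h; exact Prod.ext e₁ (by simpa using e₂)),
      Finset.sum_product_right, Finset.mul_sum]
    simp only [h.direct_eq, Finset.mul_sum]
  have s₂ : ∑ P ∈ T₂, z P = N * ∑ a ∈ S, (D.outdeg (.inl a) + D.indeg (.inl a)) := by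
    rw [hT₂, Finset.sum_image (fun x _ y _ h => by
      obtain ⟨e₁, e₂⟩ := lpath_inj h; exact Prod.ext e₁ e₂), ← pair_sum S hV hS, ← hX,
      Finset.sum_congr rfl fun x hx => h.link_eq _ _ (Finset.mem_filter.1 hx).2.1]
    simp [mul_comm]
  -- The summand `D.ext + 1` collects the one unit that `used` reserves on each original arc for the
  -- `s`-`t` flow.
  have s₃ : ∑ a ∈ S, ∑ i, D.direct i (.inl a) + ∑ a ∈ S, (D.outdeg (.inl a) + D.indeg (.inl a)) +
      (D.ext + 1) = (D.ext + 1) * D.maxc := by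
    rw [← hcard, ← Finset.sum_add_distrib, Finset.card_eq_sum_ones, ← Finset.sum_add_distrib,
      Finset.sum_mul]
    refine Finset.sum_congr rfl fun a _ => ?_
    have := sum_direct_add hV (.inl a)
    simp only [used, Sum.isLeft_inl, if_true] at this
    omega
  have s₄ : N * ∑ a ∈ S, ∑ i, D.direct i (.inl a) +
      N * ∑ a ∈ S, (D.outdeg (.inl a) + D.indeg (.inl a)) + N * (D.ext + 1) =
      N * ((D.ext + 1) * D.maxc) := by
    rw [← s₃]; ring
  simp only [inst_k, inst_M] at hloss
  omega

end Uncrossed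

/-- A robust flow of the network yields a robust flow of the given digraph and a feasible
assignment of values to the chains. -/
theorem exists_of_sol (hV : D.Valid) (hz : D.inst.Sol N z) :
    ∃ (y : Finset (Fin D.numA) → ℕ) (g : Fin D.cols → Bool → ℕ),
      (∀ a, ∑ Q ∈ D.stPaths with a ∈ Q, y Q ≤ N) ∧
      (∀ S : Finset (Fin D.numA), S.card = D.ext + 1 →
        (∀ a ∈ S, ∀ b ∈ S, a ≠ b → D.lk (.inl a) (.inl b) = 0) →
        ∑ Q ∈ D.stPaths with (Q ∩ S).Nonempty, y Q + N ≤ N * (D.ext + 1)) ∧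
      (∀ j, g j true + g j false = N * D.W) ∧
      ∀ l, N * D.rhs l ≤ ∑ j, ∑ b, D.coef l j b * g j (!b) +
        if l = 0 then ∑ Q ∈ D.stPaths, y Q else 0 := by
  obtain ⟨z', hz', h₁, h₂⟩ := exists_uncrossed hV hz
  have h : D.Uncrossed N z' := ⟨hz', h₁, h₂⟩
  refine ⟨origFlow z', colFlow z', h.origFlow_le hV, h.origFlow_loss_le hV,
    colFlow_add hz'.toIsFlow, fun l => ?_⟩
  rw [h.total_origFlow hV]
  exact row_le hz'.toIsFlow hV l

end Layout

/-- Greedy choice. It serves to lower a flow to a prescribed value and to distribute the demand of a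
row over its chains. -/
theorem exists_le_sum_eq {β : Type*} (F : Finset β) (c : β → ℕ) {n : ℕ} (h : n ≤ ∑ x ∈ F, c x) :
    ∃ r : β → ℕ, (∀ x, r x ≤ c x) ∧ ∑ x ∈ F, r x = n := by
  classical
  induction F using Finset.induction_on generalizing n with
  | empty => exact ⟨fun _ => 0, fun _ => Nat.zero_le _, by simp at h; simp [h]⟩
  | insert a F ha ih =>
    rw [Finset.sum_insert ha] at h
    obtain ⟨r, hr, hs⟩ := ih (n := n - c a) (by omega)
    refine ⟨fun x => if x = a then min (c a) n else r x, fun x => ?_, ?_⟩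
    · dsimp only
      split_ifs with hx
      · subst hx; exact min_le_left _ _
      · exact hr x
    · rw [Finset.sum_insert ha, if_pos rfl, Finset.sum_congr rfl fun x hx =>
        if_neg (ne_of_mem_of_not_mem hx ha), hs]
      omega

namespace Inst

variable {V A K : Type*} [Fintype A] [DecidableEq A] [Fintype K] {G : Inst V A K}

/-- The capacities of `S` count the flow on `P` at least twice although it is lost only once, which
saves the required `N`. This is the purpose of the links. -/
theorem IsFlow.loss_le_of_two_mem {N : ℕ} {z : Finset A → ℕ} (h : G.IsFlow N z)
    (hM : ∀ a, G.cap a ≤ G.M) {S : Finset A} (hS : S.card = G.k) {P : Finset A}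
    (hP : P ∈ G.all) (hz : N ≤ z P) {a b : A} (ha : a ∈ S) (hb : b ∈ S) (hab : a ≠ b)
    (haP : a ∈ P) (hbP : b ∈ P) :
    ∑ P ∈ G.all with (P ∩ S).Nonempty, z P + N ≤ N * (G.k * G.M) := by
  have key : ∑ X ∈ G.all, (if (X ∩ S).Nonempty then z X else 0) + N ≤
      ∑ X ∈ G.all, ∑ c ∈ S, if c ∈ X then z X else 0 := by
    rw [← Finset.add_sum_erase _ _ hP, ← Finset.add_sum_erase G.all
      (fun X => ∑ c ∈ S, if c ∈ X then z X else 0) hP]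
    have h₁ : (if (P ∩ S).Nonempty then z P else 0) + N ≤ ∑ c ∈ S, if c ∈ P then z P else 0 := by
      rw [if_pos ⟨a, Finset.mem_inter.2 ⟨haP, ha⟩⟩]
      have := Finset.sum_le_sum_of_subset (f := fun c => if c ∈ P then z P else 0)
        (Finset.insert_subset ha (Finset.singleton_subset_iff.2 hb))
      rw [Finset.sum_pair hab, if_pos haP, if_pos hbP] at this
      omega
    have h₂ : ∑ X ∈ G.all.erase P, (if (X ∩ S).Nonempty then z X else 0) ≤
        ∑ X ∈ G.all.erase P, ∑ c ∈ S, if c ∈ X then z X else 0 := by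
      have := loss_le_sum (G.all.erase P) z S
      simp_rw [Finset.sum_filter] at this
      rwa [Finset.sum_comm] at this
    omega
  rw [Finset.sum_filter]
  refine key.trans ?_
  rw [Finset.sum_comm]
  simp_rw [← Finset.sum_filter]
  calc _ ≤ ∑ c ∈ S, N * G.M := Finset.sum_le_sum fun c _ =>
        (h.cap_le c).trans (Nat.mul_le_mul_left _ (hM c))
    _ = N * (G.k * G.M) := by simp [hS]; ring

end Inst

namespace Layout

variable {D : Layout} {N : ℕ}

/-! ### From robust flows of the given instance to robust flows of the network -/

variable (D) in
/-- The index set of the paths used. -/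
abbrev Idx : Type := (D.Com × D.Main) ⊕ (D.Main × D.Main) ⊕ (Finset (Fin D.numA)) ⊕
  (Fin (D.rows + 1) × Fin D.cols × Bool) ⊕ (Fin D.cols × Bool)

/-- The commodity of an index. -/
def idxCom : D.Idx → D.Com
  | .inl x => x.1
  | .inr (.inl x) => lnk x.1
  | .inr (.inr (.inl _)) => com0
  | .inr (.inr (.inr (.inl x))) => row x.1
  | .inr (.inr (.inr (.inr x))) => col x.1

/-- A set of arcs containing the path of an index. -/
noncomputable def support : D.Idx → Finset D.Arc
  | .inl x => dpath x.1 x.2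
  | .inr (.inl x) => lpath x.1 x.2
  | .inr (.inr (.inl Q)) => {.feed com0, .toOrig, .fromOrig, .drain com0} ∪ Q.image .origIn ∪
      Q.image (fun a => .main (.inl a)) ∪ Q.image .origOut
  | .inr (.inr (.inr (.inl x))) => {.feed (row x.1), .rowIn x.1 x.2.1 x.2.2,
      .chainArc x.2.1 x.2.2 x.1, .rowOut x.1 x.2.1 x.2.2, .drain (row x.1)}
  | .inr (.inr (.inr (.inr x))) => {.feed (col x.1), .colIn x.1 x.2, .colOut x.1 x.2,
      .drain (col x.1)} ∪ Finset.univ.image (.chainArc x.1 x.2)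

/-- The amount of flow on the path of an index. -/
noncomputable def amount (N : ℕ) (y : Finset (Fin D.numA) → ℕ)
    (r : Fin (D.rows + 1) × Fin D.cols × Bool → ℕ) (g : Fin D.cols → Bool → ℕ) : D.Idx → ℕ
  | .inl x => N * D.direct x.1 x.2
  | .inr (.inl x) => N * D.lk x.1 x.2
  | .inr (.inr (.inl Q)) => if Q ∈ D.stPaths then y Q else 0
  | .inr (.inr (.inr (.inl x))) => r x
  | .inr (.inr (.inr (.inr x))) => g x.1 x.2

/-- Each arc of `Q` is expanded to three arcs and the resulting walk is shortened to a path.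
Containment in the support suffices, because capacities and losses are estimated on supports. -/
theorem exists_path_of_stPath {Q : Finset (Fin D.numA)} (hQ : Q ∈ D.stPaths) :
    ∃ P ∈ D.inst.paths com0, P ⊆ support (.inr (.inr (.inl Q))) := by
  obtain ⟨l, hw, -, rfl⟩ := mem_stPaths.1 hQ
  have key : ∀ (l : List (Fin D.numA)) (v : Fin D.numV), Walk D.tl D.hd v l D.t →
      Walk tail head (Node.orig v)
        (l.flatMap fun a => [.origIn a, .main (.inl a), .origOut a]) (.orig D.t) := by
    intro l
    induction l with
    | nil => rintro v rfl; rfl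
    | cons a l ih =>
      rintro v ⟨rfl, h⟩
      exact ⟨rfl, rfl, rfl, ih _ h⟩
  have w₀ : Walk tail head (Node.orig D.t) [.fromOrig, .drain com0] (.snk com0) := ⟨rfl, rfl, rfl⟩
  have w := (key l D.s hw).append w₀
  obtain ⟨P, hP, hsub⟩ := Walk.exists_simplePath (l := .feed com0 :: .toOrig :: _)
    (v := Node.src com0) (tl := tail) (hd := head) ⟨rfl, rfl, w⟩
  refine ⟨P, mem_paths.2 hP, hsub.trans fun a ha => ?_⟩
  simp only [List.mem_toFinset, List.mem_cons, List.mem_append, List.mem_flatMap,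
    List.not_mem_nil, or_false] at ha
  simp only [support, Finset.mem_union, Finset.mem_insert, Finset.mem_singleton,
    Finset.mem_image, List.mem_toFinset]
  rcases ha with rfl | rfl | ⟨b, hb, rfl | rfl | rfl⟩ | rfl | rfl <;> simp [*]

theorem exists_path_of_row (x : Fin (D.rows + 1) × Fin D.cols × Bool) :
    ∃ P ∈ D.inst.paths (row x.1), P ⊆ support (.inr (.inr (.inr (.inl x)))) := by
  obtain ⟨P, hP, hsub⟩ := Walk.exists_simplePath (l := [.feed (row x.1),
    .rowIn x.1 x.2.1 x.2.2, .chainArc x.2.1 x.2.2 x.1, .rowOut x.1 x.2.1 x.2.2, .drain (row x.1)])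
    (v := Node.src (row x.1)) (w := .snk (row x.1)) (tl := tail) (hd := head)
    ⟨rfl, rfl, rfl, rfl, rfl, rfl⟩
  refine ⟨P, mem_paths.2 hP, hsub.trans fun a ha => ?_⟩
  simpa [support] using ha

theorem exists_path_of_col (x : Fin D.cols × Bool) :
    ∃ P ∈ D.inst.paths (col x.1), P ⊆ support (.inr (.inr (.inr (.inr x)))) := by
  have key : ∀ m : Fin (D.rows + 2), ∃ l : List D.Arc,
      Walk tail head (Node.chain x.1 x.2 0) l (.chain x.1 x.2 m) ∧
      ∀ a ∈ l, a ∈ Finset.univ.image (Arc.chainArc x.1 x.2) := by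
    intro m
    induction m using Fin.induction with
    | zero => exact ⟨[], rfl, by simp⟩
    | succ m ih =>
      obtain ⟨l, h₁, h₂⟩ := ih
      have w₀ : Walk tail head (Node.chain x.1 x.2 m.castSucc) [.chainArc x.1 x.2 m]
        (.chain x.1 x.2 m.succ) := ⟨rfl, rfl⟩
      refine ⟨l ++ [.chainArc x.1 x.2 m], h₁.append w₀, fun a ha => ?_⟩
      rcases List.mem_append.1 ha with h | h
      · exact h₂ a h
      · simp at h
        simp [h]
  obtain ⟨l, h₁, h₂⟩ := key (Fin.last _)
  have w₀ : Walk tail head (Node.chain x.1 x.2 (Fin.last _)) [.colOut x.1 x.2, .drain (col x.1)]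
    (.snk (col x.1)) := ⟨rfl, rfl, rfl⟩
  have w := h₁.append w₀
  obtain ⟨P, hP, hsub⟩ := Walk.exists_simplePath (l := .feed (col x.1) :: .colIn x.1 x.2 :: _)
    (v := Node.src (col x.1)) (tl := tail) (hd := head) ⟨rfl, rfl, w⟩
  refine ⟨P, mem_paths.2 hP, hsub.trans fun a ha => ?_⟩
  simp only [List.mem_toFinset, List.mem_cons, List.mem_append, List.not_mem_nil, or_false] at ha
  simp only [support, Finset.mem_union, Finset.mem_insert, Finset.mem_singleton]
  have := h₂ a
  tauto

theorem exists_path_of_idx (hV : D.Valid) (y : Finset (Fin D.numA) → ℕ)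
    (r : Fin (D.rows + 1) × Fin D.cols × Bool → ℕ) (g : Fin D.cols → Bool → ℕ) (x : D.Idx) :
    ∃ P ⊆ support x, (amount N y r g x ≠ 0 → P ∈ D.inst.paths (idxCom x)) ∧
      ∀ p q, x = .inr (.inl (p, q)) → P = lpath p q := by
  rcases x with x | x | Q | x | x
  · exact ⟨_, subset_rfl, fun _ => dpath_mem _ _, by simp⟩
  · refine ⟨_, subset_rfl, fun h => lpath_mem fun e => h ?_, by rintro p q h; cases h; rfl⟩
    simp [amount, e, hV.lk_self]
  · by_cases hQ : Q ∈ D.stPaths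
    · obtain ⟨P, hP, hs⟩ := exists_path_of_stPath hQ
      exact ⟨P, hs, fun _ => hP, by simp⟩
    -- A dummy: an arc set that is not an `s`-`t`-path receives no flow.
    · exact ⟨∅, by simp, fun h => absurd (by simp [amount, hQ]) h, by simp⟩
  · obtain ⟨P, hP, hs⟩ := exists_path_of_row x
    exact ⟨P, hs, fun _ => hP, by simp⟩
  · obtain ⟨P, hP, hs⟩ := exists_path_of_col x
    exact ⟨P, hs, fun _ => hP, by simp⟩

end Layout

/-! ### Feasibility and robustness of the assembled flow -/

namespace Layout

variable {D : Layout} {N : ℕ}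

variable (D N) in
/-- A robust flow of the given digraph together with a feasible assignment of values to the chains
and amounts of flow on the row paths. -/
structure FlowData (y : Finset (Fin D.numA) → ℕ) (r : Fin (D.rows + 1) × Fin D.cols × Bool → ℕ)
    (g : Fin D.cols → Bool → ℕ) : Prop where
  cap_le : ∀ a, ∑ Q ∈ D.stPaths with a ∈ Q, y Q ≤ N
  loss_le : ∀ S : Finset (Fin D.numA), S.card = D.ext + 1 →
    (∀ a ∈ S, ∀ b ∈ S, a ≠ b → D.lk (.inl a) (.inl b) = 0) →
    ∑ Q ∈ D.stPaths with (Q ∩ S).Nonempty, y Q + N ≤ N * (D.ext + 1)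
  total_le : ∑ Q ∈ D.stPaths, y Q ≤ N * D.rhs 0
  col_eq : ∀ j, g j true + g j false = N * D.W
  row_le : ∀ x, r x ≤ D.coef x.1 x.2.1 x.2.2 * g x.2.1 (!x.2.2)
  row_eq : ∀ l, ∑ j, ∑ b, r (l, j, b) + (if l = 0 then ∑ Q ∈ D.stPaths, y Q else 0) = N * D.rhs l

section

variable {y : Finset (Fin D.numA) → ℕ} {r : Fin (D.rows + 1) × Fin D.cols × Bool → ℕ}
    {g : Fin D.cols → Bool → ℕ}

theorem FlowData.g_le (h : D.FlowData N y r g) (j : Fin D.cols) (b : Bool) : g j b ≤ N * D.W := by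
  have := h.col_eq j
  cases b <;> omega

theorem FlowData.r_le (h : D.FlowData N y r g) (hV : D.Valid) (l : Fin (D.rows + 1)) (j : Fin D.cols)
    (b : Bool) : r (l, j, b) + g j b ≤ N * D.W := by
  have h₁ := h.row_le (l, j, b)
  have h₂ := h.col_eq j
  have h₃ := Nat.mul_le_mul_right (g j (!b)) (hV.coef_le l j b)
  dsimp only at h₁
  cases b <;> simp only [Bool.not_true, Bool.not_false] at * <;> omega

theorem FlowData.r_le' (h : D.FlowData N y r g) (l : Fin (D.rows + 1)) (j : Fin D.cols)
    (b : Bool) : r (l, j, b) ≤ N * (D.W * D.coef l j b) := by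
  refine (h.row_le (l, j, b)).trans ?_
  rw [← mul_assoc, mul_comm]
  exact Nat.mul_le_mul_right _ (h.g_le j _)

theorem sum_idx (f : D.Idx → ℕ) : ∑ x, f x = ∑ i, ∑ c, f (.inl (i, c)) +
    (∑ p, ∑ q, f (.inr (.inl (p, q))) + (∑ Q, f (.inr (.inr (.inl Q))) +
      (∑ l, ∑ j, ∑ b, f (.inr (.inr (.inr (.inl (l, j, b))))) +
        ∑ j, ∑ b, f (.inr (.inr (.inr (.inr (j, b)))))))) := by
  simp only [Fintype.sum_sum_type, Fintype.sum_prod_type]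

theorem sum_amount_com (h : D.FlowData N y r g) (i : D.Com) :
    ∑ x, (if idxCom x = i then amount N y r g x else 0) = N * D.demand i := by
  classical
  rw [sum_idx]
  have h₁ : ∑ i', ∑ c, (if i' = i then N * D.direct i' c else 0) = N * ∑ c, D.direct i c := by
    rw [Finset.mul_sum, Finset.sum_eq_single i]
    · simp
    · intro b _ hb; simp [hb]
    · simp
  simp only [idxCom, amount]
  rw [demand, mul_add]
  refine congrArg₂ (· + ·) h₁ ?_
  rcases i with l | j | p
  · have := h.row_eq l
    simp only [core, ← this]
    simp only [reduceCtorEq, if_false, Finset.sum_const_zero, zero_add, add_zero, Sum.inl.injEq]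
    rw [add_comm, Finset.sum_eq_single l]
    · simp [eq_comm]
    · intro b _ hb; simp [hb]
    · simp
  · simp only [core, ← h.col_eq j]
    simp only [reduceCtorEq, if_false, Finset.sum_const_zero, zero_add, Sum.inr.injEq,
      Sum.inl.injEq]
    rw [Finset.sum_eq_single j]
    · simp
    · intro b _ hb; simp [hb]
    · simp
  · simp only [core, outdeg, Finset.mul_sum]
    simp only [reduceCtorEq, if_false, Finset.sum_const_zero, add_zero, Sum.inr.injEq]
    rw [Finset.sum_eq_single p]
    · simp
    · intro b _ hb; simp [hb]
    · simp

theorem sum_stPaths (p : Finset (Fin D.numA) → Prop) [DecidablePred p] :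
    ∑ Q, (if p Q then if Q ∈ D.stPaths then y Q else 0 else 0) =
      ∑ Q ∈ D.stPaths with p Q, y Q := by
  rw [Finset.sum_filter, ← Finset.sum_subset (Finset.subset_univ D.stPaths)]
  · exact Finset.sum_congr rfl fun Q hQ => by rw [if_pos hQ]
  · intro Q _ hQ
    simp [hQ]

theorem sum_links_le (c : D.Main) :
    ∑ p, ∑ q, (if c = p ∨ c = q then N * D.lk p q else 0) ≤ N * (D.outdeg c + D.indeg c) := by
  classical
  calc _ ≤ ∑ p, ∑ q, ((if p = c then N * D.lk p q else 0) + if q = c then N * D.lk p q else 0) := by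
        refine Finset.sum_le_sum fun p _ => Finset.sum_le_sum fun q _ => ?_
        by_cases hp : c = p <;> by_cases hq : c = q <;> simp [hp, hq]
    _ = N * (D.outdeg c + D.indeg c) := by
        simp only [Finset.sum_add_distrib]
        rw [Finset.sum_comm (f := fun p q => if p = c then N * D.lk p q else 0)]
        simp [-Fintype.sum_sum_type, outdeg, indeg, mul_add, Finset.mul_sum]

/-- The delicate arcs are the main arcs, filled by direct flow, links and at most one unit of
`s`-`t` flow, and the chain arcs, where a row uses at most what its column leaves. -/
theorem sum_amount_arc (h : D.FlowData N y r g) (hV : D.Valid) (a : D.Arc) :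
    ∑ x, (if a ∈ support x then amount N y r g x else 0) ≤ N * D.capacity a := by
  classical
  rw [sum_idx]
  cases a <;> simp [support, amount, dpath, lpath, capacity, ite_and, -Fintype.sum_sum_type]
  case feed i =>
    rcases i with l | j | p
    · simpa [add_comm, core] using (h.row_eq l).le
    · simpa [core] using (h.col_eq j).le
    · simp [-Fintype.sum_sum_type, core, outdeg, Finset.mul_sum]
  case drain i =>
    rcases i with l | j | p
    · simpa [add_comm, core] using (h.row_eq l).le
    · simpa [core] using (h.col_eq j).le
    · simp [-Fintype.sum_sum_type, core, outdeg, Finset.mul_sum]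
  case main c =>
    rw [sum_stPaths, ← sum_direct_add hV c, mul_add, Finset.mul_sum, used, mul_add]
    refine Nat.add_le_add_left (Nat.add_le_add (sum_links_le c) ?_) _
    rcases c with a | e
    · simpa using h.cap_le a
    · simp
  case origIn a => rw [sum_stPaths]; exact h.cap_le a
  case origOut a => rw [sum_stPaths]; exact h.cap_le a
  case toOrig => exact h.total_le
  case fromOrig => exact h.total_le
  case linkIn p => simp [-Fintype.sum_sum_type, outdeg, Finset.mul_sum]
  case chainArc j b l => exact h.r_le hV l j b
  case colIn j b => exact h.g_le j b
  case colOut j b => exact h.g_le j b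
  case rowIn l j b => exact h.r_le' l j b
  case rowOut l j b => exact h.r_le' l j b

theorem sum_rotate {α β γ : Type*} (s : Finset α) (t : Finset β) (u : Finset γ)
    (f : α → β → γ → ℕ) :
    ∑ a ∈ s, ∑ b ∈ t, ∑ c ∈ u, f a b c = ∑ c ∈ u, ∑ a ∈ s, ∑ b ∈ t, f a b c := by
  rw [Finset.sum_comm (s := u)]
  exact Finset.sum_congr rfl fun a _ => Finset.sum_comm

/-- A robust flow of the given digraph and a feasible assignment of values to the chains yield a
robust flow of the network. -/
theorem FlowData.exists_sol (h : D.FlowData N y r g) (hV : D.Valid) : ∃ z, D.inst.Sol N z := by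
  classical
  choose pth hsup hmem hlnk using exists_path_of_idx (N := N) hV y r g
  set amt := amount N y r g with hamt
  -- Summing over all indices with the same path makes it unnecessary to know that the chosen paths
  -- are distinct.
  set z : Finset D.Arc → ℕ := fun P => ∑ x, if pth x = P then amt x else 0 with hz
  have hsum : ∀ F : Finset (Finset D.Arc), ∑ P ∈ F, z P = ∑ x, if pth x ∈ F then amt x else 0 := by
    intro F
    simp only [hz]
    rw [Finset.sum_comm]
    refine Finset.sum_congr rfl fun x _ => ?_
    simp
  have hflow : D.inst.IsFlow N z := by
    refine ⟨fun a => ?_, fun i => ?_⟩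
    · rw [hsum]
      refine le_trans (Finset.sum_le_sum fun x _ => ?_) (sum_amount_arc h hV a)
      by_cases ha : a ∈ pth x
      · rw [if_pos (hsup x ha)]
        split_ifs <;> simp [hamt]
      · simp [ha]
    · rw [hsum]
      refine Eq.trans (Finset.sum_congr rfl fun x _ => ?_) (sum_amount_com h i)
      by_cases h0 : amt x = 0
      · rw [← hamt]; simp [h0]
      · have := hmem x h0
        rw [if_congr (mem_paths_iff this i) rfl rfl]
        simp only [eq_comm]
        rfl
  refine ⟨z, hflow, fun S hS => ?_⟩
  by_cases hmain : ∀ a ∈ S, D.capacity a = D.maxc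
  swap
  · push Not at hmain
    obtain ⟨a, ha, hne⟩ := hmain
    exact hflow.loss_le_of_cap_lt (capacity_le hV) hS ha hne
  have hmain' : ∀ a ∈ S, ∃ c, a = .main c := fun a ha => (capacity_eq_iff hV a).1 (hmain a ha)
  -- A link inside `S` is traversed twice by its link path, which carries `N`.
  by_cases hl : ∃ p q, D.lk p q = 1 ∧ Arc.main p ∈ S ∧ Arc.main q ∈ S
  · obtain ⟨p, q, hlk, hp, hq⟩ := hl
    have hpq := lk_ne hV hlk
    refine hflow.loss_le_of_two_mem (capacity_le hV) hS (P := lpath p q)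
      (Inst.mem_all.2 ⟨_, lpath_mem hpq⟩) ?_ hp hq (by simpa using hpq) (by simp [lpath])
      (by simp [lpath])
    have := Finset.single_le_sum (f := fun x => if pth x = lpath p q then amt x else 0)
      (fun _ _ => Nat.zero_le _) (Finset.mem_univ (.inr (.inl (p, q))))
    simp only [hlnk _ p q rfl, if_true] at this
    rwa [show amt (.inr (.inl (p, q))) = N by simp [hamt, amount, hlk]] at this
  push Not at hl
  have hlk0 : ∀ p q, Arc.main p ∈ S → Arc.main q ∈ S → D.lk p q = 0 := fun p q hp hq => by
    have := hV.lk_le p q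
    have := hl p q
    by_contra hne
    exact this (by omega) hp hq
  set S₀ : Finset (Fin D.numA) := Finset.univ.filter fun a => Arc.main (.inl a) ∈ S with hS₀
  have hinl : ∀ a ∈ S, ∃ b ∈ S₀, a = .main (.inl b) := by
    -- There are only `k - 1` extra arcs, so `S` contains an original one. As this is linked with
    -- every extra arc, `S` then contains no extra arc at all.
    have hex : ∃ b, Arc.main (.inl b) ∈ S := by
      by_contra hc
      push Not at hc
      have : S ⊆ Finset.univ.image fun e : Fin D.ext => Arc.main (.inr e) := by
        intro a ha
        obtain ⟨c, rfl⟩ := hmain' a ha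
        rcases c with b | e
        · exact absurd ha (hc b)
        · simp
      have := (Finset.card_le_card this).trans Finset.card_image_le
      simp only [Finset.card_univ, Fintype.card_fin] at this
      rw [hS] at this
      simp at this
    obtain ⟨b, hb⟩ := hex
    intro a ha
    obtain ⟨c, rfl⟩ := hmain' a ha
    rcases c with b' | e
    · exact ⟨b', by simp [hS₀, ha], rfl⟩
    · have := hlk0 _ _ ha hb
      rw [hV.lk_inr_inl] at this
      simp at this
  have hSim : S = S₀.image fun a => .main (.inl a) := by
    ext a
    constructor
    · intro ha
      obtain ⟨b, hb, rfl⟩ := hinl a ha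
      exact Finset.mem_image_of_mem _ hb
    · intro ha
      obtain ⟨b, hb, rfl⟩ := Finset.mem_image.1 ha
      simpa [hS₀] using hb
  have hcard : S₀.card = D.ext + 1 := by
    rw [hSim, Finset.card_image_of_injective _ (fun a b h => by simpa using h)] at hS
    exact hS
  have hloss := h.loss_le S₀ hcard fun a ha b hb _ => hlk0 _ _ (by simpa [hS₀] using ha)
    (by simpa [hS₀] using hb)
  -- The direct and link flow is bounded arc by arc. Only for the `s`-`t` flow must a path that
  -- meets `S` several times be counted once.
  have key : ∑ P ∈ D.inst.all with (P ∩ S).Nonempty, z P ≤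
      ∑ a ∈ S₀, (∑ i, N * D.direct i (.inl a) +
        ∑ p, ∑ q, (if .inl a = p ∨ .inl a = q then N * D.lk p q else 0)) +
      ∑ Q ∈ D.stPaths with (Q ∩ S₀).Nonempty, y Q := by
    have hhit : ∀ x, (pth x ∩ S).Nonempty → ∃ a ∈ S₀, Arc.main (.inl a) ∈ support x := by
      rintro x ⟨a, ha⟩
      rw [Finset.mem_inter] at ha
      obtain ⟨b, hb, rfl⟩ := hinl a ha.2
      exact ⟨b, hb, hsup x ha.1⟩
    rw [hsum]
    calc _ ≤ ∑ x, if ∃ a ∈ S₀, Arc.main (.inl a) ∈ support x then amt x else 0 := by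
          refine Finset.sum_le_sum fun x _ => ?_
          by_cases hx : (pth x ∩ S).Nonempty
          · rw [if_pos (hhit x hx)]
            split_ifs <;> simp
          · simp [hx]
      _ ≤ _ := by
          rw [sum_idx, Finset.sum_add_distrib, add_assoc]
          have hle : ∀ (p : Fin D.numA → Prop) [DecidablePred p] (n : ℕ),
              (if ∃ a ∈ S₀, p a then n else 0) ≤ ∑ a ∈ S₀, if p a then n else 0 := by
            intro p _ n
            split_ifs with hp
            · obtain ⟨a, ha, hpa⟩ := hp
              refine le_trans ?_ (Finset.single_le_sum (f := fun a => if p a then n else 0)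
                (fun _ _ => Nat.zero_le _) ha)
              simp [hpa]
            · exact Nat.zero_le _
          refine Nat.add_le_add ?_ (Nat.add_le_add ?_ ?_)
          · refine (Finset.sum_le_sum fun i _ => Finset.sum_le_sum fun c _ => hle _ _).trans ?_
            rw [sum_rotate]
            simp [dpath, hamt, amount, support, -Fintype.sum_sum_type]
          · refine (Finset.sum_le_sum fun i _ => Finset.sum_le_sum fun c _ => hle _ _).trans ?_
            rw [sum_rotate]
            simp [lpath, hamt, amount, support, -Fintype.sum_sum_type]
          · have e := sum_stPaths (D := D) (y := y) fun Q => (Q ∩ S₀).Nonempty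
            simp only [Finset.Nonempty, Finset.mem_inter] at e
            simp only [Finset.Nonempty, Finset.mem_inter]
            simp [support, hamt, amount, ← e, and_comm]
  -- Direct and link flow fill each of the `k` arcs up to `M - 1`.
  have hbound : ∑ a ∈ S₀, (∑ i, N * D.direct i (.inl a) +
        ∑ p, ∑ q, (if .inl a = p ∨ .inl a = q then N * D.lk p q else 0)) + N * (D.ext + 1) ≤
        N * ((D.ext + 1) * D.maxc) := by
    calc _ ≤ ∑ a ∈ S₀, N * (D.maxc - 1) + N * (D.ext + 1) := by
          refine Nat.add_le_add_right (Finset.sum_le_sum fun a _ => ?_) _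
          have h₁ := sum_links_le (N := N) (D := D) (.inl a)
          have h₂ := sum_direct_add hV (.inl a)
          simp only [used, Sum.isLeft_inl, if_true] at h₂
          rw [show D.maxc - 1 = ∑ i, D.direct i (.inl a) +
            (D.outdeg (.inl a) + D.indeg (.inl a)) by omega, mul_add, Finset.mul_sum]
          exact Nat.add_le_add_left h₁ _
      _ = N * ((D.ext + 1) * D.maxc) := by
          have : 1 ≤ D.maxc := by simp only [maxc]; omega
          obtain ⟨m, hm⟩ := Nat.exists_eq_add_of_le this
          rw [Finset.sum_const, hcard, hm]
          simp
          ring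
  simp only [inst_k, inst_M]
  omega

end
end Layout

namespace Layout

variable {D : Layout} {N : ℕ}

/-! ### Structural properties of the network -/

theorem card_main : Fintype.card D.Main = D.numA + D.ext := by simp

theorem demand_of_ne {i : D.Com} (hi : i ≠ com0) :
    D.demand i = 2 * (D.numA + D.ext) + D.core i := by
  simp only [demand, direct_of_ne hi, Finset.sum_const, smul_eq_mul, Finset.card_univ, card_main]
  rw [mul_comm]

/-- Every other commodity needs two units per main arc and its core; the sums of both over all
commodities are summands of `maxc`, and the constant 10 leaves the slack. -/
theorem sum_demand_erase : ∑ i ∈ Finset.univ.erase (com0 : D.Com), D.demand i + 3 ≤ D.maxc := by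
  rw [Finset.sum_congr rfl fun i hi => demand_of_ne (Finset.ne_of_mem_erase hi),
    Finset.sum_add_distrib]
  have h₁ : ∑ i ∈ Finset.univ.erase (com0 : D.Com), D.core i ≤ ∑ i, D.core i :=
    Finset.sum_le_sum_of_subset (Finset.erase_subset _ _)
  have h₂ : ∑ i ∈ Finset.univ.erase (com0 : D.Com), 2 * (D.numA + D.ext) ≤
      ∑ i : D.Com, 2 * (D.numA + D.ext) :=
    Finset.sum_le_sum_of_subset (Finset.erase_subset _ _)
  rw [Finset.sum_const (s := Finset.univ), Finset.card_univ, card_com, smul_eq_mul, mul_comm D.numK,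
    mul_right_comm, mul_right_comm] at h₂
  simp only [maxc]
  omega

/-- Saturation alone forces this in every flow: the two units on `directIn i c` have no other
continuation than `main c`. -/
theorem two_le_flow_main {z : Finset D.Arc → ℕ} (h : D.inst.IsFlow N z) {i : D.Com}
    (hi : i ≠ com0) (c : D.Main) : N * 2 ≤ ∑ P ∈ D.inst.paths i with Arc.main c ∈ P, z P := by
  have := flow_src h (i := i) (a := .directIn i c) rfl
  rw [capacity, direct_of_ne hi] at this
  rw [← this]
  refine Finset.sum_le_sum_of_subset fun P hP => ?_
  rw [Finset.mem_filter] at hP ⊢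
  exact ⟨hP.1, main_of_inn hP.1 hP.2 rfl⟩

variable (D) in
/-- The node set of the tight cut. -/
def cut : D.Node → Bool
  | .src _ => true
  | .entry (.inr (.inr _)) => true
  | .inn (.inr _) => true
  | _ => false

variable (D) in
/-- The arcs leaving the tight cut. -/
noncomputable def cutArcs : Finset D.Arc :=
  Finset.univ.filter fun a => D.cut (tail a) = true ∧ D.cut (head a) = false

theorem mem_cutArcs {a : D.Arc} :
    a ∈ D.cutArcs ↔ D.cut (tail a) = true ∧ D.cut (head a) = false := by simp [cutArcs]

/-- An extra arc has links to all original arcs, receives none and carries no `s`-`t` flow. -/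
theorem maxc_eq (hV : D.Valid) (e : Fin D.ext) :
    ∑ i : D.Com, D.direct i (.inr e) + D.numA = D.maxc := by
  rw [← sum_direct_add hV (.inr e)]
  have h₁ : D.outdeg (.inr e) = D.numA := by
    simp [outdeg, Fintype.sum_sum_type, hV.lk_inr, hV.lk_inr_inl]
  have h₂ : D.indeg (.inr e) = 0 := by simp [indeg, hV.lk_inr]
  simp [used, h₁, h₂]

theorem cutArcs_eq : D.cutArcs.filter (fun a => ∃ c, a = .main c) =
    Finset.univ.image fun e => Arc.main (.inr e) := by
  ext a
  cases a with
  | main c => rcases c with c | c <;> simp [mem_cutArcs, cut, tail, head]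
  | _ => simp

theorem card_cut_main (hV : D.Valid) :
    (D.cutArcs.filter fun a => D.capacity a = D.maxc).card = D.ext := by
  simp_rw [capacity_eq_iff hV]
  rw [cutArcs_eq, Finset.card_image_of_injective _ (fun _ _ h => by simpa using h)]
  simp

theorem outdeg_eq (hV : D.Valid) (p : D.Main) : D.outdeg p = ∑ a, D.lk p (.inl a) := by
  simp [outdeg, Fintype.sum_sum_type, hV.lk_inr]

/-- The cut separates the sources from everything except the tails of the extra arcs and the entries
of the link commodities. By `maxc_eq` the capacity of an extra arc equals the direct flow and the
link flow starting on it. All other demand leaves through direct arcs to original main arcs, feeds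
of rows and columns, and arcs `linkIn` of original arcs. -/
theorem sum_cutArcs (hV : D.Valid) : ∑ a ∈ D.cutArcs, D.capacity a = ∑ i, D.demand i := by
  have hm : D.ext * D.maxc = ∑ i : D.Com, ∑ e : Fin D.ext, D.direct i (.inr e) +
      D.ext * D.numA := by
    have := Finset.sum_congr (s₁ := Finset.univ) rfl fun e _ => (maxc_eq hV e).symm
    rw [Finset.sum_add_distrib, Finset.sum_comm] at this
    simpa using this
  simp only [Fintype.sum_sum_type] at hm
  rw [cutArcs, Finset.sum_filter, sum_arc]
  simp only [Fintype.sum_sum_type, Fintype.sum_prod_type, arcEquiv, Equiv.coe_fn_symm_mk, tail,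
    head, cut, capacity, demand, core, Finset.sum_add_distrib]
  simp [outdeg_eq hV, hV.lk_inr_inl]
  omega

/-- The counts of commodities, main arcs and columns are each at most the number of arcs, because
the feeds alone are as numerous as the commodities. With `W ≤ numA`, every core is then at most
quadratic. -/
theorem maxc_le {n : ℕ} (hn : n = Fintype.card D.Arc) (hW : D.W ≤ D.numA)
    (hr : ∀ l, D.rhs l ≤ D.W * D.cols + 1) (hV : D.Valid) :
    D.maxc ≤ 10 + 2 * n + 2 * n + 2 * n * n + n + n * (n * n + 1) := by
  have hc : n = Fintype.card D.ArcSum := hn.trans (Fintype.card_congr (arcEquiv D))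
  have hK : D.numK ≤ n := by
    rw [hc]; simp only [ArcSum, Fintype.card_sum, numK, Fintype.card_fin]; omega
  have hA : D.numA + D.ext ≤ n := le_trans (by simp only [numK]; omega) hK
  have hC : D.cols ≤ n := le_trans (by simp only [numK]; omega) hK
  have hcore : ∀ i, D.core i ≤ n * n + 1 := by
    have hn1 : n ≤ n * n := Nat.le_mul_self n
    rintro (l | j | p)
    · have := hr l
      have := Nat.mul_le_mul (hW.trans ((Nat.le_add_right _ _).trans hA)) hC
      simp only [core]; omega
    · simp only [core]; omega
    · have := outdeg_le hV p
      simp only [core]; omega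
  have hs : ∑ i, D.core i ≤ n * (n * n + 1) := by
    refine (Finset.sum_le_card_nsmul _ _ _ fun i _ => hcore i).trans ?_
    rw [Finset.card_univ, card_com, smul_eq_mul]
    exact Nat.mul_le_mul_right _ hK
  have h2 := Nat.mul_le_mul (Nat.mul_le_mul_left 2 hA) hK
  simp only [maxc]
  omega

end Layout

/-! ### Encoding a fraction by rows -/

theorem sum_testBit {n L : ℕ} (h : n < 2 ^ L) :
    ∑ i ∈ Finset.range L, (n.testBit i).toNat * 2 ^ i = n := by
  induction L generalizing n with
  | zero => simp at h; simp [h]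
  | succ L ih =>
    rw [Finset.sum_range_succ']
    have := ih (n := n / 2) (by rw [pow_succ] at h; omega)
    simp only [Nat.testBit_succ, pow_succ, ← mul_assoc, ← Finset.sum_mul, this, pow_zero,
      mul_one, Nat.testBit_zero]
    rcases Nat.mod_two_eq_zero_or_one n with h | h <;> simp [h] <;> omega

/-- The positive coefficients of the `j`-th equation: the bits of `den` for `j = 0`, and all
columns before the `j`-th for `j ≥ 1`. -/
def posCoef (den j i : ℕ) : Bool := if j = 0 then decide (1 ≤ i) && den.testBit (i - 1) else decide (i < j)

/-- The negative coefficients of the `j`-th equation. -/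
def negCoef (j i : ℕ) : Bool := decide (1 ≤ j) && decide (i = j)

/-- The coefficients of the rows: row `0` has the bits of `num`, each equation is represented by
two inequalities. -/
def rowCoef (num den C l i : ℕ) (b : Bool) : Bool :=
  if l = 0 then b && (decide (1 ≤ i) && num.testBit (i - 1))
  else if l ≤ C then (if b then negCoef (l - 1) i else posCoef den (l - 1) i)
  else (if b then posCoef den (l - 1 - C) i else negCoef (l - 1 - C) i)

/-- The right-hand sides of the rows. -/
def rowRhs (num den C W l : ℕ) : ℕ :=
  W * ∑ i ∈ Finset.range C, (rowCoef num den C l i true).toNat + (if l = 1 then 1 else 0) -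
    if l = C + 1 then 1 else 0

section

variable {num den n : ℕ} {V : ℕ → ℕ}

theorem sum_bits (d : ℕ) (V : ℕ → ℕ) :
    ∑ i ∈ Finset.range (n + 1), (decide (1 ≤ i) && d.testBit (i - 1)).toNat * V i =
      ∑ i ∈ Finset.range n, (d.testBit i).toNat * V (i + 1) := by
  rw [Finset.sum_range_succ']; simp

theorem sum_posCoef {j C : ℕ} (h₁ : 1 ≤ j) (h₂ : j ≤ C) :
    ∑ i ∈ Finset.range C, (posCoef den j i).toNat * V i = ∑ i ∈ Finset.range j, V i := by
  have : j ≠ 0 := by omega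
  simp only [posCoef, this, if_false, Bool.toNat, Bool.cond_decide, ite_mul, one_mul, zero_mul]
  rw [← Finset.sum_filter]
  congr 1; ext i; simp; omega

theorem sum_negCoef {j C : ℕ} (h₁ : 1 ≤ j) (h₂ : j < C) :
    ∑ i ∈ Finset.range C, (negCoef j i).toNat * V i = V j := by
  rw [Finset.sum_eq_single j]
  · simp [negCoef, h₁]
  · intro i _ hi; simp [negCoef, hi]
  · simp [h₂]

theorem one_le_sum_testBit {d L : ℕ} (h : d < 2 ^ L) (hd : 0 < d) :
    1 ≤ ∑ i ∈ Finset.range L, (d.testBit i).toNat := by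
  by_contra hc
  have h0 : ∀ i ∈ Finset.range L, (d.testBit i).toNat = 0 :=
    Finset.sum_eq_zero_iff.1 (by omega)
  have := sum_testBit h
  rw [Finset.sum_eq_zero fun i hi => by rw [h0 i hi, zero_mul]] at this
  omega

/-- The subtraction in `rowRhs` is not truncated: one is subtracted only in row `n + 2`, whose
positive part counts the bits of `den`, at least one. -/
theorem rowRhs_add {W l : ℕ} (hd : den < 2 ^ n) (hd0 : 0 < den) (hW : 0 < W) :
    rowRhs num den (n + 1) W l + (if l = n + 2 then 1 else 0) =
      W * ∑ i ∈ Finset.range (n + 1), (rowCoef num den (n + 1) l i true).toNat +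
        if l = 1 then 1 else 0 := by
  rw [rowRhs, Nat.sub_add_cancel]
  by_cases h : l = n + 2
  · subst h
    have : ∑ i ∈ Finset.range (n + 1), (rowCoef num den (n + 1) (n + 2) i true).toNat =
        ∑ i ∈ Finset.range n, (den.testBit i).toNat := by
      have := sum_bits (n := n) den fun _ => 1
      simpa [rowCoef, posCoef] using this
    rw [this]
    have := Nat.mul_le_mul hW (one_le_sum_testBit hd hd0)
    simpa using this
  · simp [h]

/-- Values of the columns that satisfy all equations are determined by their first value. -/
theorem columns_eq (h : ∀ j, 1 ≤ j → j ≤ n → V j = ∑ i ∈ Finset.range j, V i) {i : ℕ} (hi : i < n) :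
    V (i + 1) = 2 ^ i * V 0 := by
  induction i with
  | zero => rw [h _ le_rfl (by omega)]; simp
  | succ i ih =>
    rw [h _ (by omega) (by omega), Finset.sum_range_succ, ← h _ (by omega) (by omega),
      ih (by omega), pow_succ]
    ring

theorem columns_spec (h : ∀ i, 1 ≤ i → V i = 2 ^ (i - 1) * V 0) {j : ℕ} (hj : 1 ≤ j) :
    V j = ∑ i ∈ Finset.range j, V i := by
  induction j, hj using Nat.le_induction with
  | base => rw [h _ le_rfl]; simp
  | succ j hj ih =>
    rw [Finset.sum_range_succ, ← ih, h (j + 1) (by omega), h j hj]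
    obtain ⟨j, rfl⟩ := Nat.exists_eq_add_of_le' hj
    simp [pow_succ]; ring

theorem sum_bits_eq {d : ℕ} (hd : d < 2 ^ n) (h : ∀ i < n, V (i + 1) = 2 ^ i * V 0) :
    ∑ i ∈ Finset.range n, (d.testBit i).toNat * V (i + 1) = d * V 0 := by
  conv_rhs => rw [← sum_testBit hd]
  rw [Finset.sum_mul]
  exact Finset.sum_congr rfl fun i hi => by rw [h i (Finset.mem_range.1 hi), mul_assoc]

/-- The `l`-th row as an inequality. -/
def RowHolds (num den n : ℕ) (V : ℕ → ℕ) (N t l : ℕ) : Prop :=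
  ∑ i ∈ Finset.range (n + 1), (rowCoef num den (n + 1) l i true).toNat * V i +
      (if l = 1 then N else 0) ≤
    ∑ i ∈ Finset.range (n + 1), (rowCoef num den (n + 1) l i false).toNat * V i +
      (if l = n + 2 then N else 0) + if l = 0 then t else 0

theorem rowHolds_zero {N t : ℕ} : RowHolds num den n V N t 0 ↔
    ∑ i ∈ Finset.range n, (num.testBit i).toNat * V (i + 1) ≤ t := by
  rw [← sum_bits]; simp [RowHolds, rowCoef]

theorem rowHolds_pos {N t j : ℕ} (hj : j ≤ n) : RowHolds num den n V N t (j + 1) ↔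
    ∑ i ∈ Finset.range (n + 1), (negCoef j i).toNat * V i + (if j = 0 then N else 0) ≤
      ∑ i ∈ Finset.range (n + 1), (posCoef den j i).toNat * V i := by
  have : j ≠ n + 1 := by omega
  simp [RowHolds, rowCoef, hj, this]

theorem rowHolds_neg {N t j : ℕ} : RowHolds num den n V N t (n + 2 + j) ↔
    ∑ i ∈ Finset.range (n + 1), (posCoef den j i).toNat * V i ≤
      ∑ i ∈ Finset.range (n + 1), (negCoef j i).toNat * V i + if j = 0 then N else 0 := by
  have h₂ : ¬ n + 2 + j ≤ n + 1 := by omega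
  have h₃ : n + 2 + j ≠ 1 := by omega
  simp [RowHolds, rowCoef, h₂, h₃]

theorem sum_negCoef_zero : ∑ i ∈ Finset.range (n + 1), (negCoef 0 i).toNat * V i = 0 := by
  simp [negCoef]

theorem sum_posCoef_zero : ∑ i ∈ Finset.range (n + 1), (posCoef den 0 i).toNat * V i =
      ∑ i ∈ Finset.range n, (den.testBit i).toNat * V (i + 1) := by
  rw [← sum_bits]; simp [posCoef]

/-- Rows `j + 1` and `n + 2 + j` are opposite inequalities and give the `j`-th equation. The
equations with `j ≥ 1` make the columns powers of two times `V 0`, so sums over bits become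
multiples of `V 0`. -/
theorem of_rowHolds {N t : ℕ} (hn : num < 2 ^ n) (hd : den < 2 ^ n)
    (h : ∀ l < 2 * (n + 1) + 1, RowHolds num den n V N t l) : den * V 0 = N ∧ num * V 0 ≤ t := by
  have hV : ∀ j, 1 ≤ j → j ≤ n → V j = ∑ i ∈ Finset.range j, V i := by
    intro j h₁ h₂
    have k₁ := (rowHolds_pos h₂).1 (h (j + 1) (by omega))
    have k₂ := rowHolds_neg.1 (h (n + 2 + j) (by omega))
    rw [sum_posCoef h₁ (by omega), sum_negCoef h₁ (by omega), if_neg (by omega)] at k₁ k₂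
    omega
  have hV' := fun i hi => columns_eq hV (i := i) hi
  have k₀ := rowHolds_zero.1 (h 0 (by omega))
  have k₁ := (rowHolds_pos (Nat.zero_le _)).1 (h (0 + 1) (by omega))
  have k₂ := rowHolds_neg.1 (h (n + 2 + 0) (by omega))
  rw [sum_negCoef_zero, sum_posCoef_zero, sum_bits_eq hd hV'] at k₁ k₂
  rw [sum_bits_eq hn hV'] at k₀
  simp only [if_true] at k₁ k₂
  omega

theorem rowHolds {N t l : ℕ} (hn : num < 2 ^ n) (hd : den < 2 ^ n)
    (h : ∀ i, 1 ≤ i → V i = 2 ^ (i - 1) * V 0) (hN : den * V 0 = N) (ht : num * V 0 ≤ t)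
    (hl : l < 2 * (n + 1) + 1) : RowHolds num den n V N t l := by
  have hV : ∀ i < n, V (i + 1) = 2 ^ i * V 0 := fun i _ => h (i + 1) (by omega)
  rcases Nat.eq_zero_or_pos l with rfl | h0
  · rwa [rowHolds_zero, sum_bits_eq hn hV]
  rcases Nat.lt_or_ge l (n + 2) with h1 | h1
  · obtain ⟨j, rfl⟩ := Nat.exists_eq_add_of_le' h0
    rw [rowHolds_pos (by omega)]
    rcases Nat.eq_zero_or_pos j with rfl | hj
    · rw [sum_negCoef_zero, sum_posCoef_zero, sum_bits_eq hd hV]; simp [hN]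
    · rw [sum_posCoef hj (by omega), sum_negCoef hj (by omega), if_neg (by omega),
        columns_spec h hj]; rfl
  · obtain ⟨j, rfl⟩ := Nat.exists_eq_add_of_le h1
    rw [rowHolds_neg]
    rcases Nat.eq_zero_or_pos j with rfl | hj
    · rw [sum_negCoef_zero, sum_posCoef_zero, sum_bits_eq hd hV]; simp [hN]
    · rw [sum_posCoef hj (by omega), sum_negCoef hj (by omega), if_neg (by omega),
        columns_spec h hj]; rfl

end


/-! ### The layout of an instance of MRF-R* -/

namespace MRFR

variable (I : MRFR)

/-- A bound on the number of bits of the numerator and the denominator of the demand. -/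
def width : ℕ := max I.demand.num.size I.demand.den.size

open Classical in
/-- Two arcs of maximum capacity are linked unless they are compatible. -/
noncomputable def linked : Fin I.numA ⊕ Fin (I.k - 1) → Fin I.numA ⊕ Fin (I.k - 1) → ℕ
  | .inl a, .inl b => if a ≠ b ∧ ¬ I.compat.Adj a b then 1 else 0
  | .inr _, .inl _ => 1
  | _, .inr _ => 0

/-- The parameters of the network constructed from an instance. -/
noncomputable abbrev layout : Layout where
  numV := I.numV
  numA := I.numA
  tl := I.tail
  hd := I.head
  s := I.s
  t := I.t
  ext := I.k - 1
  cols := I.width + 1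
  rows := 2 * (I.width + 1)
  W := I.numA
  lk := I.linked
  coef l j b := (rowCoef I.demand.num I.demand.den (I.width + 1) l j b).toNat
  rhs l := rowRhs I.demand.num I.demand.den (I.width + 1) I.numA l

theorem layout_valid : I.layout.Valid where
  ext_lt := by have := I.one_le_k; have := I.k_le; show I.k - 1 < I.numA; omega
  cols_pos := Nat.succ_pos _
  lk_le := by
    rintro (a | a) (b | b) <;> simp only [linked] <;> first | omega | (split_ifs <;> omega)
  lk_self := by rintro (a | a) <;> simp [linked]
  lk_inr := by rintro (a | a) e <;> simp [linked]
  lk_inr_inl _ _ := rfl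
  coef_le _ _ _ := Bool.toNat_le _

theorem num_lt : I.demand.num < 2 ^ I.width := Nat.size_le.1 (le_max_left _ _)

theorem den_lt : I.demand.den < 2 ^ I.width := Nat.size_le.1 (le_max_right _ _)

theorem rhs_le (l) : I.layout.rhs l ≤ I.layout.W * I.layout.cols + 1 := by
  have : ∑ i ∈ Finset.range (I.width + 1),
      (rowCoef I.demand.num I.demand.den (I.width + 1) l i true).toNat ≤ I.width + 1 := by
    simpa using Finset.sum_le_sum (s := Finset.range (I.width + 1)) fun i _ =>
      Bool.toNat_le (rowCoef I.demand.num I.demand.den (I.width + 1) l i true)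
  have := Nat.mul_le_mul_left I.numA this
  simp only [rowRhs]
  split_ifs <;> omega

theorem walk_iff (D : FinDigraph) {v w : Fin D.numV} {l : List (Fin D.numA)} :
    D.IsWalk v l w ↔ Walk D.tail D.head v l w := by
  induction l generalizing v with
  | nil => rfl
  | cons a l ih => simp only [FinDigraph.IsWalk, Walk, ih]

theorem isPath_iff (D : FinDigraph) {v w : Fin D.numV} {P : Finset (Fin D.numA)} :
    D.IsPath v w P ↔ SimplePath D.tail D.head v w P := by
  simp only [FinDigraph.IsPath, SimplePath, walk_iff]

theorem stPaths_eq : I.stPaths = I.layout.stPaths := by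
  ext P
  rw [Layout.mem_stPaths]
  simp only [stPaths, FinDigraph.paths, Finset.mem_filter, Finset.mem_univ, true_and, isPath_iff]

/-- `y / N` is a solution of the instance. -/
structure Scaled (N : ℕ) (y : Finset (Fin I.numA) → ℕ) : Prop where
  cap_le : ∀ a, ∑ Q ∈ I.stPaths with a ∈ Q, y Q ≤ N
  dem_eq : I.demand.den * ∑ Q ∈ I.stPaths, y Q = N * I.demand.num
  loss_le : ∀ S : Finset (Fin I.numA), S.card = I.k → I.compat.IsClique (S : Set (Fin I.numA)) →
    ∑ Q ∈ I.stPaths with (Q ∩ S).Nonempty, y Q + N ≤ N * I.k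

variable {I}

theorem clique_iff {S : Finset (Fin I.numA)} :
    (∀ a ∈ S, ∀ b ∈ S, a ≠ b → I.layout.lk (.inl a) (.inl b) = 0) ↔
      I.compat.IsClique (S : Set (Fin I.numA)) := by
  simp only [SimpleGraph.isClique_iff, Set.Pairwise, Finset.mem_coe]
  refine forall_congr' fun a => forall_congr' fun _ => forall_congr' fun b => forall_congr' fun _ =>
    forall_congr' fun h => ?_
  simp [linked, h]

/-- A coefficient on the chain `true` contributes the flow on the other chain, `N W - V j`. Its
constant part cancels against the right-hand side of the row and `V j` moves to the other side with
positive sign. -/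
theorem sum_coef {g : Fin (I.width + 1) → Bool → ℕ} {N : ℕ} {V : ℕ → ℕ}
    (hV : ∀ j : Fin (I.width + 1), g j true = V j) (hg : ∀ j, g j true + g j false = N * I.numA)
    (l : Fin (2 * (I.width + 1) + 1)) (t : ℕ) :
    N * I.layout.rhs l ≤ ∑ j, ∑ b, I.layout.coef l j b * g j (!b) + (if l = 0 then t else 0) ↔
      RowHolds I.demand.num I.demand.den I.width V N t l := by
  have h₁ := rowRhs_add (num := I.demand.num) (l := l) I.den_lt I.demand.den_pos
    (W := I.numA) (I.one_le_k.trans I.k_le)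
  have h₂ : ∑ j, ∑ b, I.layout.coef l j b * g j (!b) + ∑ i ∈ Finset.range (I.width + 1),
      (rowCoef I.demand.num I.demand.den (I.width + 1) l i true).toNat * V i =
      N * (I.numA * ∑ i ∈ Finset.range (I.width + 1),
        (rowCoef I.demand.num I.demand.den (I.width + 1) l i true).toNat) +
      ∑ i ∈ Finset.range (I.width + 1),
        (rowCoef I.demand.num I.demand.den (I.width + 1) l i false).toNat * V i := by
    simp only [Finset.sum_range, ← hV]
    rw [← mul_assoc, Finset.mul_sum, ← Finset.sum_add_distrib, ← Finset.sum_add_distrib]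
    refine Finset.sum_congr rfl fun j _ => ?_
    rw [← hg j]
    simp only [Fintype.sum_bool, Bool.not_true, Bool.not_false]
    ring
  have h₃ : N * I.layout.rhs l + (if (l : ℕ) = I.width + 2 then N else 0) =
      N * (I.numA * ∑ i ∈ Finset.range (I.width + 1),
        (rowCoef I.demand.num I.demand.den (I.width + 1) l i true).toNat) +
        if (l : ℕ) = 1 then N else 0 := by
    have := congrArg (N * ·) h₁
    simpa only [mul_add, mul_ite, mul_one, mul_zero] using this
  have h₄ : (l = 0) ↔ ((l : ℕ) = 0) := Fin.ext_iff
  dsimp only at h₂ h₃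
  simp only [RowHolds, h₄]
  omega

theorem exists_of_sol {N : ℕ} {z : Finset I.layout.Arc → ℕ} (hz : I.layout.inst.Sol N z) :
    ∃ y, I.Scaled N y := by
  obtain ⟨y, g, h₁, h₂, h₃, h₄⟩ := Layout.exists_of_sol I.layout_valid hz
  let V : ℕ → ℕ := fun i => if h : i < I.width + 1 then g ⟨i, h⟩ true else 0
  have hV : ∀ j : Fin (I.width + 1), g j true = V j := fun j => by simp only [V, j.2, dif_pos, Fin.eta]
  obtain ⟨k₁, k₂⟩ := of_rowHolds (V := V) (N := N) (t := ∑ Q ∈ I.layout.stPaths, y Q)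
    I.num_lt I.den_lt fun l hl => (sum_coef hV h₃ ⟨l, hl⟩ _).1 (h₄ ⟨l, hl⟩)
  -- The rows only give a flow of at least the demanded value. Lowering it keeps the capacity and
  -- loss bounds.
  obtain ⟨y', l₁, l₂⟩ := exists_le_sum_eq _ _ k₂
  refine ⟨y', fun a => ?_, ?_, fun S hS hc => ?_⟩
  · rw [stPaths_eq]
    exact (Finset.sum_le_sum fun Q _ => l₁ Q).trans (h₁ a)
  · rw [stPaths_eq, l₂, ← k₁]; ring
  · have hk := I.one_le_k
    have := h₂ S (by show S.card = I.k - 1 + 1; omega) (clique_iff.2 hc)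
    have e : I.layout.ext + 1 = I.k := by show I.k - 1 + 1 = I.k; omega
    rw [e] at this
    rw [stPaths_eq]
    exact (Nat.add_le_add_right (Finset.sum_le_sum fun Q _ => l₁ Q) N).trans this

theorem Scaled.sum_le {N : ℕ} {y : Finset (Fin I.numA) → ℕ} (h : I.Scaled N y) :
    ∑ Q ∈ I.stPaths, y Q ≤ N * I.numA := by
  have h₁ := Inst.loss_le_sum I.stPaths y Finset.univ
  rw [Finset.filter_true_of_mem] at h₁
  · refine h₁.trans ((Finset.sum_le_sum fun a _ => h.cap_le a).trans ?_)
    simp [mul_comm]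
  · intro P hP
    rw [stPaths_eq, Layout.mem_stPaths] at hP
    obtain ⟨b, hb, _⟩ := hP.exists_first I.s_ne_t
    exact ⟨b, by simpa using hb⟩

/-- The demand of a YES instance is at most the number of arcs, each path using an arc of unit
capacity. This is why `W = numA` suffices for the columns. -/
theorem Scaled.num_le {N : ℕ} (hN : 0 < N) {y : Finset (Fin I.numA) → ℕ} (h : I.Scaled N y) :
    I.demand.num ≤ I.demand.den * I.numA := by
  refine Nat.le_of_mul_le_mul_left ?_ hN
  rw [← h.dem_eq, mul_left_comm]
  exact Nat.mul_le_mul_left _ h.sum_le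

/-- The denominator grows by the factor `den`, so that the first column, which has to carry `1 /
den`, becomes the natural number `N`. -/
theorem Scaled.exists_sol {N : ℕ} (hN : 0 < N) {y : Finset (Fin I.numA) → ℕ} (h : I.Scaled N y) :
    ∃ z, I.layout.inst.Sol (N * I.demand.den) z := by
  have hm : 1 ≤ I.numA := I.one_le_k.trans I.k_le
  have hden := I.demand.den_pos
  set V : ℕ → ℕ := fun i => if i = 0 then N else 2 ^ (i - 1) * N with hVdef
  have hV : ∀ i, 1 ≤ i → V i = 2 ^ (i - 1) * V 0 := fun i hi => by
    have : i ≠ 0 := by omega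
    simp [V, this]
  have hnum := h.num_le hN
  -- The largest power of two that occurs is at most the numerator or the denominator, by the choice
  -- of `width`, hence at most `den * numA`.
  have hVle : ∀ i < I.width + 1, V i ≤ N * I.demand.den * I.numA := by
    intro i hi
    have h1 : 1 ≤ I.demand.den * I.numA := Nat.mul_pos hden hm
    have : ∀ x, x ≤ I.demand.den * I.numA → x * N ≤ N * I.demand.den * I.numA := fun x hx => by
      rw [mul_comm, mul_assoc]; exact Nat.mul_le_mul_left _ hx
    simp only [V]
    split_ifs with h0
    · simpa using this 1 h1
    · refine this _ ?_
      have hw : i - 1 < I.width := by omega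
      rcases lt_max_iff.1 hw with hw | hw
      · exact (Nat.lt_size.1 hw).trans hnum
      · exact (Nat.lt_size.1 hw).trans (Nat.le_mul_of_pos_right _ hm)
  set g : Fin (I.width + 1) → Bool → ℕ := fun j b =>
    if b then V j else N * I.demand.den * I.numA - V j with hg
  have hsum : ∀ j, g j true + g j false = N * I.demand.den * I.numA := fun j => by
    have := hVle j j.2
    simp only [hg, if_true, Bool.false_eq_true, if_false]; omega
  have htot : ∑ Q ∈ I.layout.stPaths, I.demand.den * y Q = I.demand.num * N := by
    rw [← Finset.mul_sum, ← stPaths_eq, h.dem_eq, mul_comm]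
  have hrow := fun l : Fin (2 * (I.width + 1) + 1) =>
    (sum_coef (V := V) (g := g) (fun j => by simp [hg]) hsum l (I.demand.num * N)).2
      (rowHolds I.num_lt I.den_lt hV (by simp [V, mul_comm]) (by simp [V]) l.2)
  -- If the demand is positive, its numerator has a nonzero bit, so `rhs 0` is at least `numA` and
  -- the arcs `toOrig` and `fromOrig` are wide enough for the `s`-`t` flow.
  have htot' : I.demand.num * N ≤ N * I.demand.den * I.layout.rhs 0 := by
    rcases Nat.eq_zero_or_pos I.demand.num with h0 | h0
    · simp [h0]
    have : I.numA ≤ I.layout.rhs 0 := by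
      have := rowRhs_add (num := I.demand.num) (l := 0) I.den_lt hden (W := I.numA) hm
      have k := one_le_sum_testBit I.num_lt h0
      have k' := sum_bits (n := I.width) I.demand.num fun _ => 1
      simp only [mul_one] at k'
      simp [rowCoef] at this
      show _ ≤ rowRhs _ _ _ _ 0
      rw [this, k']
      exact Nat.le_mul_of_pos_right _ k
    rw [mul_comm, mul_assoc]
    exact Nat.mul_le_mul_left _ (hnum.trans (Nat.mul_le_mul_left _ this))
  -- The row inequality says that the chains offer enough room for the part of the row's demand not
  -- covered by the `s`-`t` flow.
  have hr : ∀ l, ∃ r : Fin (I.width + 1) × Bool → ℕ,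
      (∀ x, r x ≤ I.layout.coef l x.1 x.2 * g x.1 (!x.2)) ∧
      ∑ x, r x = N * I.demand.den * I.layout.rhs l - if l = 0 then I.demand.num * N else 0 := by
    intro l
    refine exists_le_sum_eq Finset.univ (fun x : Fin (I.width + 1) × Bool => I.layout.coef l x.1 x.2 * g x.1 (!x.2)) ?_
    have := hrow l
    rw [Fintype.sum_prod_type]
    dsimp only at this ⊢
    omega
  choose r hr₁ hr₂ using hr
  have hd : I.layout.FlowData (N * I.demand.den) (fun Q => I.demand.den * y Q)
      (fun x => r x.1 x.2) g := by
    refine ⟨fun a => ?_, fun S hS hc => ?_, ?_, hsum, fun x => hr₁ _ _, fun l => ?_⟩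
    · rw [← Finset.mul_sum, ← stPaths_eq, mul_comm N]
      exact Nat.mul_le_mul_left _ (h.cap_le a)
    · have hk := I.one_le_k
      have e : I.layout.ext + 1 = I.k := by show I.k - 1 + 1 = I.k; omega
      rw [e] at hS ⊢
      rw [← Finset.mul_sum, ← stPaths_eq, mul_comm N, ← mul_add, mul_assoc]
      exact Nat.mul_le_mul_left _ (h.loss_le S hS (clique_iff.1 hc))
    · rw [htot]; exact htot'
    · rw [htot, ← Fintype.sum_prod_type (f := fun x => r l x), hr₂]
      split_ifs with h0
      · subst h0; omega
      · rfl
  exact hd.exists_sol I.layout_valid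

/-- An integral flow has integral value, so in the integral case the scaling by `den` changes
nothing. -/
theorem Scaled.den_eq_one {y : Finset (Fin I.numA) → ℕ} (h : I.Scaled 1 y) :
    I.demand.den = 1 := by
  have := h.dem_eq
  rw [one_mul] at this
  exact Nat.Coprime.eq_one_of_dvd I.demand.coprime_num_den.symm ⟨_, this.symm⟩

end MRFR

/-! ### Polynomial-time computable functions between encoded types -/

/-- A type with an encoding of its elements as trees. -/
class Enc (α : Type) where
  /-- The encoding. -/
  enc : α → Data

open RobustFlow.Enc (enc)

instance : Enc Unit := ⟨fun _ => .nil⟩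
instance : Enc Bool := ⟨Data.ofBool⟩
instance : Enc ℕ := ⟨Data.ofNatUnary⟩
instance {α β : Type} [Enc α] [Enc β] : Enc (α × β) := ⟨fun x => .node (enc x.1) (enc x.2)⟩
instance {α : Type} [Enc α] : Enc (List α) := ⟨fun l => Data.ofList (l.map enc)⟩

/-- The size of the encoding. -/
def sz {α : Type} [Enc α] (a : α) : ℕ := (enc a).size

/-- Computability in polynomial time with respect to the encodings. -/
@[fun_prop]
def PolyT {α β : Type} [Enc α] [Enc β] (f : α → β) : Prop :=
  ComputableInPolyTime (enc : α → Data) (enc : β → Data) f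

theorem Data.size_pos (v : Data) : 0 < v.size := by cases v <;> simp [Data.size]

theorem Data.size_fst_le (v : Data) : v.fst.size ≤ v.size := by
  cases v <;> simp [Data.fst, Data.size]; omega

theorem Data.size_snd_le (v : Data) : v.snd.size ≤ v.size := by
  cases v <;> simp [Data.snd, Data.size]; omega

theorem Runs.size_le {p : Prog} {v w : Data} {c : ℕ} (h : Runs p v w c) : w.size ≤ c := by
  induction h with
  | id v => rfl
  | nil v => exact v.size_pos
  | fst v => exact v.size_fst_le
  | snd v => exact v.size_snd_le
  | pair _ _ h₁ h₂ => have := Data.size_pos; rename_i v _ _ _ _ _ _; have := this v; simp only [Data.size]; omega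
  | seq => omega
  | ite_true => omega
  | ite_false => omega
  | while_true => omega
  | while_false => omega

theorem eval_mono (p : Polynomial ℕ) {m n : ℕ} (h : m ≤ n) : p.eval m ≤ p.eval n := by
  rw [Polynomial.eval_eq_sum_range, Polynomial.eval_eq_sum_range]
  exact Finset.sum_le_sum fun i _ => Nat.mul_le_mul_left _ (Nat.pow_le_pow_left h i)

section

variable {α β γ σ : Type} [Enc α] [Enc β] [Enc γ] [Enc σ]

theorem sz_pos (a : α) : 0 < sz a := Data.size_pos _

@[simp] theorem sz_pair (x : α × β) : sz x = sz x.1 + sz x.2 + 1 := rfl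
@[simp] theorem sz_nil : sz ([] : List α) = 1 := rfl
@[simp] theorem sz_cons (a : α) (l : List α) : sz (a :: l) = sz a + sz l + 1 := rfl

theorem sz_append (l l' : List α) : sz (l ++ l') + 1 = sz l + sz l' := by
  induction l with
  | nil => simp; omega
  | cons a l ih => simp; omega

theorem sz_mem {a : α} {l : List α} (h : a ∈ l) : sz a ≤ sz l := by
  induction l with
  | nil => cases h
  | cons b l ih =>
    rcases List.mem_cons.1 h with rfl | h
    · simp; omega
    · have := ih h; simp; omega

theorem length_lt_sz (l : List α) : l.length < sz l := by
  induction l with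
  | nil => simp
  | cons b l ih => have := sz_pos b; simp; omega

theorem sz_sublist {l l' : List α} (h : l.Sublist l') : sz l ≤ sz l' := by
  induction h with
  | slnil => rfl
  | cons => simp; omega
  | cons_cons => simp; omega

theorem sz_list_le {l : List α} {B : ℕ} (h : ∀ a ∈ l, sz a ≤ B) : sz l ≤ l.length * (B + 1) + 1 := by
  induction l with
  | nil => simp
  | cons b l ih =>
    have h₁ := h b (by simp)
    have h₂ := ih fun a ha => h a (by simp [ha])
    simp only [sz_cons, List.length_cons, add_mul]
    omega

@[simp] theorem sz_nat (n : ℕ) : sz n = 2 * n + 1 := by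
  induction n with
  | zero => rfl
  | succ n ih => 
    have : sz (n + 1) = sz (()) + sz n + 1 := by
      simp [sz, enc, Data.ofNatUnary, List.replicate_succ, Data.ofList, Data.size]
    rw [this, ih, show sz () = 1 from rfl]; ring

theorem PolyT.of_prog {f : α → β} (prog : Prog) (p : Polynomial ℕ)
    (h : ∀ a, ∃ c, Runs prog (enc a) (enc (f a)) c ∧ c ≤ p.eval (sz a)) : PolyT f := ⟨prog, p, h⟩

/-- A function that does not change the encoding. -/
theorem PolyT.of_enc_eq {f : α → β} (h : ∀ a, enc (f a) = enc a) : PolyT f :=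
  .of_prog .id .X fun a => ⟨_, by rw [h]; exact .id _, by simp [sz]⟩

theorem PolyT.sz_le {f : α → β} (hf : PolyT f) :
    ∃ p : Polynomial ℕ, ∀ a, sz (f a) ≤ p.eval (sz a) := by
  obtain ⟨_, p, h⟩ := hf
  exact ⟨p, fun a => by obtain ⟨c, h₁, h₂⟩ := h a; exact h₁.size_le.trans h₂⟩

@[fun_prop]
theorem PolyT.id : PolyT fun a : α => a := .of_enc_eq fun _ => rfl

theorem exists_runs_const (w : Data) : ∃ (prog : Prog) (p : Polynomial ℕ), ∀ v, ∃ c,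
    Runs prog v w c ∧ c ≤ p.eval v.size := by
  induction w with
  | nil => exact ⟨.nil, .X, fun v => ⟨_, .nil v, by simp⟩⟩
  | node a b iha ihb =>
    obtain ⟨pa, qa, ha⟩ := iha
    obtain ⟨pb, qb, hb⟩ := ihb
    refine ⟨.pair pa pb, .X + qa + qb, fun v => ?_⟩
    obtain ⟨c, h₁, h₂⟩ := ha v
    obtain ⟨d, h₃, h₄⟩ := hb v
    exact ⟨_, .pair h₁ h₃, by simp; omega⟩

@[fun_prop]
theorem PolyT.const (b : β) : PolyT fun _ : α => b := by
  obtain ⟨prog, p, h⟩ := exists_runs_const (enc b)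
  exact ⟨prog, p, fun a => h _⟩

@[fun_prop]
theorem PolyT.comp {g : β → γ} {f : α → β} (hg : PolyT g) (hf : PolyT f) :
    PolyT fun a => g (f a) := by
  obtain ⟨pg, qg, hg⟩ := hg
  obtain ⟨pf, qf, hf⟩ := hf
  refine .of_prog (.seq pf pg) (.X + qf + qg.comp qf) fun a => ?_
  obtain ⟨c, h₁, h₂⟩ := hf a
  obtain ⟨d, h₃, h₄⟩ := hg (f a)
  refine ⟨_, .seq h₁ h₃, ?_⟩
  have := eval_mono qg (h₁.size_le.trans h₂)
  simp only [Polynomial.eval_add, Polynomial.eval_X, Polynomial.eval_comp, sz]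
  omega

@[fun_prop]
theorem PolyT.mk {f : α → β} {g : α → γ} (hf : PolyT f) (hg : PolyT g) :
    PolyT fun a => (f a, g a) := by
  obtain ⟨pg, qg, hg⟩ := hg
  obtain ⟨pf, qf, hf⟩ := hf
  refine .of_prog (.pair pf pg) (.X + qf + qg) fun a => ?_
  obtain ⟨c, h₁, h₂⟩ := hf a
  obtain ⟨d, h₃, h₄⟩ := hg a
  refine ⟨_, .pair h₁ h₃, ?_⟩
  simp only [Polynomial.eval_add, Polynomial.eval_X, sz]
  omega

@[fun_prop]
theorem PolyT.fst {f : α → β × γ} (hf : PolyT f) : PolyT fun a => (f a).1 :=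
  .comp (g := Prod.fst) (.of_prog .fst .X fun a => ⟨_, .fst _, by simp [sz]⟩) hf

@[fun_prop]
theorem PolyT.snd {f : α → β × γ} (hf : PolyT f) : PolyT fun a => (f a).2 :=
  .comp (g := Prod.snd) (.of_prog .snd .X fun a => ⟨_, .snd _, by simp [sz]⟩) hf

@[fun_prop]
theorem PolyT.cond {c : α → Bool} {f g : α → β} (hc : PolyT c) (hf : PolyT f) (hg : PolyT g) :
    PolyT fun a => bif c a then f a else g a := by
  obtain ⟨pc, qc, hc⟩ := hc
  obtain ⟨pg, qg, hg⟩ := hg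
  obtain ⟨pf, qf, hf⟩ := hf
  refine .of_prog (.ite pc pf pg) (.X + qc + qf + qg) fun a => ?_
  obtain ⟨b, h₁, h₂⟩ := hc a
  obtain ⟨e, h₃, h₄⟩ := hf a
  obtain ⟨d, h₅, h₆⟩ := hg a
  cases h : c a <;> rw [h] at h₁
  · refine ⟨_, .ite_false h₁ h₅, ?_⟩
    simp only [Polynomial.eval_add, Polynomial.eval_X, sz]
    omega
  · refine ⟨_, .ite_true h₁ h₃, ?_⟩
    simp only [Polynomial.eval_add, Polynomial.eval_X, sz]
    omega

/-- The body of the loop that computes a fold. -/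
def foldBody (ps : Prog) : Prog :=
  .pair .fst (.pair (.seq (.seq .snd .fst) .snd)
    (.seq (.pair .fst (.pair (.seq .snd .snd) (.seq (.seq .snd .fst) .fst))) ps))

theorem runs_foldBody {ps : Prog} {q : Polynomial ℕ} {step : α → σ → β → σ}
    (hs : ∀ x : α × σ × β, ∃ c, Runs ps (enc x) (enc (step x.1 x.2.1 x.2.2)) c ∧
      c ≤ q.eval (sz x)) (a : α) (x : β) (l : List β) (s : σ) :
    ∃ c, Runs (foldBody ps) (enc (a, x :: l, s)) (enc (a, l, step a s x)) c ∧
      c ≤ 30 * sz (a, x :: l, s) + q.eval (sz (a, x :: l, s)) := by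
  obtain ⟨c, h₁, h₂⟩ := hs (a, s, x)
  refine ⟨_, .pair (.fst _) (.pair (.seq (.seq (.snd _) (.fst _)) (.snd _))
    (.seq (.pair (.fst _) (.pair (.seq (.snd _) (.snd _)) (.seq (.seq (.snd _) (.fst _)) (.fst _))))
      h₁)), ?_⟩
  have h₃ : c ≤ q.eval (sz (a, x :: l, s)) := h₂.trans (eval_mono q (by simp; omega))
  refine le_trans ?_ (Nat.add_le_add_left h₃ _)
  have e : enc (a, x :: l, s) = .node (enc a) (.node (.node (enc x) (enc l)) (enc s)) := rfl
  simp only [sz, e, Data.fst, Data.snd, Data.size]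
  omega

/-- The loop state is parameter, remaining list and accumulator. A bound `B` on all intermediate
states bounds the cost of every round; the constant 40 generously covers the bookkeeping. -/
theorem runs_fold {ps : Prog} {q : Polynomial ℕ} {step : α → σ → β → σ}
    (hs : ∀ x : α × σ × β, ∃ c, Runs ps (enc x) (enc (step x.1 x.2.1 x.2.2)) c ∧
      c ≤ q.eval (sz x)) (a : α) (B : ℕ) (l : List β) (s : σ)
    (hB : ∀ l₁ l₂, l = l₁ ++ l₂ → sz (a, l₂, l₁.foldl (step a) s) ≤ B) :
    ∃ c, Runs (.while (.seq .snd .fst) (foldBody ps)) (enc (a, l, s))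
      (enc (a, ([] : List β), l.foldl (step a) s)) c ∧
      c ≤ (l.length + 1) * (40 * B + q.eval B) := by
  induction l generalizing s with
  | nil =>
    refine ⟨_, .while_false (c := sz (a, ([] : List β), s) + sz (a, ([] : List β), s) +
      sz (([] : List β), s)) (.seq (.snd _) (.fst _)), ?_⟩
    have := hB [] [] rfl
    have e : (enc (a, ([] : List β), s)).size = sz (a, ([] : List β), s) := rfl
    simp only [List.foldl_nil, sz_pair, sz_nil] at this e ⊢
    simp only [List.length_nil, zero_add, one_mul, e]
    omega
  | cons x l ih =>
    obtain ⟨c, h₁, h₂⟩ := runs_foldBody hs a x l s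
    obtain ⟨d, h₃, h₄⟩ := ih (step a s x) fun l₁ l₂ h => hB (x :: l₁) l₂ (by simp [h])
    refine ⟨_, .while_true (c := sz (a, x :: l, s) + sz (a, x :: l, s) +
      sz (x :: l, s)) (.seq (.snd _) (.fst _)) h₁ h₃, ?_⟩
    have h₅ := hB [] (x :: l) rfl
    have h₆ := eval_mono q h₅
    have e : (enc (a, x :: l, s)).size = sz (a, x :: l, s) := rfl
    have e' : sz (x :: l, s) ≤ sz (a, x :: l, s) := by rw [sz_pair (a, x :: l, s)]; simp only; omega
    rw [List.length_cons, add_mul (l.length + 1), one_mul]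
    simp only [List.foldl_nil] at h₅ h₆
    rw [e]
    omega

/-- A polynomial-time step does not suffice, since repeated steps could blow up the accumulator;
hence the bound `B` on all partial folds. -/
theorem PolyT.foldl {l : α → List β} {init : α → σ} {step : α → σ → β → σ} (hl : PolyT l)
    (hi : PolyT init) (hs : PolyT fun x : α × σ × β => step x.1 x.2.1 x.2.2)
    (B : Polynomial ℕ)
    (hB : ∀ a l₁ l₂, l a = l₁ ++ l₂ → sz (l₁.foldl (step a) (init a)) ≤ B.eval (sz a)) :
    PolyT fun a => (l a).foldl (step a) (init a) := by
  obtain ⟨b, hb⟩ := hl.sz_le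
  obtain ⟨ps, q, hs⟩ := hs
  have hi' := PolyT.mk PolyT.id (hl.mk hi)
  obtain ⟨pi, r, hi'⟩ := hi'
  have key : PolyT fun a => (a, ([] : List β), (l a).foldl (step a) (init a)) := by
    refine .of_prog (.seq pi (.while (.seq .snd .fst) (foldBody ps)))
      (.X + r + (b + 1) * (40 * (.X + b + B + 2) + q.comp (.X + b + B + 2))) fun a => ?_
    obtain ⟨c, h₁, h₂⟩ := hi' a
    obtain ⟨d, h₃, h₄⟩ := runs_fold hs a (sz a + b.eval (sz a) + B.eval (sz a) + 2) (l a) (init a)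
      fun l₁ l₂ h => by
        have h₅ := hB a l₁ l₂ h
        have h₆ := (sz_sublist (l := l₂) (l' := l a) (by rw [h]; simp)).trans (hb a)
        simp only [sz_pair]
        omega
    refine ⟨_, .seq h₁ h₃, ?_⟩
    have h₅ : (l a).length + 1 ≤ b.eval (sz a) + 1 := by
      have := length_lt_sz (l a); have := hb a; omega
    have h₆ := Nat.mul_le_mul_right
      (40 * (sz a + b.eval (sz a) + B.eval (sz a) + 2) +
        q.eval (sz a + b.eval (sz a) + B.eval (sz a) + 2)) h₅
    have h₇ : (enc a).size = sz a := rfl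
    simp only [Polynomial.eval_add, Polynomial.eval_X, Polynomial.eval_comp, Polynomial.eval_mul,
      Polynomial.eval_one, Polynomial.eval_ofNat]
    replace h₂ : c ≤ r.eval (sz a) := h₂
    rw [h₇]
    omega
  exact key.snd.snd

/-- Folding when each step increases the size by a bounded amount. -/
theorem PolyT.foldl_of_add {l : α → List β} {init : α → σ} {step : α → σ → β → σ} (hl : PolyT l)
    (hi : PolyT init) (hs : PolyT fun x : α × σ × β => step x.1 x.2.1 x.2.2)
    (B : Polynomial ℕ)
    (hB : ∀ a s, ∀ x ∈ l a, sz (step a s x) ≤ sz s + B.eval (sz a)) :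
    PolyT fun a => (l a).foldl (step a) (init a) := by
  obtain ⟨b, hb⟩ := hl.sz_le
  obtain ⟨i, hi'⟩ := hi.sz_le
  refine PolyT.foldl hl hi hs (i + b * B) fun a l₁ l₂ h => ?_
  have key : ∀ l' : List β, (∀ x ∈ l', x ∈ l a) → ∀ s,
      sz (l'.foldl (step a) s) ≤ sz s + l'.length * B.eval (sz a) := by
    intro l'
    induction l' with
    | nil => intro _ s; simp
    | cons x l' ih =>
      intro hm s
      have h₁ := hB a s x (hm x (by simp))
      have h₂ := ih (fun y hy => hm y (by simp [hy])) (step a s x)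
      rw [List.foldl_cons, List.length_cons, add_mul]
      omega
  have h₁ := key l₁ (fun x hx => by rw [h]; simp [hx]) (init a)
  have h₂ : l₁.length ≤ b.eval (sz a) := by
    have h₃ := length_lt_sz (l a)
    have h₄ := hb a
    rw [h, List.length_append] at h₃
    rw [h] at h₄
    omega
  have h₃ := Nat.mul_le_mul_right (B.eval (sz a)) h₂
  have h₄ := hi' a
  simp only [Polynomial.eval_add, Polynomial.eval_mul]
  omega

end


/-! ### Polynomial-time operations on lists and numbers -/

open RobustFlow.Enc (enc)

section

variable {α β γ σ : Type} [Enc α] [Enc β] [Enc γ] [Enc σ]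

@[fun_prop]
theorem PolyT.cons {f : α → β} {g : α → List β} (hf : PolyT f) (hg : PolyT g) :
    PolyT fun a => f a :: g a :=
  .comp (g := fun x : β × List β => x.1 :: x.2) (.of_enc_eq fun _ => rfl) (hf.mk hg)

@[fun_prop]
theorem PolyT.reverse {f : α → List β} (hf : PolyT f) : PolyT fun a => (f a).reverse := by
  refine .comp (g := List.reverse) ?_ hf
  have : (List.reverse : List β → List β) = fun l => l.foldl (fun s x => x :: s) [] := by
    funext l; simp
  rw [this]
  refine .foldl_of_add .id (.const _) (by fun_prop) (.X + 1) fun a s x hx => ?_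
  have := sz_mem hx
  simp; omega

/-- Prepending builds the image in reverse order; together with `reverse` this yields `append` and
`map`. -/
theorem PolyT.foldl_cons {l : α → List β} {i : α → List γ} {f : α → β → γ} (hl : PolyT l)
    (hi : PolyT i) (hf : PolyT fun x : α × β => f x.1 x.2) :
    PolyT fun a => (l a).foldl (fun s x => f a x :: s) (i a) := by
  obtain ⟨p, hp⟩ := hf.sz_le
  obtain ⟨b, hb⟩ := hl.sz_le
  refine .foldl_of_add hl hi ?_ (p.comp (.X + b + 1) + 1) fun a s x hx => ?_
  · exact .cons (hf.comp (f := fun x : α × List γ × β => (x.1, x.2.2)) (by fun_prop)) (by fun_prop)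
  · have h₁ := (sz_mem hx).trans (hb a)
    have h₂ := (hp (a, x)).trans (eval_mono p (show _ ≤ sz a + b.eval (sz a) + 1 by simp; omega))
    simp only [sz_cons, Polynomial.eval_add, Polynomial.eval_X, Polynomial.eval_comp,
      Polynomial.eval_one]
    dsimp only at h₂
    omega

@[fun_prop]
theorem PolyT.append {f g : α → List β} (hf : PolyT f) (hg : PolyT g) :
    PolyT fun a => f a ++ g a := by
  have := PolyT.foldl_cons (f := fun _ x => x) hf.reverse hg (by fun_prop)
  simpa using this

@[fun_prop]
theorem PolyT.map {l : α → List β} {f : α → β → γ} (hl : PolyT l)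
    (hf : PolyT fun x : α × β => f x.1 x.2) : PolyT fun a => (l a).map (f a) := by
  have := (PolyT.foldl_cons hl (.const []) hf).reverse
  simpa using this

@[fun_prop]
theorem PolyT.flatMap {l : α → List β} {f : α → β → List γ} (hl : PolyT l)
    (hf : PolyT fun x : α × β => f x.1 x.2) : PolyT fun a => (l a).flatMap (f a) := by
  obtain ⟨p, hp⟩ := hf.sz_le
  obtain ⟨b, hb⟩ := hl.sz_le
  have key : PolyT fun a => (l a).foldl (fun s x => s ++ f a x) [] := by
    refine .foldl_of_add hl (.const _) ?_ (p.comp (.X + b + 1)) fun a s x hx => ?_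
    · exact .append (by fun_prop) (hf.comp (f := fun x : α × List γ × β => (x.1, x.2.2)) (by fun_prop))
    · have h₁ := (sz_mem hx).trans (hb a)
      have h₂ := (hp (a, x)).trans (eval_mono p (show _ ≤ sz a + b.eval (sz a) + 1 by simp; omega))
      have h₃ := sz_append s (f a x)
      simp only [Polynomial.eval_add, Polynomial.eval_X, Polynomial.eval_comp, Polynomial.eval_one]
      dsimp only at h₂
      omega
  have e : ∀ a, (l a).foldl (fun s x => s ++ f a x) [] = (l a).flatMap (f a) := fun a => by
    have : ∀ (l : List β) (s : List γ), l.foldl (fun s x => s ++ f a x) s = s ++ l.flatMap (f a) := by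
      intro l
      induction l with
      | nil => simp
      | cons x l ih => intro s; simp [ih]
    simpa using this (l a) []
  simpa only [e] using key

/-! #### Unary numbers -/

@[fun_prop]
theorem PolyT.replicate_unit {f : α → ℕ} (hf : PolyT f) :
    PolyT fun a => List.replicate (f a) () :=
  .comp (g := fun n => List.replicate n ()) (.of_enc_eq fun n => by
    simp [enc, Data.ofNatUnary]) hf

@[fun_prop]
theorem PolyT.length {f : α → List β} (hf : PolyT f) : PolyT fun a => (f a).length := by
  have h : PolyT fun l : List Unit => l.length := .of_enc_eq fun l => by
    simp only [enc, Data.ofNatUnary]; congr 1; induction l <;> simp_all [List.replicate_succ]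
  simpa using h.comp (f := fun a => (f a).map fun _ => ()) (by fun_prop)

/-- A unary number is encoded as a list of that length, so arithmetic reduces to list operations:
`append` for sums, `flatMap` for products, `drop` for differences. -/
theorem PolyT.nat_of_list {f : α → ℕ} {g : α → List β} (hg : PolyT g)
    (h : ∀ a, (g a).length = f a) : PolyT f := by
  simpa only [h] using hg.length

@[fun_prop]
theorem PolyT.add {f g : α → ℕ} (hf : PolyT f) (hg : PolyT g) : PolyT fun a => f a + g a :=
  .nat_of_list (hf.replicate_unit.append hg.replicate_unit) fun a => by simp

@[fun_prop]
theorem PolyT.mul {f g : α → ℕ} (hf : PolyT f) (hg : PolyT g) : PolyT fun a => f a * g a :=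
  .nat_of_list (hf.replicate_unit.flatMap (f := fun a _ => List.replicate (g a) ())
    (by fun_prop)) fun a => by simp

@[fun_prop]
theorem PolyT.tail {f : α → List β} (hf : PolyT f) : PolyT fun a => (f a).tail := by
  refine .comp (g := List.tail) (.of_prog .snd .X fun l => ⟨_, ?_, by simp; rfl⟩) hf
  cases l <;> exact .snd _

/-- Iteration is a fold over a list of `f a` dummies, affordable because `f a` is in unary. -/
theorem PolyT.foldl_replicate {f : α → ℕ} {init : α → σ} {step : α → σ → σ} (hf : PolyT f)
    (hi : PolyT init) (hs : PolyT fun x : α × σ => step x.1 x.2) (B : Polynomial ℕ)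
    (hB : ∀ a, ∀ n ≤ f a, sz ((step a)^[n] (init a)) ≤ B.eval (sz a)) :
    PolyT fun a => (step a)^[f a] (init a) := by
  have e : ∀ a s n, (List.replicate n ()).foldl (fun s _ => step a s) s = (step a)^[n] s := by
    intro a s n
    induction n generalizing s with
    | zero => rfl
    | succ n ih => simp [List.replicate_succ, ih]
  have := PolyT.foldl (step := fun a s (_ : Unit) => step a s) hf.replicate_unit hi
    (hs.comp (f := fun x : α × σ × Unit => (x.1, x.2.1)) (by fun_prop)) B fun a l₁ l₂ h => by
      obtain ⟨h₁, h₂, h₃⟩ := List.append_eq_replicate_iff.1 h.symm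
      rw [h₂, e]
      exact hB a _ (by omega)
  simpa only [e] using this

@[fun_prop]
theorem PolyT.drop {f : α → ℕ} {g : α → List β} (hf : PolyT f) (hg : PolyT g) :
    PolyT fun a => (g a).drop (f a) := by
  obtain ⟨b, hb⟩ := hg.sz_le
  have e : ∀ n, List.tail^[n] = (List.drop n : List β → List β) := fun n => by
    induction n with
    | zero => rfl
    | succ n ih => rw [Function.iterate_succ', ih]; funext l; simp
  have := PolyT.foldl_replicate (step := fun _ l => l.tail) hf hg (by fun_prop) b fun a n _ => by
    show sz (List.tail^[n] _) ≤ _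
    rw [e]
    exact (sz_sublist (List.drop_sublist _ _)).trans (hb a)
  have e' : ∀ a, (fun l : List β => l.tail)^[f a] = List.tail^[f a] := fun _ => rfl
  simpa only [e', e] using this

@[fun_prop]
theorem PolyT.sub {f g : α → ℕ} (hf : PolyT f) (hg : PolyT g) : PolyT fun a => f a - g a :=
  .nat_of_list (hg.drop hf.replicate_unit) fun a => by simp

@[fun_prop]
theorem PolyT.range {f : α → ℕ} (hf : PolyT f) : PolyT fun a => List.range (f a) := by
  refine .comp (g := List.range) ?_ hf
  have e : ∀ n, (fun s : List ℕ => s.length :: s)^[n] [] = (List.range n).reverse := fun n => by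
    induction n with
    | zero => rfl
    | succ n ih => rw [Function.iterate_succ_apply', ih]; simp [List.range_succ]
  have := PolyT.foldl_replicate (α := ℕ) (f := fun n => n) (init := fun _ => [])
    (step := fun _ s => s.length :: s) (by fun_prop) (by fun_prop) (by fun_prop)
    (.X * (.X + 1) + 1) fun n k hk => by
      rw [e]
      have := sz_list_le (l := (List.range k).reverse) (B := 2 * n + 1) fun a ha => by
        simp at ha; simp; omega
      have h := Nat.mul_le_mul_right (2 * n + 1 + 1) hk
      simp only [List.length_reverse, List.length_range] at this
      simp only [Polynomial.eval_add, Polynomial.eval_X, Polynomial.eval_mul, Polynomial.eval_one,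
        sz_nat]
      nlinarith
  simp only [e] at this
  simpa using this.reverse

/-! #### Tests -/

@[fun_prop]
theorem PolyT.isEmpty {f : α → List β} (hf : PolyT f) : PolyT fun a => (f a).isEmpty := by
  refine .comp (g := List.isEmpty) (.of_prog (.ite .id .nil (.pair .nil .nil))
    (5 * .X) fun l => ?_) hf
  cases l with
  | nil => exact ⟨_, .ite_false (.id _) (.pair (.nil _) (.nil _)), by simp [sz]; omega⟩
  | cons x l => exact ⟨_, .ite_true (.id _) (.nil _), by simp [sz]; omega⟩

@[fun_prop]
theorem PolyT.not {f : α → Bool} (hf : PolyT f) : PolyT fun a => !(f a) := by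
  have := hf.cond (.const false) (.const true)
  refine (funext fun a => ?_ : (fun a => !(f a)) = _) ▸ this
  cases f a <;> rfl

@[fun_prop]
theorem PolyT.and {f g : α → Bool} (hf : PolyT f) (hg : PolyT g) : PolyT fun a => f a && g a := by
  have := hf.cond hg (.const false)
  refine (funext fun a => ?_ : (fun a => f a && g a) = _) ▸ this
  cases f a <;> rfl

@[fun_prop]
theorem PolyT.decide_le {f g : α → ℕ} (hf : PolyT f) (hg : PolyT g) :
    PolyT fun a => decide (f a ≤ g a) := by
  have := (hf.sub hg).replicate_unit.isEmpty
  refine (funext fun a => ?_ : (fun a => decide (f a ≤ g a)) = _) ▸ this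
  rw [Bool.eq_iff_iff]; simp [Nat.sub_eq_zero_iff_le]

@[fun_prop]
theorem PolyT.decide_lt {f g : α → ℕ} (hf : PolyT f) (hg : PolyT g) :
    PolyT fun a => decide (f a < g a) := (hf.add (.const 1)).decide_le hg

@[fun_prop]
theorem PolyT.decide_eq {f g : α → ℕ} (hf : PolyT f) (hg : PolyT g) :
    PolyT fun a => decide (f a = g a) := by
  have := (hf.decide_le hg).and (hg.decide_le hf)
  refine (funext fun a => ?_ : (fun a => decide (f a = g a)) = _) ▸ this
  rw [Bool.eq_iff_iff]; simp [le_antisymm_iff]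

@[fun_prop]
theorem PolyT.toNat {f : α → Bool} (hf : PolyT f) : PolyT fun a => (f a).toNat := by
  have := hf.cond (.const 1) (.const 0)
  refine (funext fun a => ?_ : (fun a => (f a).toNat) = _) ▸ this
  cases f a <;> rfl

@[fun_prop]
theorem PolyT.sum {l : α → List β} {f : α → β → ℕ} (hl : PolyT l)
    (hf : PolyT fun x : α × β => f x.1 x.2) : PolyT fun a => ((l a).map (f a)).sum :=
  .nat_of_list (hl.flatMap (f := fun a x => List.replicate (f a x) ()) (by fun_prop)) fun a => by
    simp [List.length_flatMap]

/-- The first element of a list, with a default value. -/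
theorem PolyT.headD {f : α → List β} (hf : PolyT f) {d : β} (hd : enc d = .nil) :
    PolyT fun a => (f a).headD d := by
  refine .comp (g := fun l : List β => l.headD d) (.of_prog .fst .X fun l => ⟨_, ?_, by simp; rfl⟩) hf
  cases l with
  | nil => exact hd ▸ .fst _
  | cons => exact .fst _

@[fun_prop]
theorem PolyT.getI_bool {f : α → List Bool} {g : α → ℕ} (hf : PolyT f) (hg : PolyT g) :
    PolyT fun a => (f a).getI (g a) := by
  have := PolyT.headD (hg.drop hf) (d := false) rfl
  refine (funext fun a => ?_ : (fun a => (f a).getI (g a)) = _) ▸ this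
  simp [List.getI_eq_getElem?_getD, List.headD_eq_head?_getD]

@[fun_prop]
theorem PolyT.getD_nil {f : α → List (List β)} {g : α → ℕ} (hf : PolyT f) (hg : PolyT g) :
    PolyT fun a => (f a).getD (g a) [] := by
  have := PolyT.headD (hg.drop hf) (d := []) rfl
  refine (funext fun a => ?_ : (fun a => (f a).getD (g a) []) = _) ▸ this
  simp [List.headD_eq_head?_getD]

@[fun_prop]
theorem PolyT.min {f g : α → ℕ} (hf : PolyT f) (hg : PolyT g) :
    PolyT fun a => min (f a) (g a) := by
  have := (hf.decide_le hg).cond hf hg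
  refine (funext fun a => ?_ : (fun a => Min.min (f a) (g a)) = _) ▸ this
  by_cases h : f a ≤ g a <;> simp [h]; omega

@[fun_prop]
theorem PolyT.max {f g : α → ℕ} (hf : PolyT f) (hg : PolyT g) :
    PolyT fun a => max (f a) (g a) := by
  have := (hf.decide_le hg).cond hg hf
  refine (funext fun a => ?_ : (fun a => Max.max (f a) (g a)) = _) ▸ this
  by_cases h : f a ≤ g a <;> simp [h]; omega

/-! #### Binary numbers -/

/-- The successor of a binary number. -/
def incr : List Bool → List Bool
  | [] => [true]
  | false :: l => true :: l
  | true :: l => false :: incr l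

theorem incr_bits (n : ℕ) : incr n.bits = (n + 1).bits := by
  induction n using Nat.binaryRec' with
  | zero => simp [incr]
  | bit b n h ih =>
    rw [Nat.bits_append_bit _ _ h]
    cases b with
    | false => simp [incr, Nat.bit]
    | true =>
      have : Nat.bit true n + 1 = 2 * (n + 1) := by simp [Nat.bit]; ring
      rw [this, Nat.bit0_bits _ (by omega), ← ih, incr]

/-- Written as a fold whose state is the carry and the reversed output; a final carry becomes a new
leading bit. -/
theorem polyT_incr : PolyT incr := by
  have key : PolyT fun l : List Bool => l.foldl
      (fun (s : Bool × List Bool) x => (s.1 && x, (bif s.1 then !x else x) :: s.2)) (true, []) := by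
    have hb : ∀ b : Bool, sz b = 1 ∨ sz b = 3 := fun b => by cases b <;> simp [sz, enc, Data.ofBool, Data.size]
    refine .foldl_of_add .id (.const _) (by fun_prop) 10 fun a s x _ => ?_
    have h₁ := hb (s.1 && x)
    have h₂ := hb (bif s.1 then !x else x)
    simp only [sz_pair, sz_cons, Polynomial.eval_ofNat]
    omega
  have h₂ : PolyT fun s : Bool × List Bool => s.2.reverse ++ (bif s.1 then [true] else []) := by
    fun_prop
  have e : ∀ (l : List Bool) (c : Bool) (o : List Bool),
      (fun s : Bool × List Bool => s.2.reverse ++ (bif s.1 then [true] else []))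
        (l.foldl (fun (s : Bool × List Bool) x =>
          (s.1 && x, (bif s.1 then !x else x) :: s.2)) (c, o)) =
      o.reverse ++ bif c then incr l else l := by
    intro l
    induction l with
    | nil => intro c o; cases c <;> simp [incr]
    | cons x l ih =>
      intro c o
      rw [List.foldl_cons, ih]
      cases c <;> cases x <;> simp [incr]
  have := h₂.comp key
  simp only [e] at this
  simpa using this

@[fun_prop]
theorem PolyT.bits {f : α → ℕ} (hf : PolyT f) : PolyT fun a => (f a).bits := by
  refine .comp (g := Nat.bits) ?_ hf
  have e : ∀ n, incr^[n] [] = n.bits := fun n => by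
    induction n with
    | zero => simp
    | succ n ih => rw [Function.iterate_succ_apply', ih, incr_bits]
  have := PolyT.foldl_replicate (α := ℕ) (f := fun n => n) (init := fun _ => [])
    (step := fun _ s => incr s) (by fun_prop) (by fun_prop) (polyT_incr.comp (by fun_prop))
    (.X * 4 + 1) fun n k hk => by
      show sz (incr^[k] []) ≤ _
      rw [e]
      have h₁ := sz_list_le (l := k.bits) (B := 3) fun a _ => by
        cases a <;> simp [sz, enc, Data.ofBool, Data.size]
      have h₂ : k.bits.length ≤ k := by
        rw [Nat.size_eq_bits_len]; exact Nat.size_le.2 Nat.lt_two_pow_self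
      simp only [Polynomial.eval_add, Polynomial.eval_X, Polynomial.eval_mul, Polynomial.eval_one,
        Polynomial.eval_ofNat, sz_nat]
      omega
  simpa only [show ∀ n, (fun s => incr s)^[n] = incr^[n] from fun _ => rfl, e] using this

/-- The value of a binary number, if it is at most `m`. -/
def unaryOfBits (m : ℕ) (l : List Bool) : ℕ := l.reverse.foldl (fun u b => min (2 * u + b.toNat) m) 0

/-- Horner's scheme with a cap. The cap is never active when `n ≤ m`, while in general it prevents
an exponentially long unary number. -/
theorem unaryOfBits_bits {m n : ℕ} (h : n ≤ m) : unaryOfBits m n.bits = n := by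
  rw [unaryOfBits, List.foldl_reverse]
  induction n using Nat.binaryRec' with
  | zero => simp
  | bit b n hb ih =>
    rw [Nat.bits_append_bit _ _ hb, List.foldr_cons, ih (by cases b <;> simp [Nat.bit] at h <;> omega)]
    cases b <;> simp [Nat.bit] at h ⊢ <;> omega

@[fun_prop]
theorem PolyT.unaryOfBits {f : α → ℕ} {g : α → List Bool} (hf : PolyT f) (hg : PolyT g) :
    PolyT fun a => unaryOfBits (f a) (g a) := by
  obtain ⟨p, hp⟩ := hf.sz_le
  refine .foldl_of_add (step := fun a u b => Min.min (2 * u + b.toNat) (f a)) hg.reverse (.const _)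
    ?_ p fun a s x _ => ?_
  · fun_prop
  · have := hp a
    rw [sz_nat] at this ⊢
    have := Nat.min_le_right (2 * s + x.toNat) (f a)
    omega

end

/-! ### Clearing denominators -/

theorem exists_scale {β : Type*} (F : Finset β) (x : β → ℚ≥0) :
    ∃ N : ℕ, 0 < N ∧ ∃ z : β → ℕ, ∀ P ∈ F, (N : ℚ≥0) * x P = z P := by
  classical
  induction F using Finset.induction_on with
  | empty => exact ⟨1, one_pos, fun _ => 0, by simp⟩
  | insert P F hP ih =>
    obtain ⟨N, hN, z, hz⟩ := ih
    refine ⟨(x P).den * N, Nat.mul_pos (x P).den_pos hN,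
      fun Q => if Q = P then N * (x P).num else (x P).den * z Q, fun Q hQ => ?_⟩
    rcases eq_or_ne Q P with rfl | h
    · have : ((x Q).den : ℚ≥0) * x Q = (x Q).num := NNRat.den_mul_eq_num _
      simp only [if_true]
      push_cast
      rw [← this]; ring
    · have := hz Q (Finset.mem_of_mem_insert_of_ne hQ h)
      simp only [h, if_false]
      push_cast
      rw [← this]; ring

theorem sum_scale {β : Type*} {F : Finset β} {x : β → ℚ≥0} {N : ℕ} {z : β → ℕ}
    (h : ∀ P ∈ F, (N : ℚ≥0) * x P = z P) : (N : ℚ≥0) * ∑ P ∈ F, x P = (∑ P ∈ F, z P : ℕ) := by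
  rw [Finset.mul_sum, Finset.sum_congr rfl h]; push_cast; rfl

theorem scale_le_iff {N : ℕ} (hN : 0 < N) {a : ℚ≥0} {n c : ℕ} (h : (N : ℚ≥0) * a = n) :
    a ≤ c ↔ n ≤ N * c := by
  have hN' : (0 : ℚ≥0) < N := by exact_mod_cast hN
  rw [← mul_le_mul_iff_right₀ hN', h]
  exact_mod_cast Iff.rfl

theorem scale_eq_iff {N : ℕ} (hN : 0 < N) {a : ℚ≥0} {n c : ℕ} (h : (N : ℚ≥0) * a = n) :
    a = c ↔ n = N * c := by
  have hN' : (N : ℚ≥0) ≠ 0 := by exact_mod_cast hN.ne'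
  rw [← mul_right_inj' hN', h]
  exact_mod_cast Iff.rfl

theorem scale_le_sub_one_iff {N : ℕ} (hN : 0 < N) {a : ℚ≥0} {n c : ℕ} (h : (N : ℚ≥0) * a = n) :
    (a : ℚ) ≤ (c : ℚ) - 1 ↔ n + N ≤ N * c := by
  have hN' : (0 : ℚ) < N := by exact_mod_cast hN
  have h' : (N : ℚ) * a = n := by exact_mod_cast h
  rw [← mul_le_mul_iff_right₀ hN', h', mul_sub, mul_one, le_sub_iff_add_le]
  exact_mod_cast Iff.rfl

namespace MRFR

variable {I : MRFR}

theorem isSolution_iff {N : ℕ} (hN : 0 < N) {x : Finset (Fin I.numA) → ℚ≥0}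
    {y : Finset (Fin I.numA) → ℕ} (h : ∀ P ∈ I.stPaths, (N : ℚ≥0) * x P = y P) :
    I.IsSolution x ↔ I.Scaled N y := by
  have hs : ∀ (p : Finset (Fin I.numA) → Prop) [DecidablePred p], (N : ℚ≥0) * ∑ P ∈ I.stPaths with p P, x P =
      (∑ P ∈ I.stPaths with p P, y P : ℕ) := fun p _ =>
    sum_scale fun P hP => h P (Finset.mem_filter.1 hP).1
  have h₁ : (∀ a, arcFlow I.stPaths x a ≤ 1) ↔ ∀ a, ∑ Q ∈ I.stPaths with a ∈ Q, y Q ≤ N := by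
    refine forall_congr' fun a => ?_
    have := scale_le_iff hN (hs fun Q => a ∈ Q) (c := 1)
    simpa [arcFlow] using this
  have h₂ : ∑ P ∈ I.stPaths, x P = I.demand ↔
      I.demand.den * ∑ Q ∈ I.stPaths, y Q = N * I.demand.num := by
    have hN' : (N : ℚ≥0) ≠ 0 := by exact_mod_cast hN.ne'
    have hd : (I.demand.den : ℚ≥0) ≠ 0 := by exact_mod_cast I.demand.den_ne_zero
    have e : (I.demand.den : ℚ≥0) * I.demand = I.demand.num := NNRat.den_mul_eq_num _
    rw [← mul_right_inj' hN', sum_scale h, ← mul_right_inj' hd, mul_left_comm, e]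
    exact_mod_cast Iff.rfl
  have h₃ : (∀ S : Finset (Fin I.numA), S.card ≤ I.k →
      I.compat.IsClique (S : Set (Fin I.numA)) →
      (lostFlow I.stPaths x S : ℚ) ≤ (I.k : ℚ) - 1) ↔
      ∀ S : Finset (Fin I.numA), S.card ≤ I.k → I.compat.IsClique (S : Set (Fin I.numA)) →
      ∑ Q ∈ I.stPaths with (Q ∩ S).Nonempty, y Q + N ≤ N * I.k :=
    forall_congr' fun S => forall_congr' fun _ => forall_congr' fun _ =>
      scale_le_sub_one_iff hN (hs fun Q => (Q ∩ S).Nonempty)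
  rw [IsSolution, h₁, h₂, h₃]
  refine ⟨fun ⟨a, b, c⟩ => ⟨a, b, fun S hS => c S hS.le⟩, fun ⟨a, b, c⟩ => ⟨a, b, fun S hS hc => ?_⟩⟩
  -- Fewer than `k` arcs of unit capacity lose at most `k - 1` units, so only cliques of exactly `k`
  -- arcs are a restriction.
  rcases hS.lt_or_eq with hS | hS
  · have h₁ := (Inst.loss_le_sum I.stPaths y S).trans (Finset.sum_le_card_nsmul S _ N fun a' _ => a a')
    have h₂ := Nat.mul_le_mul_left N (Nat.succ_le_of_lt hS)
    rw [smul_eq_mul, mul_comm] at h₁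
    rw [Nat.mul_succ] at h₂
    omega
  · exact c S hS hc

theorem isYes_iff : I.IsYes ↔ ∃ N y, 0 < N ∧ I.Scaled N y := by
  constructor
  · rintro ⟨x, hx⟩
    obtain ⟨N, hN, y, h⟩ := exists_scale I.stPaths x
    exact ⟨N, y, hN, (isSolution_iff hN h).1 hx⟩
  · rintro ⟨N, y, hN, h⟩
    have hN' : (N : ℚ≥0) ≠ 0 := by exact_mod_cast hN.ne'
    exact ⟨fun P => y P / N, (isSolution_iff hN fun P _ => by field_simp).2 h⟩

theorem isIntegralYes_iff : I.IsIntegralYes ↔ ∃ y, I.Scaled 1 y := by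
  constructor
  · rintro ⟨x, hx, hi⟩
    choose! y hy using hi
    exact ⟨y, (isSolution_iff one_pos fun P hP => by simp [hy P hP]).1 hx⟩
  · rintro ⟨y, h⟩
    exact ⟨fun P => y P, (isSolution_iff one_pos fun P _ => by simp).2 h, fun P _ => ⟨_, rfl⟩⟩

theorem isYes_iff_layout : I.IsYes ↔ ∃ N z, 0 < N ∧ I.layout.inst.Sol N z := by
  rw [isYes_iff]
  constructor
  · rintro ⟨N, y, hN, h⟩
    obtain ⟨z, hz⟩ := h.exists_sol hN
    exact ⟨_, z, Nat.mul_pos hN I.demand.den_pos, hz⟩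
  · rintro ⟨N, z, hN, hz⟩
    obtain ⟨y, hy⟩ := exists_of_sol hz
    exact ⟨N, y, hN, hy⟩

theorem isIntegralYes_iff_layout : I.IsIntegralYes ↔ ∃ z, I.layout.inst.Sol 1 z := by
  rw [isIntegralYes_iff]
  constructor
  · rintro ⟨y, h⟩
    have := h.exists_sol one_pos
    rwa [h.den_eq_one] at this
  · rintro ⟨z, hz⟩
    exact exists_of_sol hz

end MRFR

/-! ### Numbering the elements of finite types -/

/-- A type whose elements are numbered. -/
class Coded (α : Type) where
  /-- The number of elements. -/
  card : ℕ
  /-- The numbering. -/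
  equiv : α ≃ Fin card

namespace Coded

instance (n : ℕ) : Coded (Fin n) := ⟨n, Equiv.refl _⟩
instance : Coded Unit := ⟨1, Equiv.ofUnique _ _⟩
instance : Coded Bool := ⟨2, finTwoEquiv.symm⟩
instance {α β : Type} [Coded α] [Coded β] : Coded (α ⊕ β) :=
  ⟨card α + card β, (Equiv.sumCongr equiv equiv).trans finSumFinEquiv⟩
instance {α β : Type} [Coded α] [Coded β] : Coded (α × β) :=
  ⟨card α * card β, (Equiv.prodCongr equiv equiv).trans finProdFinEquiv⟩

/-- The number of an element. -/
def code {α : Type} [Coded α] (a : α) : ℕ := (equiv a : Fin (card α))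

/-- All elements in the order of their numbers. -/
def enum (α : Type) [Coded α] : List α := List.ofFn (equiv (α := α)).symm

variable {α β γ : Type} [Coded α] [Coded β]

theorem code_inl (a : α) : code (Sum.inl a : α ⊕ β) = code a := by simp [code, equiv]
theorem code_inr (b : β) : code (Sum.inr b : α ⊕ β) = card α + code b := by simp [code, equiv]
theorem code_pair (a : α) (b : β) : code (a, b) = code b + card β * code a := by
  simp [code, equiv]
theorem code_fin {n : ℕ} (i : Fin n) : code i = i := rfl
theorem card_bool : card Bool = 2 := rfl

theorem enum_sum : enum (α ⊕ β) = (enum α).map Sum.inl ++ (enum β).map Sum.inr := by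
  simp only [enum]
  refine (List.ofFn_add (n := card α) (m := card β)).trans ?_
  simp only [List.map_ofFn]
  congr 2 <;> funext i <;> rw [Equiv.symm_apply_eq]
  · simp [equiv, Fin.ext_iff]
  · simp [equiv]

theorem enum_prod : enum (α × β) = (enum α).flatMap fun a => (enum β).map fun b => (a, b) := by
  simp only [enum]
  refine (List.ofFn_mul (m := card α) (n := card β) _).trans ?_
  rw [List.flatMap_def, List.map_ofFn]
  congr 2; funext i
  simp only [Function.comp, List.map_ofFn]
  congr 1; funext j
  rw [Equiv.symm_apply_eq]
  simp [equiv, Fin.ext_iff]; ring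

end Coded


/-! ### Instances of MRF-M* from numbered node, arc and commodity types -/

namespace Inst

variable {V A K : Type} [Fintype A] [DecidableEq A] [Fintype K] [Coded V] [Coded A] [Coded K]
  (G : Inst V A K)

open RobustFlow.Coded (equiv)

/-- The conditions making an instance over arbitrary types an instance of MRF-M*. -/
structure Proper : Prop where
  one_le_k : 1 ≤ G.k
  k_le : G.k ≤ Fintype.card A
  src_ne_snk : ∀ i, G.src i ≠ G.snk i
  src_injective : Function.Injective G.src
  cap_le : ∀ a, G.cap a ≤ G.M
  exists_cap_eq : ∃ a, G.cap a = G.M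

variable {G}

/-- The instance with numbered nodes, arcs and commodities. -/
abbrev toMRFM (h : G.Proper) : MRFM where
  numV := Coded.card V
  numA := Coded.card A
  tail a := equiv (G.tl (equiv.symm a))
  head a := equiv (G.hd (equiv.symm a))
  cap a := G.cap (equiv.symm a)
  k := G.k
  numK := Coded.card K
  src i := equiv (G.src (equiv.symm i))
  snk i := equiv (G.snk (equiv.symm i))
  dem i := G.dem (equiv.symm i)
  one_le_k := h.one_le_k
  k_le := by
    have := Fintype.card_congr (equiv (α := A))
    rw [Fintype.card_fin] at this
    exact this ▸ h.k_le
  src_ne_snk i := by simpa using h.src_ne_snk _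
  pairs_injective i j hij := by
    simp only [Prod.mk.injEq, EmbeddingLike.apply_eq_iff_eq] at hij
    exact equiv.symm.injective (h.src_injective hij.1)

variable (h : G.Proper)

/-- The correspondence of arc sets. -/
def arcSets : Finset A ≃ Finset (Fin (toMRFM h).numA) := (equiv (α := A)).finsetCongr

theorem mem_arcSets {P : Finset A} {a : A} : (equiv a : Fin (Coded.card A)) ∈ arcSets h P ↔ a ∈ P := by
  simp [arcSets]

theorem walk_toMRFM {v w : V} {l : List A} :
    Walk (toMRFM h).tail (toMRFM h).head (equiv v : Fin (Coded.card V)) (l.map equiv) (equiv w : Fin (Coded.card V)) ↔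
      Walk G.tl G.hd v l w := by
  induction l generalizing v with
  | nil => simp [Walk]
  | cons a l ih =>
    simp only [List.map_cons, Walk]
    rw [← ih]
    simp [toMRFM]

theorem simplePath_toMRFM {v w : V} {P : Finset A} :
    SimplePath (toMRFM h).tail (toMRFM h).head (equiv v : Fin (Coded.card V))
      (equiv w : Fin (Coded.card V)) (arcSets h P) ↔ SimplePath G.tl G.hd v w P := by
  have nd : ∀ l : List A, ((equiv v : Fin (Coded.card V)) :: (l.map equiv).map (toMRFM h).head).Nodup ↔
      (v :: l.map G.hd).Nodup := fun l => by
    rw [← List.nodup_map_iff (f := (equiv : V ≃ Fin (Coded.card V))) equiv.injective]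
    simp [toMRFM, Function.comp_def]
  have fs : ∀ l : List A, (l.map equiv).toFinset = arcSets h P ↔ l.toFinset = P := fun l => by
    have : (l.map equiv).toFinset = arcSets h l.toFinset := by
      ext a
      obtain ⟨b, rfl⟩ := (equiv (α := A)).surjective a
      rw [mem_arcSets]; simp
    rw [this, EmbeddingLike.apply_eq_iff_eq]
  constructor
  · rintro ⟨l, h₁, h₂, h₃⟩
    obtain ⟨l, rfl⟩ : ∃ l' : List A, l = l'.map equiv :=
      ⟨l.map equiv.symm, by simp [List.map_map]⟩
    exact ⟨l, (walk_toMRFM h).1 h₁, (nd l).1 h₂, (fs l).1 h₃⟩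
  · rintro ⟨l, h₁, h₂, h₃⟩
    exact ⟨l.map equiv, (walk_toMRFM h).2 h₁, (nd l).2 h₂, (fs l).2 h₃⟩

theorem mem_commodityPaths {i : K} {P : Finset A} :
    arcSets h P ∈ (toMRFM h).commodityPaths (equiv i) ↔ P ∈ G.paths i := by
  rw [mem_paths, ← simplePath_toMRFM h, MRFM.commodityPaths, FinDigraph.paths]
  simp [MRFR.isPath_iff, toMRFM]

theorem mem_allPaths {P : Finset A} : arcSets h P ∈ (toMRFM h).allPaths ↔ P ∈ G.all := by
  rw [mem_all, MRFM.allPaths]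
  simp only [Finset.mem_biUnion, Finset.mem_univ, true_and]
  refine ((equiv (α := K)).exists_congr fun i => ?_).symm
  rw [mem_commodityPaths]

theorem sum_commodityPaths {β : Type*} [AddCommMonoid β] (i : K) (p : Finset A → Prop) [DecidablePred p]
    (q : Finset (Fin (toMRFM h).numA) → Prop) [DecidablePred q] (hpq : ∀ P, q (arcSets h P) ↔ p P)
    (f : Finset (Fin (toMRFM h).numA) → β) :
    ∑ P ∈ (toMRFM h).commodityPaths (equiv i) with q P, f P =
      ∑ P ∈ G.paths i with p P, f (arcSets h P) :=
  (Finset.sum_equiv (arcSets h) (fun P => by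
    rw [Finset.mem_filter, Finset.mem_filter]
    exact (and_congr (mem_commodityPaths h) (hpq P)).symm) fun _ _ => rfl).symm

theorem sum_allPaths {β : Type*} [AddCommMonoid β] (p : Finset A → Prop) [DecidablePred p]
    (q : Finset (Fin (toMRFM h).numA) → Prop) [DecidablePred q] (hpq : ∀ P, q (arcSets h P) ↔ p P)
    (f : Finset (Fin (toMRFM h).numA) → β) :
    ∑ P ∈ (toMRFM h).allPaths with q P, f P = ∑ P ∈ G.all with p P, f (arcSets h P) :=
  (Finset.sum_equiv (arcSets h) (fun P => by
    rw [Finset.mem_filter, Finset.mem_filter]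
    exact (and_congr (mem_allPaths h) (hpq P)).symm) fun _ _ => rfl).symm

section

variable {N : ℕ} {x : Finset (Fin (toMRFM h).numA) → ℚ≥0} {z : Finset A → ℕ}

theorem scale_arcFlow (hz : ∀ P ∈ G.all, (N : ℚ≥0) * x (arcSets h P) = z P) (i : K) (a : A) :
    (N : ℚ≥0) * arcFlow ((toMRFM h).commodityPaths (equiv i)) x (equiv a : Fin (Coded.card A)) =
      (∑ P ∈ G.paths i with a ∈ P, z P : ℕ) := by
  rw [arcFlow, sum_commodityPaths h i (fun P => a ∈ P) _ (fun P => mem_arcSets h)]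
  exact sum_scale fun P hP => hz P (mem_all.2 ⟨i, (Finset.mem_filter.1 hP).1⟩)

theorem isFlow_toMRFM (hN : 0 < N) (hz : ∀ P ∈ G.all, (N : ℚ≥0) * x (arcSets h P) = z P) :
    (toMRFM h).IsFlow x ↔ G.IsFlow N z := by
  have h₁ : (∀ a, arcFlow (toMRFM h).allPaths x a ≤ (toMRFM h).cap a) ↔
      ∀ a, ∑ P ∈ G.all with a ∈ P, z P ≤ N * G.cap a := by
    refine ((equiv (α := A)).forall_congr fun {a} => ?_).symm
    have e : (toMRFM h).cap (equiv a : Fin (Coded.card A)) = (G.cap a : ℚ≥0) := by simp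
    rw [e]
    refine (scale_le_iff hN ?_).symm
    rw [arcFlow, sum_allPaths h (fun P => a ∈ P) _ (fun P => mem_arcSets h)]
    exact sum_scale fun P hP => hz P (Finset.mem_filter.1 hP).1
  have h₂ : (∀ i, ∑ P ∈ (toMRFM h).commodityPaths i, x P = (toMRFM h).dem i) ↔
      ∀ i, ∑ P ∈ G.paths i, z P = N * G.dem i := by
    refine ((equiv (α := K)).forall_congr fun {i} => ?_).symm
    have e : (toMRFM h).dem (equiv i : Fin (Coded.card K)) = (G.dem i : ℚ≥0) := by simp
    rw [e]
    refine (scale_eq_iff hN ?_).symm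
    have := sum_commodityPaths h i (fun _ => True) (fun _ => True) (fun _ => Iff.rfl) x
    simp only [Finset.filter_true] at this
    rw [this]
    exact sum_scale fun P hP => hz P (mem_all.2 ⟨i, hP⟩)
  exact ⟨fun k => ⟨h₁.1 k.1, h₂.1 k.2⟩, fun k => ⟨h₁.2 k.1, h₂.2 k.2⟩⟩

theorem maxCap_toMRFM : (toMRFM h).maxCap = G.M := by
  refine le_antisymm (Finset.sup_le fun a _ => ?_) ?_
  · exact Nat.cast_le.2 (h.cap_le _)
  · obtain ⟨a, ha⟩ := h.exists_cap_eq
    have : (toMRFM h).cap (equiv a : Fin (Coded.card A)) = (G.M : ℚ≥0) := by simp [ha]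
    rw [← this]
    exact Finset.le_sup (Finset.mem_univ _)

theorem isSolution_toMRFM (hN : 0 < N) (hz : ∀ P ∈ G.all, (N : ℚ≥0) * x (arcSets h P) = z P) :
    (toMRFM h).IsSolution x ↔ G.Sol N z := by
  have h₁ : (∀ S : Finset (Fin (toMRFM h).numA), S.card = (toMRFM h).k →
      (lostFlow (toMRFM h).allPaths x S : ℚ) ≤ ((toMRFM h).k : ℚ) * ((toMRFM h).maxCap : ℚ) - 1) ↔
      ∀ S : Finset A, S.card = G.k → ∑ P ∈ G.all with (P ∩ S).Nonempty, z P + N ≤ N * (G.k * G.M) := by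
    refine ((arcSets h).forall_congr fun {S} => ?_).symm
    have e : ((toMRFM h).k : ℚ) * ((toMRFM h).maxCap : ℚ) = ((G.k * G.M : ℕ) : ℚ) := by
      rw [maxCap_toMRFM]; simp
    have e' : (arcSets h S).card = S.card := by simp [arcSets]
    rw [e, e']
    refine imp_congr_right fun _ => (scale_le_sub_one_iff hN ?_).symm
    rw [lostFlow, sum_allPaths h (fun P => (P ∩ S).Nonempty)]
    · exact sum_scale fun P hP => hz P (Finset.mem_filter.1 hP).1
    · intro P
      simp only [arcSets, Equiv.finsetCongr_apply, ← Finset.map_inter, Finset.map_nonempty]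
  rw [MRFM.IsSolution, isFlow_toMRFM h hN hz, h₁]
  exact ⟨fun k => ⟨k.1, k.2⟩, fun k => ⟨k.1, k.2⟩⟩

end

theorem isYes_toMRFM : (toMRFM h).IsYes ↔ ∃ N z, 0 < N ∧ G.Sol N z := by
  constructor
  · rintro ⟨x, hx⟩
    obtain ⟨N, hN, z, hz⟩ := exists_scale G.all fun P => x (arcSets h P)
    exact ⟨N, z, hN, (isSolution_toMRFM h hN hz).1 hx⟩
  · rintro ⟨N, z, hN, hz⟩
    have hN' : (N : ℚ≥0) ≠ 0 := by exact_mod_cast hN.ne'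
    exact ⟨fun P => z ((arcSets h).symm P) / N,
      (isSolution_toMRFM h hN fun P _ => by simp; field_simp).2 hz⟩

theorem isIntegralYes_toMRFM : (toMRFM h).IsIntegralYes ↔ ∃ z, G.Sol 1 z := by
  constructor
  · rintro ⟨x, hx, hi⟩
    choose! z hz using hi
    exact ⟨fun P => z (arcSets h P), (isSolution_toMRFM h one_pos fun P hP => by
      simp [hz _ ((mem_allPaths h).2 hP)]).1 hx⟩
  · rintro ⟨z, hz⟩
    exact ⟨fun P => z ((arcSets h).symm P), (isSolution_toMRFM h one_pos fun P _ => by simp).2 hz,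
      fun P _ => ⟨_, rfl⟩⟩

theorem exists_isFlow {x : Finset (Fin (toMRFM h).numA) → ℚ≥0} (hx : (toMRFM h).IsFlow x) :
    ∃ N z, 0 < N ∧ G.IsFlow N z ∧ ∀ P ∈ G.all, (N : ℚ≥0) * x (arcSets h P) = z P := by
  obtain ⟨N, hN, z, hz⟩ := exists_scale G.all fun P => x (arcSets h P)
  exact ⟨N, z, hN, (isFlow_toMRFM h hN hz).1 hx, hz⟩

theorem sum_arcs_toMRFM (p : A → Prop) [DecidablePred p] (q : Fin (toMRFM h).numA → Prop)
    [DecidablePred q] (hpq : ∀ a, q (equiv a : Fin (Coded.card A)) ↔ p a) :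
    ∑ a with q a, (toMRFM h).cap a = ((∑ a with p a, G.cap a : ℕ) : ℚ≥0) := by
  rw [Nat.cast_sum]
  refine (Finset.sum_equiv (equiv (α := A)) (fun a => ?_) fun a _ => ?_).symm
  · simp [hpq]
  · simp

end Inst

open RobustFlow.Coded (equiv)

namespace Layout

variable {D : Layout}

instance : Coded D.Node := ⟨Coded.card D.NodeSum, (nodeEquiv D).trans equiv⟩
instance : Coded D.Arc := ⟨Coded.card D.ArcSum, (arcEquiv D).trans equiv⟩

theorem proper (hV : D.Valid) : D.inst.Proper where
  one_le_k := Nat.succ_pos _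
  k_le := by
    have h := Fintype.card_le_of_injective (Arc.main (D := D)) fun _ _ h => by simpa using h
    have := hV.ext_lt
    rw [card_main] at h
    simp only [inst_k]; omega
  src_ne_snk _ := by simp
  src_injective _ _ h := by simpa using h
  cap_le := capacity_le hV
  exists_cap_eq := ⟨.main (.inl ⟨0, by have := hV.ext_lt; omega⟩), rfl⟩

/-- The instance of MRF-M* given by the parameters. -/
noncomputable abbrev toMRFM (hV : D.Valid) : MRFM := Inst.toMRFM (proper hV)

/-! ### Structural properties of the numbered instance -/

variable (hV : D.Valid)

theorem saturated_terminals (i : Fin (toMRFM hV).numK) :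
    ∑ a ∈ (toMRFM hV).outArcs {(toMRFM hV).src i}, (toMRFM hV).cap a = (toMRFM hV).dem i ∧
      ∑ a ∈ (toMRFM hV).inArcs {(toMRFM hV).snk i}, (toMRFM hV).cap a = (toMRFM hV).dem i ∧
      (toMRFM hV).inArcs {(toMRFM hV).src i} = ∅ ∧ (toMRFM hV).outArcs {(toMRFM hV).snk i} = ∅ := by
  have hs : ∀ a i, head (D := D) a ≠ .src i := head_ne_src
  have ht : ∀ a i, tail (D := D) a ≠ .snk i := tail_ne_snk
  refine ⟨?_, ?_, ?_, ?_⟩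
  · rw [FinDigraph.outArcs, Inst.sum_arcs_toMRFM (proper hV) (fun a => tail a = .src (equiv.symm i))]
    · exact congrArg _ (sum_src _)
    · intro a; simp [hs]
  · rw [FinDigraph.inArcs, Inst.sum_arcs_toMRFM (proper hV) (fun a => head a = .snk (equiv.symm i))]
    · exact congrArg _ (sum_snk _)
    · intro a; simp [ht]
  · ext a; simp [FinDigraph.inArcs, hs]
  · ext a; simp [FinDigraph.outArcs, ht]

theorem sum_dem_erase :
    ((∑ i ∈ Finset.univ.erase (equiv (com0 : D.Com)), (toMRFM hV).dem i : ℚ≥0) : ℚ) ≤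
      ((toMRFM hV).maxCap : ℚ) - 3 := by
  have e : ∑ i ∈ Finset.univ.erase (equiv (com0 : D.Com)), (toMRFM hV).dem i =
      ((∑ i ∈ Finset.univ.erase (com0 : D.Com), D.demand i : ℕ) : ℚ≥0) := by
    rw [Nat.cast_sum]
    exact (Finset.sum_equiv (equiv (α := D.Com)) (fun i => by simp) fun i _ => by simp).symm
  rw [e, Inst.maxCap_toMRFM, le_sub_iff_add_le]
  exact_mod_cast sum_demand_erase (D := D)

theorem two_le_arcFlow {x : Finset (Fin (toMRFM hV).numA) → ℚ≥0} (hx : (toMRFM hV).IsFlow x)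
    {i : Fin (toMRFM hV).numK} (hi : i ≠ equiv (com0 : D.Com)) {a : Fin (toMRFM hV).numA}
    (ha : ((toMRFM hV).maxCap : ℚ) - 2 ≤ ((toMRFM hV).cap a : ℚ)) :
    2 ≤ arcFlow ((toMRFM hV).commodityPaths i) x a := by
  obtain ⟨N, z, hN, hf, hz⟩ := Inst.exists_isFlow _ hx
  obtain ⟨i, rfl⟩ := (equiv (α := D.Com)).surjective i
  obtain ⟨a, rfl⟩ := (equiv (α := D.Arc)).surjective a
  have hi' : i ≠ com0 := fun e => hi (by rw [e])
  -- By `capacity_lt` all other arcs have capacity at most `M - 3`.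
  obtain ⟨c, rfl⟩ : ∃ c, a = .main c := by
    by_contra hc
    push Not at hc
    have h₁ := capacity_lt hV a hc
    rw [Inst.maxCap_toMRFM, sub_le_iff_le_add] at ha
    simp only [inst_M, inst_cap, Equiv.symm_apply_apply, NNRat.cast_natCast] at ha
    have : D.maxc ≤ D.capacity a + 2 := by exact_mod_cast ha
    omega
  have h₁ := two_le_flow_main hf hi' c
  have h₂ := Inst.scale_arcFlow _ hz i (.main c)
  by_contra hc
  rw [not_le] at hc
  have hN' : (0 : ℚ≥0) < N := by exact_mod_cast hN
  have := mul_lt_mul_of_pos_left hc hN'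
  rw [h₂] at this
  have : ∑ P ∈ D.inst.paths i with Arc.main c ∈ P, z P < N * 2 := by exact_mod_cast this
  omega

theorem exists_cut : ∃ U : Finset (Fin (toMRFM hV).numV),
    (∀ i, (toMRFM hV).src i ∈ U) ∧ (∀ i, (toMRFM hV).snk i ∉ U) ∧
      ∑ a ∈ (toMRFM hV).outArcs U, (toMRFM hV).cap a = ∑ i, (toMRFM hV).dem i ∧
      (((toMRFM hV).outArcs U).filter fun a => (toMRFM hV).cap a = (toMRFM hV).maxCap).card =
        (toMRFM hV).k - 1 := by
  have hU : ∀ v : D.Node, (equiv v : Fin (Coded.card D.Node)) ∈ Finset.univ.filter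
      (fun v : Fin (Coded.card D.Node) => D.cut (equiv.symm v) = true) ↔ D.cut v = true := fun v => by
    simp only [Finset.mem_filter, Finset.mem_univ, true_and, Equiv.symm_apply_apply]
  have hA : ∀ a : D.Arc, (equiv a : Fin (Coded.card D.Arc)) ∈ (toMRFM hV).outArcs (Finset.univ.filter
      (fun v : Fin (Coded.card D.Node) => D.cut (equiv.symm v) = true)) ↔ a ∈ D.cutArcs := fun a => by
    rw [FinDigraph.outArcs, Finset.mem_filter, hU, hU, mem_cutArcs, Bool.not_eq_true]
    simp only [Finset.mem_univ, true_and, Equiv.symm_apply_apply, inst_tl, inst_hd]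
  refine ⟨Finset.univ.filter fun v => D.cut (equiv.symm v) = true,
    fun i => (hU _).2 rfl, fun i h => Bool.false_ne_true ((hU _).1 h), ?_, ?_⟩
  · rw [FinDigraph.outArcs, Inst.sum_arcs_toMRFM (proper hV)
      (fun a => D.cut (tail a) = true ∧ D.cut (head a) = false)]
    · refine (congrArg _ (sum_cutArcs hV)).trans ?_
      rw [Nat.cast_sum]
      exact Fintype.sum_equiv (equiv (α := D.Com)) _ _ fun i => by simp
    · intro a
      have := hA a
      rw [FinDigraph.outArcs, Finset.mem_filter, mem_cutArcs] at this
      simpa only [Finset.mem_univ, true_and] using this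
  · have h := card_cut_main hV
    simp only [inst_k, Nat.add_sub_cancel]
    refine Eq.trans ?_ h
    refine (Finset.card_equiv (equiv (α := D.Arc)) fun a => ?_).symm
    rw [Inst.maxCap_toMRFM, Finset.mem_filter, Finset.mem_filter, hA]
    simp only [Equiv.symm_apply_apply, inst_cap, inst_M, Nat.cast_inj]

theorem maxCap_le (hW : D.W ≤ D.numA) (hr : ∀ l, D.rhs l ≤ D.W * D.cols + 1) :
    (toMRFM hV).maxCap ≤ ((10 + 2 * .X + 2 * .X + 2 * .X * .X + .X + .X * (.X * .X + 1) :
      Polynomial ℕ).eval (toMRFM hV).numA : ℕ) := by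
  rw [Inst.maxCap_toMRFM, Nat.cast_le]
  have h := maxc_le (D := D) (n := (toMRFM hV).numA)
    (by have := Fintype.card_congr (equiv (α := D.Arc)); rw [this, Fintype.card_fin]) hW hr hV
  simpa using h

end Layout

/-- The reduction. -/
noncomputable def MRFR.reduction (I : MRFR) : MRFM := Layout.toMRFM I.layout_valid

namespace MRFR

variable (I : MRFR)

theorem reduction_k : I.reduction.k = I.k := Nat.sub_add_cancel I.one_le_k

theorem isYes_reduction : I.IsYes ↔ I.reduction.IsYes := by
  rw [isYes_iff_layout, reduction, Inst.isYes_toMRFM]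

theorem isIntegralYes_reduction : I.IsIntegralYes ↔ I.reduction.IsIntegralYes := by
  rw [isIntegralYes_iff_layout, reduction, Inst.isIntegralYes_toMRFM]

end MRFR

open RobustFlow.Enc (enc)
open RobustFlow.Coded (equiv code enum)

/-! ### Encodings as tuples -/

/-- The encoded instances of MRF-R*. -/
abbrev Input : Type :=
  ℕ × List (List Bool × List Bool) × List Bool × List Bool × List Bool × List (List Bool) ×
    (List Bool × List Bool) × Unit

/-- An encoded arc or commodity. -/
abbrev Entry : Type := List Bool × List Bool × (List Bool × List Bool) × Unit

/-- The encoded instances of MRF-M*. -/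
abbrev Output : Type := ℕ × List Entry × List Bool × List Entry × Unit

open Classical in
/-- The encoding of an instance as a tuple. -/
noncomputable def MRFR.input (I : MRFR) : Input :=
  (I.numV, List.ofFn fun a => ((I.tail a : ℕ).bits, (I.head a : ℕ).bits), (I.s : ℕ).bits,
    (I.t : ℕ).bits, I.k.bits, List.ofFn fun a => List.ofFn fun b => decide (I.compat.Adj a b),
    (I.demand.num.bits, I.demand.den.bits), ())

/-- The encoding of an instance as a tuple. -/
def MRFM.output (J : MRFM) : Output :=
  (J.numV, List.ofFn fun a => ((J.tail a : ℕ).bits, (J.head a : ℕ).bits,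
      ((J.cap a).num.bits, (J.cap a).den.bits), ()), J.k.bits,
    List.ofFn fun i => ((J.src i : ℕ).bits, (J.snk i : ℕ).bits,
      ((J.dem i).num.bits, (J.dem i).den.bits), ()), ())

theorem enc_list_ofFn {α : Type} [Enc α] {n : ℕ} (f : Fin n → α) :
    enc (List.ofFn f) = Data.ofList (List.ofFn fun i => enc (f i)) := by
  simp [enc, List.map_ofFn, Function.comp_def]

/-- Nested pairs have the same tree as a list of fixed length; the trailing `Unit` supplies the
final `nil`. -/
theorem MRFR.enc_input (I : MRFR) : enc I.input = I.encode := by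
  simp only [MRFR.encode, MRFR.input]
  have h : ∀ (f : Fin I.numA → List Bool × List Bool), enc (List.ofFn f) =
      Data.ofList (List.ofFn fun i => Data.node (enc (f i).1) (enc (f i).2)) := fun f => enc_list_ofFn f
  have h' : ∀ (f : Fin I.numA → Fin I.numA → Bool), enc (List.ofFn fun i => List.ofFn (f i)) =
      Data.ofList (List.ofFn fun i => Data.ofList (List.ofFn fun j => Data.ofBool (f i j))) := fun f => by
    rw [enc_list_ofFn]; simp only [enc_list_ofFn]; rfl
  show Data.node _ (Data.node (enc _) (Data.node _ (Data.node _ (Data.node _ (Data.node (enc _)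
    (Data.node _ _)))))) = _
  rw [h, h']
  rfl

theorem MRFM.enc_output (J : MRFM) : enc J.output = J.encode := by
  simp only [MRFM.encode, MRFM.output]
  show Data.node _ (Data.node (enc _) (Data.node _ (Data.node (enc _) _))) = _
  rw [enc_list_ofFn, enc_list_ofFn]
  rfl

/-! ### The computation of the reduction -/

namespace Input

variable (p : Input)

/-- The number of arcs. -/
def m : ℕ := p.2.1.length
/-- The number of additional arcs. -/
def ext : ℕ := unaryOfBits p.m p.2.2.2.2.1 - 1
/-- Adjacency in the compatibility graph. -/
def adj (a b : ℕ) : Bool := (p.2.2.2.2.2.1.getD a []).getI b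
/-- The bits of the numerator of the demand. -/
def num : List Bool := p.2.2.2.2.2.2.1.1
/-- The bits of the denominator of the demand. -/
def den : List Bool := p.2.2.2.2.2.2.1.2
/-- The number of columns. -/
def cols : ℕ := max p.num.length p.den.length + 1
/-- The number of rows. -/
def rows : ℕ := 2 * p.cols + 1
/-- The number of arcs of maximum capacity. -/
def mains : ℕ := p.m + p.ext
/-- The number of commodities. -/
def coms : ℕ := p.rows + (p.cols + p.mains)

/-- The links. -/
def lk (a b : ℕ) : ℕ :=
  bif decide (b < p.m) then
    bif decide (a < p.m) then (!decide (a = b) && !p.adj a b).toNat else 1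
  else 0

/-- The positive coefficients. -/
def pos (j i : ℕ) : Bool :=
  bif decide (j = 0) then decide (1 ≤ i) && p.den.getI (i - 1) else decide (i < j)

/-- The coefficients of the rows. -/
def coef (l i : ℕ) (b : Bool) : Bool :=
  bif decide (l = 0) then b && (decide (1 ≤ i) && p.num.getI (i - 1))
  else bif decide (l ≤ p.cols) then
    (bif b then decide (1 ≤ l - 1) && decide (i = l - 1) else p.pos (l - 1) i)
  else (bif b then p.pos (l - 1 - p.cols) i
    else decide (1 ≤ l - 1 - p.cols) && decide (i = l - 1 - p.cols))

/-- The right-hand sides. -/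
def rhs (l : ℕ) : ℕ :=
  p.m * ((List.range p.cols).map fun i => (p.coef l i true).toNat).sum + (decide (l = 1)).toNat -
    (decide (l = p.cols + 1)).toNat

/-- The number of links leaving an arc. -/
def outdeg (a : ℕ) : ℕ := ((List.range p.mains).map fun b => p.lk a b).sum
/-- The number of links entering an arc. -/
def indeg (b : ℕ) : ℕ := ((List.range p.mains).map fun a => p.lk a b).sum

/-- The amount of flow of a commodity that is not direct. -/
def core (i : ℕ) : ℕ :=
  bif decide (i < p.rows) then p.rhs i
  else bif decide (i < p.rows + p.cols) then p.m else p.outdeg (i - p.rows - p.cols)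

/-- The maximum capacity. -/
def maxc : ℕ :=
  10 + 2 * p.coms + 2 * p.mains + 2 * p.mains * p.coms + p.m +
    ((List.range p.coms).map fun i => p.core i).sum

/-- The direct flow. -/
def direct (i c : ℕ) : ℕ :=
  bif decide (i = 0) then
    p.maxc - 2 * (p.coms - 1) - (p.outdeg c + p.indeg c + (decide (c < p.m)).toNat)
  else 2

/-- The demands. -/
def demand (i : ℕ) : ℕ := ((List.range p.mains).map fun c => p.direct i c).sum + p.core i

section PolyTime

variable {α : Type} [Enc α] {f : α → Input} {g h : α → ℕ} {b : α → Bool}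

@[fun_prop] theorem polyT_m : PolyT m := by unfold m; fun_prop
@[fun_prop] theorem polyT_ext : PolyT ext := by unfold ext; fun_prop
@[fun_prop] theorem polyT_num : PolyT num := by unfold num; fun_prop
@[fun_prop] theorem polyT_den : PolyT den := by unfold den; fun_prop
@[fun_prop] theorem polyT_cols : PolyT cols := by unfold cols; fun_prop
@[fun_prop] theorem polyT_rows : PolyT rows := by unfold rows; fun_prop
@[fun_prop] theorem polyT_mains : PolyT mains := by unfold mains; fun_prop
@[fun_prop] theorem polyT_coms : PolyT coms := by unfold coms; fun_prop

@[fun_prop] theorem polyT_adj (hf : PolyT f) (hg : PolyT g) (hh : PolyT h) :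
    PolyT fun a => (f a).adj (g a) (h a) := by unfold adj; fun_prop

@[fun_prop] theorem polyT_lk (hf : PolyT f) (hg : PolyT g) (hh : PolyT h) :
    PolyT fun a => (f a).lk (g a) (h a) := by unfold lk; fun_prop

@[fun_prop] theorem polyT_pos (hf : PolyT f) (hg : PolyT g) (hh : PolyT h) :
    PolyT fun a => (f a).pos (g a) (h a) := by unfold pos; fun_prop

@[fun_prop] theorem polyT_coef (hf : PolyT f) (hg : PolyT g) (hh : PolyT h) (hb : PolyT b) :
    PolyT fun a => (f a).coef (g a) (h a) (b a) := by unfold coef; fun_prop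

@[fun_prop] theorem polyT_rhs (hf : PolyT f) (hg : PolyT g) :
    PolyT fun a => (f a).rhs (g a) := by unfold rhs; fun_prop

@[fun_prop] theorem polyT_outdeg (hf : PolyT f) (hg : PolyT g) :
    PolyT fun a => (f a).outdeg (g a) := by unfold outdeg; fun_prop

@[fun_prop] theorem polyT_indeg (hf : PolyT f) (hg : PolyT g) :
    PolyT fun a => (f a).indeg (g a) := by unfold indeg; fun_prop

@[fun_prop] theorem polyT_core (hf : PolyT f) (hg : PolyT g) :
    PolyT fun a => (f a).core (g a) := by unfold core; fun_prop

@[fun_prop] theorem polyT_maxc : PolyT maxc := by unfold maxc; fun_prop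

@[fun_prop] theorem polyT_direct (hf : PolyT f) (hg : PolyT g) (hh : PolyT h) :
    PolyT fun a => (f a).direct (g a) (h a) := by unfold direct; fun_prop

@[fun_prop] theorem polyT_demand (hf : PolyT f) (hg : PolyT g) :
    PolyT fun a => (f a).demand (g a) := by unfold demand; fun_prop

end PolyTime

end Input


open RobustFlow.Enc (enc)
open RobustFlow.Coded (equiv code enum card)

/-! ### Listing numbered elements -/

section

variable {α β γ δ : Type} [Coded α] [Coded β] [Coded γ]

theorem ofFn_eq_map_range {n : ℕ} (F : ℕ → δ) :
    List.ofFn (fun i : Fin n => F i) = (List.range n).map F := by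
  rw [List.ofFn_eq_map, ← List.map_coe_finRange_eq_range, List.map_map]; rfl

/-- This replaces elements by their numbers: a listing over a numbered type becomes a listing over
`List.range`, which the calculus above can compute. -/
theorem map_enum {g : α → δ} {m : ℕ} (hα : card α = m) (F : ℕ → δ) (h : ∀ a, g a = F (code a)) :
    (enum α).map g = (List.range m).map F := by
  subst hα
  rw [enum, List.map_ofFn, ← ofFn_eq_map_range]
  congr 1; funext i
  simp [h, code]

theorem map_enum_prod {g : α × β → δ} {m n : ℕ} (hα : card α = m) (hβ : card β = n)
    (F : ℕ → ℕ → δ) (h : ∀ a b, g (a, b) = F (code a) (code b)) :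
    (enum (α × β)).map g =
      (List.range m).flatMap fun i => (List.range n).map fun j => F i j := by
  rw [Coded.enum_prod, List.map_flatMap, List.flatMap_def, List.flatMap_def]
  refine congrArg List.flatten (map_enum hα _ fun a => ?_)
  rw [List.map_map]
  exact map_enum hβ _ fun b => h a b

theorem map_enum_prod_prod {g : α × β × γ → δ} {m n o : ℕ} (hα : card α = m)
    (hβ : card β = n) (hγ : card γ = o) (F : ℕ → ℕ → ℕ → δ)
    (h : ∀ a b c, g (a, b, c) = F (code a) (code b) (code c)) :
    (enum (α × β × γ)).map g = (List.range m).flatMap fun i =>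
      (List.range n).flatMap fun j => (List.range o).map fun l => F i j l := by
  rw [Coded.enum_prod, List.map_flatMap, List.flatMap_def, List.flatMap_def]
  refine congrArg List.flatten (map_enum hα _ fun a => ?_)
  rw [List.map_map]
  exact map_enum_prod hβ hγ _ fun b c => h a b c

theorem map_enum_sum {g : α ⊕ β → δ} {l₁ l₂ : List δ} (h₁ : (enum α).map (fun a => g (.inl a)) = l₁)
    (h₂ : (enum β).map (fun b => g (.inr b)) = l₂) : (enum (α ⊕ β)).map g = l₁ ++ l₂ := by
  rw [Coded.enum_sum, List.map_append, List.map_map, List.map_map, ← h₁, ← h₂]; rfl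

theorem sum_map_range [Fintype α] {g : α → ℕ} (F : ℕ → ℕ) (h : ∀ a, F (code a) = g a) :
    ((List.range (card α)).map F).sum = ∑ a, g a := by
  rw [← map_enum rfl F fun a => (h a).symm, enum, List.map_ofFn, List.sum_ofFn]
  exact equiv.symm.sum_comp g

end

namespace Input

variable (p : Input)

/-- An arc or commodity with a natural number as capacity or demand. -/
def entry (v w : List Bool) (c : ℕ) : Entry := (v, w, (c.bits, [true]), ())

/-- The number of the source of a commodity. -/
def src (i : ℕ) : ℕ := p.1 + i
/-- The number of the sink of a commodity. -/
def snk (i : ℕ) : ℕ := p.1 + (p.coms + i)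
/-- The number of the entry of a commodity. -/
def ent (i : ℕ) : ℕ := p.1 + (p.coms + (p.coms + i))
/-- The number of the exit of a commodity. -/
def exi (i : ℕ) : ℕ := p.1 + (p.coms + (p.coms + (p.coms + i)))
/-- The number of the tail of an arc of maximum capacity. -/
def inn (c : ℕ) : ℕ := p.1 + (p.coms + (p.coms + (p.coms + (p.coms + c))))
/-- The number of the head of an arc of maximum capacity. -/
def out (c : ℕ) : ℕ := p.1 + (p.coms + (p.coms + (p.coms + (p.coms + (p.mains + c)))))
/-- The number of a node of a chain. -/
def chain (j h l : ℕ) : ℕ :=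
  p.1 + (p.coms + (p.coms + (p.coms + (p.coms + (p.mains + (p.mains +
    (l + (p.rows + 1) * h + 2 * (p.rows + 1) * j)))))))
/-- The number of nodes. -/
def nodes : ℕ :=
  p.1 + (p.coms + (p.coms + (p.coms + (p.coms + (p.mains + (p.mains +
    p.cols * (2 * (p.rows + 1))))))))
/-- The tail of an arc of the given digraph. -/
def tl (a : ℕ) : List Bool := (p.2.1.map Prod.fst).getD a []
/-- The head of an arc of the given digraph. -/
def hd (a : ℕ) : List Bool := (p.2.1.map Prod.snd).getD a []

/-- The arcs carrying the direct flow. -/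
def directArcs : List Entry :=
  ((List.range p.coms).flatMap fun i => (List.range p.mains).map fun c =>
      entry (p.src i).bits (p.inn c).bits (p.direct i c)) ++
    ((List.range p.coms).flatMap fun i => (List.range p.mains).map fun c =>
      entry (p.out c).bits (p.snk i).bits (p.direct i c))

/-- The arcs at the terminals and the arcs of maximum capacity. -/
def coreArcs : List Entry :=
  ((List.range p.coms).map fun i => entry (p.src i).bits (p.ent i).bits (p.core i)) ++
    (((List.range p.coms).map fun i => entry (p.exi i).bits (p.snk i).bits (p.core i)) ++
      ((List.range p.mains).map fun c => entry (p.inn c).bits (p.out c).bits p.maxc))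

/-- The arcs incident with nodes of the given digraph. -/
def origArcs : List Entry :=
  ((List.range p.m).map fun a => entry (p.tl a) (p.inn a).bits 1) ++
    (((List.range p.m).map fun a => entry (p.out a).bits (p.hd a) 1) ++
      ([entry (p.ent 0).bits p.2.2.1 (p.rhs 0)] ++
        [entry p.2.2.2.1 (p.exi 0).bits (p.rhs 0)]))

/-- The arcs of the links. -/
def linkArcs : List Entry :=
  ((List.range p.mains).flatMap fun a => (List.range p.mains).map fun b =>
      entry (p.out a).bits (p.inn b).bits (p.lk a b)) ++
    (((List.range p.mains).map fun a =>
        entry (p.ent (p.rows + (p.cols + a))).bits (p.inn a).bits (p.outdeg a)) ++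
      ((List.range p.mains).flatMap fun a => (List.range p.mains).map fun b =>
        entry (p.out b).bits (p.exi (p.rows + (p.cols + a))).bits (p.lk a b)))

/-- The arcs of the columns. -/
def colArcs : List Entry :=
  ((List.range p.cols).flatMap fun j => (List.range 2).flatMap fun h => (List.range p.rows).map fun l =>
      entry (p.chain j h l).bits (p.chain j h (l + 1)).bits p.m) ++
    (((List.range p.cols).flatMap fun j => (List.range 2).map fun h =>
        entry (p.ent (p.rows + j)).bits (p.chain j h 0).bits p.m) ++
      ((List.range p.cols).flatMap fun j => (List.range 2).map fun h =>
        entry (p.chain j h p.rows).bits (p.exi (p.rows + j)).bits p.m))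

/-- The arcs of the rows. -/
def rowArcs : List Entry :=
  ((List.range p.rows).flatMap fun l => (List.range p.cols).flatMap fun j => (List.range 2).map fun h =>
      entry (p.ent l).bits (p.chain j h l).bits (p.m * (p.coef l j (decide (h = 1))).toNat)) ++
    ((List.range p.rows).flatMap fun l => (List.range p.cols).flatMap fun j => (List.range 2).map fun h =>
      entry (p.chain j h (l + 1)).bits (p.exi l).bits (p.m * (p.coef l j (decide (h = 1))).toNat))

/-- The encoding of the constructed instance. -/
def compute : Output :=
  (p.nodes, p.directArcs ++ (p.coreArcs ++ (p.origArcs ++ (p.linkArcs ++ (p.colArcs ++ p.rowArcs)))),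
    p.2.2.2.2.1,
    (List.range p.coms).map fun i => entry (p.src i).bits (p.snk i).bits (p.demand i), ())

section PolyTime

variable {α : Type} [Enc α] {f : α → Input} {g h k : α → ℕ} {v w : α → List Bool}

@[fun_prop] theorem polyT_entry (hv : PolyT v) (hw : PolyT w) (hg : PolyT g) :
    PolyT fun a => entry (v a) (w a) (g a) := by unfold entry; fun_prop
@[fun_prop] theorem polyT_src (hf : PolyT f) (hg : PolyT g) : PolyT fun a => (f a).src (g a) := by
  unfold src; fun_prop
@[fun_prop] theorem polyT_snk (hf : PolyT f) (hg : PolyT g) : PolyT fun a => (f a).snk (g a) := by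
  unfold snk; fun_prop
@[fun_prop] theorem polyT_ent (hf : PolyT f) (hg : PolyT g) : PolyT fun a => (f a).ent (g a) := by
  unfold ent; fun_prop
@[fun_prop] theorem polyT_exi (hf : PolyT f) (hg : PolyT g) : PolyT fun a => (f a).exi (g a) := by
  unfold exi; fun_prop
@[fun_prop] theorem polyT_inn (hf : PolyT f) (hg : PolyT g) : PolyT fun a => (f a).inn (g a) := by
  unfold inn; fun_prop
@[fun_prop] theorem polyT_out (hf : PolyT f) (hg : PolyT g) : PolyT fun a => (f a).out (g a) := by
  unfold out; fun_prop
@[fun_prop] theorem polyT_chain (hf : PolyT f) (hg : PolyT g) (hh : PolyT h) (hk : PolyT k) :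
    PolyT fun a => (f a).chain (g a) (h a) (k a) := by unfold chain; fun_prop
@[fun_prop] theorem polyT_nodes : PolyT nodes := by unfold nodes; fun_prop
@[fun_prop] theorem polyT_tl (hf : PolyT f) (hg : PolyT g) : PolyT fun a => (f a).tl (g a) := by
  unfold tl; fun_prop
@[fun_prop] theorem polyT_hd (hf : PolyT f) (hg : PolyT g) : PolyT fun a => (f a).hd (g a) := by
  unfold hd; fun_prop
@[fun_prop] theorem polyT_directArcs : PolyT directArcs := by unfold directArcs; fun_prop
@[fun_prop] theorem polyT_coreArcs : PolyT coreArcs := by unfold coreArcs; fun_prop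
@[fun_prop] theorem polyT_origArcs : PolyT origArcs := by unfold origArcs; fun_prop
@[fun_prop] theorem polyT_linkArcs : PolyT linkArcs := by unfold linkArcs; fun_prop
@[fun_prop] theorem polyT_colArcs : PolyT colArcs := by unfold colArcs; fun_prop
@[fun_prop] theorem polyT_rowArcs : PolyT rowArcs := by unfold rowArcs; fun_prop
theorem polyT_compute : PolyT compute := by unfold compute; fun_prop

end PolyTime

end Input


open RobustFlow.Coded (equiv code enum card)

/-! ### Correctness of the computation -/

theorem entry_eq (v w : List Bool) (c : ℕ) :
    (v, w, ((c : ℚ≥0).num.bits, (c : ℚ≥0).den.bits), ()) = Input.entry v w c := by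
  rw [NNRat.num_natCast, NNRat.den_natCast, Nat.one_bits]; rfl

theorem Inst.output_toMRFM {V A K : Type} [Fintype A] [DecidableEq A] [Fintype K] [Coded V]
    [Coded A] [Coded K] {G : Inst V A K} (h : G.Proper) : (toMRFM h).output =
    (card V,
      (enum A).map fun a => Input.entry (code (G.tl a)).bits (code (G.hd a)).bits (G.cap a),
      G.k.bits,
      (enum K).map fun i => Input.entry (code (G.src i)).bits (code (G.snk i)).bits (G.dem i),
      ()) := by
  simp only [MRFM.output, entry_eq, enum, List.map_ofFn]
  rfl

namespace MRFR

variable (I : MRFR)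

theorem input_m : I.input.m = I.numA := by simp [Input.m, input]

/-- The binary budget can be converted to unary because `k` is at most the number of arcs. The
demand, in contrast, is only ever accessed bit by bit. -/
theorem input_ext : I.input.ext = I.k - 1 := by
  rw [Input.ext, input_m]
  show unaryOfBits I.numA I.k.bits - 1 = _
  rw [unaryOfBits_bits I.k_le]

theorem input_cols : I.input.cols = I.width + 1 := by
  simp [Input.cols, Input.num, Input.den, input, width, Nat.size_eq_bits_len]

/-- Here row 0 is included, unlike in the field `rows` of the layout. -/
theorem input_rows : I.input.rows = 2 * (I.width + 1) + 1 := by rw [Input.rows, input_cols]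

theorem input_mains : I.input.mains = card I.layout.Main := by
  rw [Input.mains, input_m, input_ext]; rfl

theorem input_coms : I.input.coms = card I.layout.Com := by
  rw [Input.coms, input_rows, input_cols, input_mains]; rfl

theorem input_adj (a b : Fin I.numA) : I.input.adj a b = true ↔ I.compat.Adj a b := by
  simp [Input.adj, input, List.getD_eq_getElem?_getD, List.getI_eq_getElem?_getD]

theorem input_lk (a b : I.layout.Main) : I.input.lk (code a) (code b) = I.layout.lk a b := by
  rw [Input.lk, input_m]
  rcases b with b | b
  · rw [Coded.code_inl, Coded.code_fin, decide_eq_true b.2]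
    rcases a with a | a
    · rw [Coded.code_inl, Coded.code_fin, decide_eq_true a.2]
      show (!decide ((a : ℕ) = b) && !I.input.adj a b).toNat = I.linked (.inl a) (.inl b)
      have := input_adj I a b
      by_cases h₁ : a = b <;> by_cases h₂ : I.compat.Adj a b <;>
        simp [linked, h₁, h₂, Fin.val_inj] at this ⊢ <;> simp [this]
    · have : ¬ code (Sum.inr a : I.layout.Main) < I.numA := by
        rw [Coded.code_inr]; exact Nat.not_lt.2 (Nat.le_add_right _ _)
      rw [decide_eq_false this]; rfl
  · have : ¬ code (Sum.inr b : I.layout.Main) < I.numA := by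
      rw [Coded.code_inr]; exact Nat.not_lt.2 (Nat.le_add_right _ _)
    rw [decide_eq_false this]
    exact (I.layout_valid.lk_inr a b).symm

/-- Reading position `i` of the list of bits, with default `false`, is `testBit`. -/
theorem input_coef (l i : ℕ) (b : Bool) :
    I.input.coef l i b = rowCoef I.demand.num I.demand.den (I.width + 1) l i b := by
  have h₁ : ∀ i, I.input.num.getI i = I.demand.num.testBit i := fun i =>
    (Nat.testBit_eq_inth _ _).symm
  have h₂ : ∀ i, I.input.den.getI i = I.demand.den.testBit i := fun i =>
    (Nat.testBit_eq_inth _ _).symm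
  simp only [Input.coef, Input.pos, h₁, h₂, input_cols, rowCoef, posCoef, negCoef,
    Bool.cond_eq_ite, decide_eq_true_eq]

theorem input_rhs (l : Fin (2 * (I.width + 1) + 1)) : I.input.rhs l = I.layout.rhs l := by
  have h : ((List.range I.input.cols).map fun i => (I.input.coef l i true).toNat).sum =
      ∑ i ∈ Finset.range (I.width + 1),
        (rowCoef I.demand.num I.demand.den (I.width + 1) l i true).toNat := by
    rw [input_cols, ← ofFn_eq_map_range, List.sum_ofFn, Finset.sum_range]
    simp only [input_coef]
  rw [Input.rhs, h, input_m, input_cols]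
  show _ = rowRhs _ _ _ _ _
  simp only [rowRhs, Bool.toNat, Bool.cond_decide]

theorem input_outdeg (a : I.layout.Main) : I.input.outdeg (code a) = I.layout.outdeg a := by
  rw [Input.outdeg, input_mains]
  exact sum_map_range _ fun b => input_lk I a b

theorem input_indeg (b : I.layout.Main) : I.input.indeg (code b) = I.layout.indeg b := by
  rw [Input.indeg, input_mains]
  exact sum_map_range _ fun a => input_lk I a b

theorem code_row (l : Fin (2 * (I.width + 1) + 1)) :
    code (Layout.row l : I.layout.Com) = l := Coded.code_inl _

theorem code_col (j : Fin (I.width + 1)) :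
    code (Layout.col j : I.layout.Com) = I.input.rows + j := by
  rw [input_rows]; exact (Coded.code_inr _).trans (congrArg _ (Coded.code_inl _))

theorem code_lnk (a : I.layout.Main) :
    code (Layout.lnk a : I.layout.Com) = I.input.rows + (I.input.cols + code a) := by
  rw [input_rows, input_cols]; exact (Coded.code_inr _).trans (congrArg _ (Coded.code_inr _))

theorem input_core (i : I.layout.Com) : I.input.core (code i) = I.layout.core i := by
  rw [Input.core]
  rcases i with l | j | a
  · rw [code_row, decide_eq_true (by rw [input_rows]; exact l.2), cond_true, input_rhs]
    rfl
  · rw [code_col, decide_eq_false (by omega), decide_eq_true (by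
      have := j.2; rw [input_cols]; simp only at this; omega), cond_true, cond_false, input_m]
    rfl
  · rw [code_lnk, decide_eq_false (by omega), decide_eq_false (by omega), cond_false, cond_false]
    rw [show I.input.rows + (I.input.cols + code a) - I.input.rows - I.input.cols = code a by omega,
      input_outdeg]
    rfl

theorem card_layout_com : card I.layout.Com = I.layout.numK := rfl

theorem input_maxc : I.input.maxc = I.layout.maxc := by
  have h : ((List.range I.input.coms).map fun i => I.input.core i).sum = ∑ i, I.layout.core i := by
    rw [input_coms]
    exact sum_map_range _ fun i => input_core I i
  rw [Input.maxc, h, input_coms, input_mains, input_m]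
  rfl

theorem input_direct (i : I.layout.Com) (c : I.layout.Main) :
    I.input.direct (code i) (code c) = I.layout.direct i c := by
  have h₁ : code i = 0 ↔ i = Layout.com0 := by
    rcases i with l | i
    · rw [Coded.code_inl, Coded.code_fin]
      exact ⟨fun h => congrArg Sum.inl (Fin.ext h), fun h => by rw [Sum.inl.inj h]; rfl⟩
    · rw [Coded.code_inr]
      simp only [reduceCtorEq, iff_false]
      exact fun h => absurd (Nat.eq_zero_of_add_eq_zero_right h) (Nat.succ_ne_zero _)
  have h₂ : decide (code c < I.numA) = c.isLeft := by
    rcases c with c | c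
    · rw [Coded.code_inl]; exact decide_eq_true c.2
    · rw [Coded.code_inr]; exact decide_eq_false (Nat.not_lt.2 (Nat.le_add_right _ _))
  rw [Input.direct, input_maxc, input_coms, input_m, input_outdeg, input_indeg, h₂,
    card_layout_com]
  simp only [h₁, Layout.direct, Layout.used, Bool.toNat, Bool.cond_eq_ite, decide_eq_true_eq]

theorem input_demand (i : I.layout.Com) : I.input.demand (code i) = I.layout.demand i := by
  rw [Input.demand, input_core, input_mains, Layout.demand]
  exact congrArg (· + _) (sum_map_range _ fun c => input_direct I i c)

/-! The numbers of the nodes. -/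

theorem code_orig (v : Fin I.numV) : code (Layout.Node.orig v : I.layout.Node) = v :=
  Coded.code_inl (α := Fin I.numV) _

theorem code_src (i : I.layout.Com) : code (Layout.Node.src i) = I.input.src (code i) := by
  refine (Coded.code_inr (α := Fin I.numV) _).trans (congrArg _ (Coded.code_inl _))

theorem code_snk (i : I.layout.Com) : code (Layout.Node.snk i) = I.input.snk (code i) := by
  rw [Input.snk, input_coms]
  refine (Coded.code_inr (α := Fin I.numV) _).trans (congrArg _ ?_)
  exact (Coded.code_inr _).trans (congrArg _ (Coded.code_inl _))

theorem code_entry (i : I.layout.Com) : code (Layout.Node.entry i) = I.input.ent (code i) := by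
  rw [Input.ent, input_coms]
  refine (Coded.code_inr (α := Fin I.numV) _).trans (congrArg _ ?_)
  refine (Coded.code_inr _).trans (congrArg _ ?_)
  exact (Coded.code_inr _).trans (congrArg _ (Coded.code_inl _))

theorem code_exit (i : I.layout.Com) : code (Layout.Node.exit i) = I.input.exi (code i) := by
  rw [Input.exi, input_coms]
  refine (Coded.code_inr (α := Fin I.numV) _).trans (congrArg _ ?_)
  refine (Coded.code_inr _).trans (congrArg _ ?_)
  refine (Coded.code_inr _).trans (congrArg _ ?_)
  exact (Coded.code_inr _).trans (congrArg _ (Coded.code_inl _))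

theorem code_inn (c : I.layout.Main) : code (Layout.Node.inn c) = I.input.inn (code c) := by
  rw [Input.inn, input_coms]
  refine (Coded.code_inr (α := Fin I.numV) _).trans (congrArg _ ?_)
  refine (Coded.code_inr _).trans (congrArg _ ?_)
  refine (Coded.code_inr _).trans (congrArg _ ?_)
  refine (Coded.code_inr _).trans (congrArg _ ?_)
  exact (Coded.code_inr _).trans (congrArg _ (Coded.code_inl _))

theorem code_out (c : I.layout.Main) : code (Layout.Node.out c) = I.input.out (code c) := by
  rw [Input.out, input_coms, input_mains]
  refine (Coded.code_inr (α := Fin I.numV) _).trans (congrArg _ ?_)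
  refine (Coded.code_inr _).trans (congrArg _ ?_)
  refine (Coded.code_inr _).trans (congrArg _ ?_)
  refine (Coded.code_inr _).trans (congrArg _ ?_)
  refine (Coded.code_inr _).trans (congrArg _ ?_)
  exact (Coded.code_inr _).trans (congrArg _ (Coded.code_inl _))

theorem code_chain (j : Fin (I.width + 1)) (h : Bool) (l : Fin (2 * (I.width + 1) + 2)) :
    code (Layout.Node.chain j h l : I.layout.Node) = I.input.chain j (code h) l := by
  rw [Input.chain, input_coms, input_mains, input_rows]
  refine (Coded.code_inr (α := Fin I.numV) _).trans (congrArg _ ?_)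
  refine (Coded.code_inr _).trans (congrArg _ ?_)
  refine (Coded.code_inr _).trans (congrArg _ ?_)
  refine (Coded.code_inr _).trans (congrArg _ ?_)
  refine (Coded.code_inr _).trans (congrArg _ ?_)
  refine (Coded.code_inr _).trans (congrArg _ ?_)
  refine (Coded.code_inr _).trans (congrArg _ ?_)
  rw [Coded.code_pair, Coded.code_pair]
  rfl

theorem input_nodes : I.input.nodes = card I.layout.Node := by
  rw [Input.nodes, input_coms, input_mains, input_rows, input_cols]; rfl

theorem input_tl (a : Fin I.numA) : I.input.tl a = (I.tail a : ℕ).bits := by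
  simp [Input.tl, input, List.getD_eq_getElem?_getD]

theorem input_hd (a : Fin I.numA) : I.input.hd a = (I.head a : ℕ).bits := by
  simp [Input.hd, input, List.getD_eq_getElem?_getD]

/-- The encoding of an arc of the network. -/
noncomputable def arcEntry (a : I.layout.Arc) : Entry :=
  Input.entry (code (Layout.tail a)).bits (code (Layout.head a)).bits (I.layout.capacity a)

/-- The summands of `ArcSum` are enumerated in order, and each kind of arc contributes one block of
the computed list. -/
theorem map_arcEntry : (enum I.layout.Arc).map I.arcEntry = I.input.directArcs ++
    (I.input.coreArcs ++ (I.input.origArcs ++ (I.input.linkArcs ++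
      (I.input.colArcs ++ I.input.rowArcs)))) := by
  have e : enum I.layout.Arc = (enum I.layout.ArcSum).map (Layout.arcEquiv _).symm := by
    rw [enum, enum, List.map_ofFn]; rfl
  rw [e, List.map_map]
  simp only [Input.directArcs, Input.coreArcs, Input.origArcs, Input.linkArcs, Input.colArcs,
    Input.rowArcs, List.append_assoc]
  -- The chains `false` and `true` of a column have the numbers 0 and 1.
  have hb : ∀ h : Bool, decide (code h = 1) = h := by decide
  have hm : card (Fin I.layout.numA) = I.input.m := (input_m I).symm
  have hc : card (Fin I.layout.cols) = I.input.cols := (input_cols I).symm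
  have hr : card (Fin (I.layout.rows + 1)) = I.input.rows := (input_rows I).symm
  have hM := (input_mains I).symm
  have hC := (input_coms I).symm
  refine map_enum_sum (map_enum_prod hC hM _ fun i c => ?_) ?_
  · change I.arcEntry (.directIn i c) = _
    simp only [arcEntry, Layout.tail, Layout.head, Layout.capacity, code_src, code_inn, input_direct]
  refine map_enum_sum (map_enum_prod hC hM _ fun i c => ?_) ?_
  · change I.arcEntry (.directOut i c) = _
    simp only [arcEntry, Layout.tail, Layout.head, Layout.capacity, code_out, code_snk, input_direct]
  refine map_enum_sum (map_enum hC _ fun i => ?_) ?_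
  · change I.arcEntry (.feed i) = _
    simp only [arcEntry, Layout.tail, Layout.head, Layout.capacity, code_src, code_entry, input_core]
  refine map_enum_sum (map_enum hC _ fun i => ?_) ?_
  · change I.arcEntry (.drain i) = _
    simp only [arcEntry, Layout.tail, Layout.head, Layout.capacity, code_exit, code_snk, input_core]
  refine map_enum_sum (map_enum hM _ fun c => ?_) ?_
  · change I.arcEntry (.main c) = _
    simp only [arcEntry, Layout.tail, Layout.head, Layout.capacity, code_inn, code_out, input_maxc]
  refine map_enum_sum (map_enum hm _ fun a => ?_) ?_
  · change I.arcEntry (.origIn a) = _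
    simp only [arcEntry, Layout.tail, Layout.head, Layout.capacity, code_orig, code_inn, Coded.code_inl, Coded.code_fin, input_tl]
  refine map_enum_sum (map_enum hm _ fun a => ?_) ?_
  · change I.arcEntry (.origOut a) = _
    simp only [arcEntry, Layout.tail, Layout.head, Layout.capacity, code_orig, code_out, Coded.code_inl, Coded.code_fin, input_hd]
  refine map_enum_sum (congrArg (fun x => [x]) (?_ : I.arcEntry .toOrig = _)) ?_
  · simp only [arcEntry, Layout.tail, Layout.head, Layout.capacity, code_entry, code_orig]
    exact congrArg (Input.entry _ _) (input_rhs I 0).symm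
  refine map_enum_sum (congrArg (fun x => [x]) (?_ : I.arcEntry .fromOrig = _)) ?_
  · simp only [arcEntry, Layout.tail, Layout.head, Layout.capacity, code_exit, code_orig]
    exact congrArg (Input.entry _ _) (input_rhs I 0).symm
  refine map_enum_sum (map_enum_prod hM hM _ fun a b => ?_) ?_
  · change I.arcEntry (.link a b) = _
    simp only [arcEntry, Layout.tail, Layout.head, Layout.capacity, code_out, code_inn, input_lk]
  refine map_enum_sum (map_enum hM _ fun a => ?_) ?_
  · change I.arcEntry (.linkIn a) = _
    simp only [arcEntry, Layout.tail, Layout.head, Layout.capacity, code_entry, code_lnk, code_inn, input_outdeg]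
  refine map_enum_sum (map_enum_prod hM hM _ fun a b => ?_) ?_
  · change I.arcEntry (.linkOut a b) = _
    simp only [arcEntry, Layout.tail, Layout.head, Layout.capacity, code_out, code_exit, code_lnk, input_lk]
  refine map_enum_sum (map_enum_prod_prod hc Coded.card_bool hr _ fun j h l => ?_) ?_
  · change I.arcEntry (.chainArc j h l) = _
    simp only [arcEntry, Layout.tail, Layout.head, Layout.capacity, code_chain, Coded.code_fin, Fin.val_castSucc, Fin.val_succ, input_m]
  refine map_enum_sum (map_enum_prod hc Coded.card_bool _ fun j h => ?_) ?_
  · change I.arcEntry (.colIn j h) = _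
    simp only [arcEntry, Layout.tail, Layout.head, Layout.capacity, code_chain, Coded.code_fin, code_entry, code_col, Fin.val_zero, input_m]
  refine map_enum_sum (map_enum_prod hc Coded.card_bool _ fun j h => ?_) ?_
  · change I.arcEntry (.colOut j h) = _
    simp only [arcEntry, Layout.tail, Layout.head, Layout.capacity, code_chain, Coded.code_fin, code_exit, code_col, Fin.val_last, input_m, input_rows]
  refine map_enum_sum (map_enum_prod_prod hr hc Coded.card_bool _ fun l j h => ?_) ?_
  · change I.arcEntry (.rowIn l j h) = _
    simp only [arcEntry, Layout.tail, Layout.head, Layout.capacity, code_chain, Coded.code_fin, code_entry, code_row, Fin.val_castSucc, input_m, hb, input_coef]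
  refine map_enum_prod_prod hr hc Coded.card_bool _ fun l j h => ?_
  · change I.arcEntry (.rowOut l j h) = _
    simp only [arcEntry, Layout.tail, Layout.head, Layout.capacity, code_chain, Coded.code_fin, code_exit, code_row, Fin.val_succ, input_m, hb, input_coef]

theorem map_comEntry : ((enum I.layout.Com).map fun i =>
      Input.entry (code (Layout.Node.src i : I.layout.Node)).bits
        (code (Layout.Node.snk i : I.layout.Node)).bits (I.layout.demand i)) =
    (List.range I.input.coms).map fun i =>
      Input.entry (I.input.src i).bits (I.input.snk i).bits (I.input.demand i) :=
  map_enum (input_coms I).symm _ fun i => by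
    simp only [code_src, code_snk, ← input_demand]

theorem output_reduction : I.reduction.output = I.input.compute := by
  have hk : I.layout.inst.k = I.k := Nat.sub_add_cancel I.one_le_k
  have hV := input_nodes I
  have hA := map_arcEntry I
  have hK := map_comEntry I
  unfold arcEntry at hA
  rw [reduction, Layout.toMRFM, Inst.output_toMRFM, hk]
  simp only [Layout.inst_tl, Layout.inst_hd, Layout.inst_cap, Layout.inst_src, Layout.inst_snk,
    Layout.inst_dem]
  rw [hA, hK, ← hV]
  rfl

/-- The program for `Input.compute` is run on arbitrary tuples, but its output is the encoding of
the reduction whenever the tuple encodes an instance, and the encodings agree tree by tree. -/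
theorem computable_reduction : ComputableInPolyTime encode MRFM.encode reduction := by
  obtain ⟨prog, q, h⟩ := Input.polyT_compute
  refine ⟨prog, q, fun I => ?_⟩
  obtain ⟨c, h₁, h₂⟩ := h I.input
  rw [← output_reduction, enc_input, MRFM.enc_output] at h₁
  rw [enc_input] at h₂
  exact ⟨c, h₁, h₂⟩

end MRFR

end RobustFlow

theorem theorem6 :
    ∃ T : MRFR → MRFM,
      ComputableInPolyTime MRFR.encode MRFM.encode T ∧
      -- the budget is preserved, and YES instances correspond, fractionally and integrally
      (∀ I : MRFR, (T I).k = I.k ∧ (I.IsYes ↔ (T I).IsYes) ∧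
        (I.IsIntegralYes ↔ (T I).IsIntegralYes)) ∧
      -- integral capacities, with maximum polynomial in the number of arcs
      (∃ p : Polynomial ℕ, ∀ I : MRFR,
        (∀ a, ∃ z : ℕ, (T I).cap a = z) ∧
        (T I).maxCap ≤ (p.eval (T I).numA : ℕ)) ∧
      ∀ I : MRFR,
        -- saturated sources and sinks
        (∀ i, ∑ a ∈ (T I).outArcs {(T I).src i}, (T I).cap a = (T I).dem i ∧
          ∑ a ∈ (T I).inArcs {(T I).snk i}, (T I).cap a = (T I).dem i ∧
          (T I).inArcs {(T I).src i} = ∅ ∧ (T I).outArcs {(T I).snk i} = ∅) ∧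
        -- the special commodity
        (∃ i₀ : Fin (T I).numK,
          ((∑ i ∈ Finset.univ.erase i₀, (T I).dem i : ℚ≥0) : ℚ) ≤ ((T I).maxCap : ℚ) - 3 ∧
          ∀ x, (T I).IsFlow x → ∀ i, i ≠ i₀ → ∀ a,
            ((T I).maxCap : ℚ) - 2 ≤ ((T I).cap a : ℚ) →
            2 ≤ arcFlow ((T I).commodityPaths i) x a) ∧
        -- the tight cut
        ∃ U : Finset (Fin (T I).numV),
          (∀ i, (T I).src i ∈ U) ∧ (∀ i, (T I).snk i ∉ U) ∧
          ∑ a ∈ (T I).outArcs U, (T I).cap a = ∑ i, (T I).dem i ∧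
          ((((T I).outArcs U).filter fun a => (T I).cap a = (T I).maxCap).card = (T I).k - 1) := by
  -- The two placeholders for witnesses are found by unification: the polynomial of
  -- `Layout.maxCap_le`, and the number of `com0` as the special commodity.
  refine ⟨MRFR.reduction, MRFR.computable_reduction, fun I => ⟨I.reduction_k, I.isYes_reduction,
    I.isIntegralYes_reduction⟩, ⟨_, fun I => ⟨fun a => ⟨_, rfl⟩,
    Layout.maxCap_le I.layout_valid le_rfl I.rhs_le⟩⟩, fun I =>
    ⟨Layout.saturated_terminals I.layout_valid, ⟨_, Layout.sum_dem_erase I.layout_valid,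
      fun x hx i hi a ha => Layout.two_le_arcFlow I.layout_valid hx hi ha⟩,
      Layout.exists_cut I.layout_valid⟩⟩
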